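/- Work over the category of $\mathbb{C}$-schemes. A complex algebraic group is a reduced group scheme of finite type over $\mathbb{C}$. Let $\Gamma$ be a complex algebraic group, let $Y$ be a $\mathbb{C}$-scheme with a left action of $\Gamma$, and let $G$ be an affine complex algebraic group. A principal $G$-bundle over a $\mathbb{C}$-scheme $U$ is a $U$-scheme with a right action of $G$ over $U$ that is étale-locally on $U$ equivariantly isomorphic to the trivial bundle $U\times G$; left principal $\Gamma$-bundles are defined in the same way. Let $[\Gamma\backslash Y]$ be the quotient stack: its objects over $U$ are left principal $\Gamma$-bundles $M\to U$ together with a $\Gamma$-equivariant map $M\to Y$, and its morphisms are $\Gamma$-equivariant pull-back diagrams compatible with the maps to $Y$. Let $\mathrm{Bun}_{\Gamma,G}Y$ be the category over $\mathbb{C}$-schemes whose objects over $T$ are the $(\Gamma,G)$-bundles over $Y\times T$, i.e. principal $G$-bundles $E\to Y\times T$ with a left action of $\Gamma$ on $E$ which commutes with the action of $G$ and for which $E\to Y\times T$ is $\Gamma$-equivariant ($\Gamma$ acting on $Y\times T$ through $Y$), and whose morphisms over $S\to T$ are the $\Gamma$-equivariant pull-back diagrams of $G$-bundles over $Y\times S\to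 Y\times T$. A principal $G$-bundle on a category $\mathfrak{X}$ fibred in groupoids over $\mathbb{C}$-schemes consists of a principal $G$-bundle $\mathscr{E}_f$ over $U$ for every morphism $f:U\to\mathfrak{X}$ from a $\mathbb{C}$-scheme that is representable (by schemes) and smooth, and of an isomorphism $\beta_k:\mathscr{E}_f\to k^*\mathscr{E}_g$ for every $k:U\to V$ with a $2$-isomorphism $f\cong g\circ k$, where $f$ and $g$ are such morphisms, compatible with composition. Let $\mathrm{Bun}_G\mathfrak{X}$ be the category over $\mathbb{C}$-schemes whose objects over $T$ are the principal $G$-bundles on $\mathfrak{X}\times T$ and whose morphisms over $h:S\to T$ are pull-back diagrams of principal $G$-bundles over $\mathrm{id}\times h:\mathfrak{X}\times S\to\mathfrak{X}\times T$, that is, families of pull-back diagrams $\mathscr{E}_f\to\mathscr{F}_g$ over $k$, one for each $2$-commutative square formed by $\mathrm{id}\times h$, representable smooth morphisms $f:U\to\mathfrak{X}\times S$ and $g:V\to\mathfrak{X}\times T$, and a morphism $k:U\to V$, compatible with the isomorphisms $\beta$ of $\mathscr{E}$ and $\mathscr{F}$. Then there is an equivalence $$\mathrm{Bun}_{\Gamma,G}Y\;\xrightarrow{\sim}\;\mathrm{Bun}_G[\Gamma\backslash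 Y]$$ of categories over the category of $\mathbb{C}$-schemes. -/

import Mathlib

open CategoryTheory AlgebraicGeometry Limits MonoidalCategory CartesianMonoidalCategory
open scoped MonObj

noncomputable section

namespace BundleStacks

/-- The category of schemes over `ℂ`. It carries Mathlib's cartesian monoidal structure: `X ⊗ Y` is
the fibre product over `Spec ℂ`, and a `GrpObj` is a group scheme over `ℂ`. -/
abbrev SchC : Type 1 := Over (Spec (CommRingCat.of ℂ))

/-- A complex algebraic group: a group object in the category of `ℂ`-schemes whose underlying
scheme is reduced and of finite type over `ℂ`. -/
class IsAlgebraicGroup (G : SchC) [GrpObj G] : Prop where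
  locallyOfFiniteType : LocallyOfFiniteType G.hom
  quasiCompact : QuasiCompact G.hom
  reduced : IsReduced G.left

/-! ### Principal bundles over schemes -/

/-- A (right) principal `G`-bundle over a `ℂ`-scheme `U`: a `U`-scheme with a fibrewise right action
of `G` which, after pull-back along an étale covering `c : V ⟶ U`, becomes equivariantly isomorphic
to the trivial bundle `V × G`. -/
structure PrincipalBundle (G : SchC) [GrpObj G] (U : SchC) where
  tot : SchC
  proj : tot ⟶ U
  act : tot ⊗ G ⟶ tot
  act_one : tot ◁ η[G] ≫ act = (ρ_ tot).hom
  act_mul : tot ◁ μ[G] ≫ act = (α_ tot G G).inv ≫ act ▷ G ≫ act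
  act_proj : act ≫ proj = fst tot G ≫ proj
  locallyTrivial : ∃ (V : SchC) (c : V ⟶ U) (t : V ⊗ G ⟶ tot),
    Etale c.left ∧ Surjective c.left ∧ IsPullback t (fst V G) proj c ∧
      V ◁ μ[G] ≫ t = (α_ V G G).inv ≫ t ▷ G ≫ act

namespace PrincipalBundle

variable {G : SchC} [GrpObj G]

/-- A morphism of principal `G`-bundles over `k : U ⟶ V`: a `G`-equivariant pull-back diagram.
For `k = 𝟙 U` these are the (iso)morphisms of `G`-bundles over `U`, and in general they are the
same as isomorphisms `E ≅ k^* F` of `G`-bundles over `U`. -/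
@[ext]
structure Hom {U V : SchC} (E : PrincipalBundle G U) (F : PrincipalBundle G V) (k : U ⟶ V) where
  hom : E.tot ⟶ F.tot
  isPullback : IsPullback hom E.proj F.proj k
  equivariant : E.act ≫ hom = hom ▷ G ≫ F.act

/-- The identity morphism. -/
def Hom.id {U : SchC} (E : PrincipalBundle G U) : E.Hom E (𝟙 U) where
  hom := 𝟙 _
  isPullback := IsPullback.of_horiz_isIso ⟨by simp⟩
  equivariant := by simp

/-- Composition of morphisms of principal bundles, over an arrow `m` equal to `k ≫ l`. -/
def Hom.comp {U V W : SchC} {E : PrincipalBundle G U} {F : PrincipalBundle G V}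
    {H : PrincipalBundle G W} {k : U ⟶ V} {l : V ⟶ W} {m : U ⟶ W} (φ : E.Hom F k)
    (ψ : F.Hom H l) (hm : k ≫ l = m) : E.Hom H m where
  hom := φ.hom ≫ ψ.hom
  isPullback := hm ▸ φ.isPullback.paste_horiz ψ.isPullback
  equivariant := by
    rw [← Category.assoc, φ.equivariant, Category.assoc, ψ.equivariant, comp_whiskerRight,
      Category.assoc]

end PrincipalBundle

/-- A left principal `Γ`-bundle over a `ℂ`-scheme `U` (étale locally trivial). -/
structure LeftPrincipalBundle (Γ : SchC) [GrpObj Γ] (U : SchC) where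
  tot : SchC
  proj : tot ⟶ U
  [act : ModObj Γ tot]
  act_proj : γ[Γ, tot] ≫ proj = snd Γ tot ≫ proj
  locallyTrivial : ∃ (V : SchC) (c : V ⟶ U) (t : Γ ⊗ V ⟶ tot),
    Etale c.left ∧ Surjective c.left ∧ IsPullback t (snd Γ V) proj c ∧
      μ[Γ] ▷ V ≫ t = (α_ Γ Γ V).hom ≫ Γ ◁ t ≫ γ[Γ, tot]

attribute [instance] LeftPrincipalBundle.act

/-! ### The quotient stack `[Γ \ Y]` -/

/-- An object of the quotient stack: a left principal `Γ`-bundle `M ⟶ U` with a `Γ`-equivariant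
map `M ⟶ Y`. -/
structure QuotientObj (Γ : SchC) [GrpObj Γ] (Y : SchC) [ModObj Γ Y] where
  base : SchC
  bundle : LeftPrincipalBundle Γ base
  toY : bundle.tot ⟶ Y
  equivariant : γ[Γ, bundle.tot] ≫ toY = Γ ◁ toY ≫ γ[Γ, Y]

namespace QuotientObj

variable {Γ : SchC} [GrpObj Γ] {Y : SchC} [ModObj Γ Y]

/-- A morphism of the quotient stack: a `Γ`-equivariant pull-back diagram over a morphism of base
schemes, compatible with the maps to `Y`. -/
@[ext]
structure Hom (a b : QuotientObj Γ Y) where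
  base : a.base ⟶ b.base
  tot : a.bundle.tot ⟶ b.bundle.tot
  isPullback : IsPullback tot a.bundle.proj b.bundle.proj base
  equivariant : γ[Γ, a.bundle.tot] ≫ tot = Γ ◁ tot ≫ γ[Γ, b.bundle.tot]
  toY : tot ≫ b.toY = a.toY

instance : Category (QuotientObj Γ Y) where
  Hom := Hom
  id a :=
    { base := 𝟙 _
      tot := 𝟙 _
      isPullback := IsPullback.of_horiz_isIso ⟨by simp⟩
      equivariant := by simp
      toY := by simp }
  comp f g :=
    { base := f.base ≫ g.base
      tot := f.tot ≫ g.tot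
      isPullback := f.isPullback.paste_horiz g.isPullback
      equivariant := by
        rw [← Category.assoc, f.equivariant, Category.assoc, g.equivariant,
          MonoidalCategory.whiskerLeft_comp, Category.assoc]
      toY := by rw [Category.assoc, g.toY, f.toY] }
  id_comp _ := by apply Hom.ext <;> exact Category.id_comp _
  comp_id _ := by apply Hom.ext <;> exact Category.comp_id _
  assoc _ _ _ := by apply Hom.ext <;> exact Category.assoc _ _ _

variable (Γ Y) in
/-- The projection of the quotient stack to the category of `ℂ`-schemes. -/
def forget : QuotientObj Γ Y ⥤ SchC where
  obj a := a.base
  map f := Hom.base f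

end QuotientObj

/-- The quotient stack `[Γ \ Y]`, as a category over the category of `ℂ`-schemes. -/
abbrev quotientStack (Γ : SchC) [GrpObj Γ] (Y : SchC) [ModObj Γ Y] : BasedCategory SchC :=
  BasedCategory.ofFunctor (QuotientObj.forget Γ Y)

/-- A category over the category of `ℂ`-schemes is fibred in groupoids if it is a fibred category
all of whose arrows are cartesian. -/
class IsFiberedInGroupoids (X : BasedCategory.{0, 1} SchC) : Prop where
  isFibered : X.p.IsFibered
  isStronglyCartesian {a b : X.obj} (φ : a ⟶ b) : X.p.IsStronglyCartesian (X.p.map φ) φ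

lemma map_eq_of_isHomLift {C D : Type*} [Category* C] [Category* D] {p : C ⥤ D} {a b : C}
    {f : p.obj a ⟶ p.obj b} {φ : a ⟶ b} (h : p.IsHomLift f φ) : p.map φ = f := by
  simpa using (IsHomLift.fac p f φ).symm

section pullback

variable {Γ : SchC} [GrpObj Γ] {Y : SchC} [ModObj Γ Y]

/-- The action map of `pullbackAction`. -/
def pullbackSmul {M U R : SchC} [ModObj Γ M] (q : M ⟶ U) (hq : γ[Γ, M] ≫ q = snd Γ M ≫ q)
    (f : R ⟶ U) : Γ ⊗ pullback q f ⟶ pullback q f :=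
  pullback.lift (Γ ◁ pullback.fst q f ≫ γ[Γ, M]) (snd Γ _ ≫ pullback.snd q f) (by
    rw [Category.assoc, hq, whiskerLeft_snd_assoc, Category.assoc, pullback.condition])

lemma pullbackSmul_fst {M U R : SchC} [ModObj Γ M] (q : M ⟶ U)
    (hq : γ[Γ, M] ≫ q = snd Γ M ≫ q) (f : R ⟶ U) :
    pullbackSmul q hq f ≫ pullback.fst q f = Γ ◁ pullback.fst q f ≫ γ[Γ, M] :=
  pullback.lift_fst _ _ _

lemma pullbackSmul_snd {M U R : SchC} [ModObj Γ M] (q : M ⟶ U)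
    (hq : γ[Γ, M] ≫ q = snd Γ M ≫ q) (f : R ⟶ U) :
    pullbackSmul q hq f ≫ pullback.snd q f = snd Γ _ ≫ pullback.snd q f :=
  pullback.lift_snd _ _ _

/-- The base change of a `Γ`-action along a map to a base on which `Γ` acts trivially. -/
abbrev pullbackAction {M U R : SchC} [ModObj Γ M] (q : M ⟶ U) (hq : γ[Γ, M] ≫ q = snd Γ M ≫ q)
    (f : R ⟶ U) : ModObj Γ (pullback q f) where
  smul := pullbackSmul q hq f
  one_smul := by
    change η[Γ] ▷ pullback q f ≫ pullbackSmul q hq f = (λ_ (pullback q f)).hom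
    apply pullback.hom_ext
    · rw [Category.assoc, pullbackSmul_fst, ← whisker_exchange_assoc, ModObj.one_smul_self,
        leftUnitor_naturality]
    · rw [Category.assoc, pullbackSmul_snd, whiskerRight_snd_assoc, leftUnitor_hom]
  mul_smul := by
    change μ[Γ] ▷ pullback q f ≫ pullbackSmul q hq f =
      (α_ Γ Γ (pullback q f)).hom ≫ Γ ◁ pullbackSmul q hq f ≫ pullbackSmul q hq f
    apply pullback.hom_ext
    · simp only [Category.assoc, pullbackSmul_fst]
      rw [← whisker_exchange_assoc, ModObj.mul_smul_self, ← whiskerLeft_comp_assoc,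
        pullbackSmul_fst]
      simp
    · simp [pullbackSmul_snd]

/-- The base change of a left principal bundle. -/
def LeftPrincipalBundle.baseChange {U R : SchC} (M : LeftPrincipalBundle Γ U) (f : R ⟶ U) :
    LeftPrincipalBundle Γ R :=
  letI := pullbackAction M.proj M.act_proj f
  { tot := pullback M.proj f
    proj := pullback.snd _ _
    act_proj := pullbackSmul_snd _ _ _
    locallyTrivial := by
      obtain ⟨V, c, t, hc, hs, ht, he⟩ := M.locallyTrivial
      have w : (Γ ◁ pullback.fst c f ≫ t) ≫ M.proj = (snd Γ _ ≫ pullback.snd c f) ≫ f := by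
        rw [Category.assoc, ht.w, whiskerLeft_snd_assoc, Category.assoc, pullback.condition]
      have hp : IsPullback (pullback.fst c f).left (pullback.snd c f).left c.left f.left :=
        (IsPullback.of_hasPullback c f).map (Over.forget _)
      obtain ⟨t', t1, t2⟩ : ∃ t' : Γ ⊗ pullback c f ⟶ pullback M.proj f,
          t' ≫ pullback.fst _ _ = Γ ◁ pullback.fst c f ≫ t ∧
          t' ≫ pullback.snd _ _ = snd Γ _ ≫ pullback.snd c f :=
        ⟨pullback.lift _ _ w, pullback.lift_fst _ _ w, pullback.lift_snd _ _ w⟩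
      refine ⟨pullback c f, pullback.snd c f, t', ?_, ?_, ?_, ?_⟩
      · exact MorphismProperty.of_isPullback (P := @Etale) hp hc
      · exact MorphismProperty.of_isPullback (P := @Surjective) hp hs
      · have h1 : IsPullback (Γ ◁ pullback.fst c f) (snd Γ _) (snd Γ V) (pullback.fst c f) := by
          refine IsPullback.of_isLimit' ⟨whiskerLeft_snd _ _⟩
            (PullbackCone.IsLimit.mk _ (fun s => lift (s.fst ≫ fst Γ V) s.snd) ?_ ?_ ?_)
          · intro s
            apply CartesianMonoidalCategory.hom_ext
            · simp
            · simpa using s.condition.symm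
          · intro s
            simp
          · intro s m h1 h2
            apply CartesianMonoidalCategory.hom_ext
            · simp [← h1]
            · simp [← h2]
        have h2 := h1.paste_horiz ht
        rw [pullback.condition] at h2
        refine IsPullback.of_right ?_ t2 (IsPullback.of_hasPullback M.proj f)
        rwa [t1]
      · change μ[Γ] ▷ pullback c f ≫ t' =
          (α_ Γ Γ (pullback c f)).hom ≫ Γ ◁ t' ≫ pullbackSmul M.proj M.act_proj f
        apply pullback.hom_ext
        · simp only [Category.assoc, pullbackSmul_fst, t1]
          rw [← whisker_exchange_assoc, he, ← whiskerLeft_comp_assoc, t1]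
          simp
        · simp [pullbackSmul_snd, t2] }

/-- The base change of an object of the quotient stack. -/
def QuotientObj.baseChange (a : QuotientObj Γ Y) {R : SchC} (f : R ⟶ a.base) :
    QuotientObj Γ Y where
  base := R
  bundle := a.bundle.baseChange f
  toY := pullback.fst a.bundle.proj f ≫ a.toY
  equivariant := by
    change pullbackSmul a.bundle.proj a.bundle.act_proj f ≫ pullback.fst a.bundle.proj f ≫ a.toY =
      Γ ◁ (pullback.fst a.bundle.proj f ≫ a.toY) ≫ γ[Γ, Y]
    rw [← Category.assoc, pullbackSmul_fst, Category.assoc, a.equivariant, MonoidalCategory.whiskerLeft_comp, Category.assoc]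

/-- The projection from the base change. -/
def QuotientObj.baseChangeHom (a : QuotientObj Γ Y) {R : SchC} (f : R ⟶ a.base) :
    a.baseChange f ⟶ a where
  base := f
  tot := pullback.fst _ _
  isPullback := IsPullback.of_hasPullback _ _
  equivariant := pullbackSmul_fst _ _ _
  toY := rfl

lemma QuotientObj.existsUnique_lift {a' a b : QuotientObj Γ Y} (φ : Hom a b) (φ' : Hom a' b)
    (g : a'.base ⟶ a.base) (e : g ≫ φ.base = φ'.base) :
    ∃ χ : Hom a' a, χ.base = g ∧ χ.tot ≫ φ.tot = φ'.tot ∧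
      ∀ ψ : Hom a' a, ψ.base = g → ψ.tot ≫ φ.tot = φ'.tot → ψ = χ := by
  have w : φ'.tot ≫ b.bundle.proj = (a'.bundle.proj ≫ g) ≫ φ.base := by
    rw [φ'.isPullback.w, Category.assoc, e]
  obtain ⟨t, t1, t2⟩ : ∃ t, t ≫ φ.tot = φ'.tot ∧ t ≫ a.bundle.proj = a'.bundle.proj ≫ g :=
    ⟨φ.isPullback.lift _ _ w, φ.isPullback.lift_fst _ _ w, φ.isPullback.lift_snd _ _ w⟩
  refine ⟨⟨g, t, ?_, ?_, ?_⟩, rfl, t1, ?_⟩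
  · refine IsPullback.of_right ?_ t2 φ.isPullback
    rw [t1, e]
    exact φ'.isPullback
  · apply φ.isPullback.hom_ext
    · rw [Category.assoc, Category.assoc, t1, φ'.equivariant, φ.equivariant, ← t1,
        MonoidalCategory.whiskerLeft_comp, Category.assoc]
    · rw [Category.assoc, Category.assoc, t2, a.bundle.act_proj, whiskerLeft_snd_assoc, t2,
        ← Category.assoc, a'.bundle.act_proj, Category.assoc]
  · rw [← φ.toY, ← φ'.toY, ← t1, Category.assoc]
  · intro ψ h1 h2
    refine Hom.ext h1 (φ.isPullback.hom_ext ?_ ?_)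
    · rw [h2, t1]
    · rw [t2, ψ.isPullback.w, h1]

lemma QuotientObj.isStronglyCartesian {a b : QuotientObj Γ Y} (φ : a ⟶ b) :
    (QuotientObj.forget Γ Y).IsStronglyCartesian ((QuotientObj.forget Γ Y).map φ) φ where
  universal_property' {a'} g φ' hφ' := by
    have e : g ≫ (QuotientObj.forget Γ Y).map φ = (QuotientObj.forget Γ Y).map φ' := by
      simpa using IsHomLift.fac (QuotientObj.forget Γ Y) (g ≫ (QuotientObj.forget Γ Y).map φ) φ'
    obtain ⟨χ, h1, h2, h3⟩ := QuotientObj.existsUnique_lift φ φ' g e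
    subst h1
    refine ⟨χ, ⟨IsHomLift.map (p := QuotientObj.forget Γ Y) (show a' ⟶ a from χ),
      Hom.ext e h2⟩, ?_⟩
    rintro ψ ⟨hψ, hψ'⟩
    refine h3 ψ ?_ (congrArg Hom.tot hψ')
    exact map_eq_of_isHomLift hψ

instance : IsFiberedInGroupoids (quotientStack Γ Y) where
  isFibered := Functor.IsFibered.of_exists_isStronglyCartesian fun a _ f =>
    ⟨QuotientObj.baseChange a f, QuotientObj.baseChangeHom a f,
      QuotientObj.isStronglyCartesian (QuotientObj.baseChangeHom a f)⟩
  isStronglyCartesian φ := QuotientObj.isStronglyCartesian φ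

end pullback

/-! ### Principal bundles on a category over the category of schemes -/

/-- The product `X × T` of a category `X` over `ℂ`-schemes and a `ℂ`-scheme `T`: its objects over
`U` are pairs of an object of `X` over `U` and a morphism `U ⟶ T`. -/
abbrev ProdScheme (X : BasedCategory.{0, 1} SchC) (T : SchC) : Type 1 := CostructuredArrow X.p T

/-- The projection of `X × T` to the category of `ℂ`-schemes. -/
abbrev ProdScheme.p (X : BasedCategory.{0, 1} SchC) (T : SchC) : ProdScheme X T ⥤ SchC :=
  CostructuredArrow.proj X.p T ⋙ X.p

/-- Let `Z` be fibred in groupoids over `ℂ`-schemes by `p`. An object `z` of `Z`, viewed as a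
morphism from the scheme `p z` to `Z`, is a smooth atlas if it is representable and smooth: for
every object `w`, viewed as a morphism from the scheme `p w` to `Z`, the fibre product
`p z ×_Z p w` is a scheme which is smooth over `p w`.
A scheme `W` with a morphism to `p z`, a morphism to `p w` and an isomorphism between the two
pull-backs of `z` and `w` to `W` is the same as an object over `W` with arrows to `z` and `w`, so
that the fibre product is a scheme exactly when `z` and `w` have a product in the category `Z`,
and in that case it is the scheme over which the product lies. -/
def IsSmoothAtlas {Z : Type 1} [Category.{0} Z] (p : Z ⥤ SchC) (z : Z) : Prop :=
  ∀ w : Z, ∃ (v : Z) (a : v ⟶ z) (b : v ⟶ w),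
    (∀ (u : Z) (f : u ⟶ z) (g : u ⟶ w), ∃! m : u ⟶ v, m ≫ a = f ∧ m ≫ b = g) ∧
      Smooth (p.map b).left

/-- A principal `G`-bundle on `Z`: a principal `G`-bundle `obj z` over `p z` for each smooth atlas
`z`, and for each arrow `k : z ⟶ w` between smooth atlases (that is, each morphism of schemes
`p z ⟶ p w` over `Z`) an isomorphism of `obj z` with the pull-back of `obj w`, given by a pull-back
diagram, compatible with composition. -/
structure PrincipalBundleOn (G : SchC) [GrpObj G] {Z : Type 1} [Category.{0} Z] (p : Z ⥤ SchC) where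
  obj (z : Z) (hz : IsSmoothAtlas p z) : PrincipalBundle G (p.obj z)
  map {z w : Z} (hz : IsSmoothAtlas p z) (hw : IsSmoothAtlas p w) (k : z ⟶ w) :
    (obj z hz).Hom (obj w hw) (p.map k)
  map_comp {z w v : Z} (hz : IsSmoothAtlas p z) (hw : IsSmoothAtlas p w) (hv : IsSmoothAtlas p v)
    (k : z ⟶ w) (l : w ⟶ v) : (map hz hv (k ≫ l)).hom = (map hz hw k).hom ≫ (map hw hv l).hom

lemma PrincipalBundleOn.map_id {G : SchC} [GrpObj G] {Z : Type 1} [Category.{0} Z] {p : Z ⥤ SchC}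
    (E : PrincipalBundleOn G p) {z : Z} (hz : IsSmoothAtlas p z) :
    (E.map hz hz (𝟙 z)).hom = 𝟙 _ := by
  have : IsIso (E.map hz hz (𝟙 z)).hom := by
    exact (E.map hz hz (𝟙 z)).isPullback.isIso_fst_of_isIso
  have h := E.map_comp hz hz hz (𝟙 z) (𝟙 z)
  rw [Category.comp_id] at h
  rw [← cancel_mono (E.map hz hz (𝟙 z)).hom, ← h, Category.id_comp]

section Bun

variable {G : SchC} [GrpObj G] {X : BasedCategory.{0, 1} SchC}

/-- A pull-back diagram, over `h : S ⟶ T`, from a principal `G`-bundle `E` on `X × S` to a principal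
`G`-bundle `F` on `X × T`: for each commutative square formed by a smooth atlas `x` of `X × S`, a
smooth atlas `y` of `X × T`, a morphism `k` from `x` to `y` and the morphism `X × S ⟶ X × T` induced
by `h`, a morphism of principal `G`-bundles `E x ⟶ F y` over `k`, compatible with the structure
morphisms of `E` and `F`. -/
@[ext]
structure PrincipalBundleOn.Hom {S T : SchC} (E : PrincipalBundleOn G (ProdScheme.p X S))
    (F : PrincipalBundleOn G (ProdScheme.p X T)) (h : S ⟶ T) where
  app (x : ProdScheme X S) (hx : IsSmoothAtlas (ProdScheme.p X S) x) (y : ProdScheme X T)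
    (hy : IsSmoothAtlas (ProdScheme.p X T) y) (k : x.left ⟶ y.left)
    (hk : X.p.map k ≫ y.hom = x.hom ≫ h) : (E.obj x hx).Hom (F.obj y hy) (X.p.map k)
  map_app {x' x : ProdScheme X S} (hx' : IsSmoothAtlas (ProdScheme.p X S) x')
    (hx : IsSmoothAtlas (ProdScheme.p X S) x) {y : ProdScheme X T} (hy : IsSmoothAtlas (ProdScheme.p X T) y)
    (a : x' ⟶ x) (k : x.left ⟶ y.left) (k' : x'.left ⟶ y.left)
    (hk : X.p.map k ≫ y.hom = x.hom ≫ h) (hk' : X.p.map k' ≫ y.hom = x'.hom ≫ h)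
    (e : a.left ≫ k = k') :
    (app x' hx' y hy k' hk').hom = (E.map hx' hx a).hom ≫ (app x hx y hy k hk).hom
  app_map {x : ProdScheme X S} (hx : IsSmoothAtlas (ProdScheme.p X S) x) {y y' : ProdScheme X T}
    (hy : IsSmoothAtlas (ProdScheme.p X T) y) (hy' : IsSmoothAtlas (ProdScheme.p X T) y')
    (k : x.left ⟶ y.left) (b : y ⟶ y') (k' : x.left ⟶ y'.left)
    (hk : X.p.map k ≫ y.hom = x.hom ≫ h) (hk' : X.p.map k' ≫ y'.hom = x.hom ≫ h)
    (e : k ≫ b.left = k') :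
    (app x hx y' hy' k' hk').hom = (app x hx y hy k hk).hom ≫ (F.map hy hy' b).hom

/-- Smooth atlases of `X × T` can be pulled back to `X × S` along `h : S ⟶ T`. -/
lemma exists_baseChange [IsFiberedInGroupoids X] {S T : SchC} (h : S ⟶ T) (z : ProdScheme X T)
    (hz : IsSmoothAtlas (ProdScheme.p X T) z) :
    ∃ (z' : ProdScheme X S) (π : z'.left ⟶ z.left), IsSmoothAtlas (ProdScheme.p X S) z' ∧
      X.p.map π ≫ z.hom = z'.hom ≫ h ∧
      ∀ (x : ProdScheme X S) (k : x.left ⟶ z.left), X.p.map k ≫ z.hom = x.hom ≫ h →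
        ∃! a : x ⟶ z', a.left ≫ π = k := by
  have := IsFiberedInGroupoids.isFibered (X := X)
  obtain ⟨b', φ, hφ⟩ := Functor.IsPreFibered.exists_isCartesian' (p := X.p) (pullback.fst z.hom h)
  obtain ⟨s, hs⟩ : ∃ s : X.p.obj b' ⟶ S, IsPullback (X.p.map φ) s z.hom h := by
    have e := IsHomLift.fac' X.p (pullback.fst z.hom h) φ
    refine ⟨eqToHom (IsHomLift.domain_eq X.p (pullback.fst z.hom h) φ) ≫ pullback.snd z.hom h, ?_⟩
    refine IsPullback.of_iso (IsPullback.of_hasPullback z.hom h)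
      (eqToIso (IsHomLift.domain_eq X.p (pullback.fst z.hom h) φ).symm) (Iso.refl _) (Iso.refl _)
      (Iso.refl _) ?_ ?_ ?_ ?_ <;> simp [e]
  have key : ∀ (x : ProdScheme X S) (k : x.left ⟶ z.left), X.p.map k ≫ z.hom = x.hom ≫ h →
        ∃! a : x ⟶ (CostructuredArrow.mk s : ProdScheme X S), a.left ≫ φ = k := by
    intro x k hk
    have := IsFiberedInGroupoids.isStronglyCartesian φ
    let l := hs.lift _ _ hk
    have l1 : l ≫ X.p.map φ = X.p.map k := hs.lift_fst _ _ hk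
    have l2 : l ≫ s = x.hom := hs.lift_snd _ _ hk
    have : X.p.IsHomLift (l ≫ X.p.map φ) k := by rw [l1]; infer_instance
    obtain ⟨χ, ⟨hχ, hχφ⟩, hu⟩ :=
      Functor.IsStronglyCartesian.universal_property' (p := X.p) (f := X.p.map φ) (φ := φ) l k
    have pχ : X.p.map χ = l := map_eq_of_isHomLift hχ
    refine ⟨CostructuredArrow.homMk χ (by simpa [pχ] using l2), hχφ, fun a ha => ?_⟩
    ext
    refine hu _ ⟨?_, ha⟩
    have : X.p.map a.left = l := by
      apply hs.hom_ext
      · rw [l1, ← ha, X.p.map_comp]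
      · rw [l2]
        exact CostructuredArrow.w a
    rw [← this]
    infer_instance
  refine ⟨CostructuredArrow.mk s, φ, ?_, hs.w, key⟩
  intro w
  obtain ⟨c, c₁, c₂, hc, hsm⟩ := hz (CostructuredArrow.mk (w.hom ≫ h))
  have e₁ : X.p.map c₁.left ≫ z.hom = c.hom := CostructuredArrow.w c₁
  have e₂ : X.p.map c₂.left ≫ w.hom ≫ h = c.hom := CostructuredArrow.w c₂
  have hsw : X.p.map φ ≫ z.hom = s ≫ h := hs.w
  let d₂ : c.left ⟶ w.left := c₂.left
  let v : ProdScheme X S := CostructuredArrow.mk (X.p.map d₂ ≫ w.hom)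
  obtain ⟨a, ha, -⟩ := key v c₁.left (by
    rw [e₁, ← e₂]; exact (Category.assoc _ _ _).symm)
  let b : v ⟶ w := CostructuredArrow.homMk d₂ rfl
  refine ⟨v, a, b, fun u f g => ?_, hsm⟩
  have t₁ : X.p.map f.left ≫ s = u.hom := CostructuredArrow.w f
  have t₂ : X.p.map g.left ≫ w.hom = u.hom := CostructuredArrow.w g
  let f' : u.left ⟶ b' := f.left
  let q₁ : (CostructuredArrow.mk (u.hom ≫ h) : ProdScheme X T) ⟶ z :=
    CostructuredArrow.homMk (f' ≫ φ) (by
      rw [X.p.map_comp, Category.assoc, hsw, ← Category.assoc, t₁]; rfl)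
  let q₂ : (CostructuredArrow.mk (u.hom ≫ h) : ProdScheme X T) ⟶
      CostructuredArrow.mk (w.hom ≫ h) :=
    CostructuredArrow.homMk g.left (by
      rw [← t₂]; exact (Category.assoc _ _ _).symm)
  obtain ⟨r, ⟨r₁, r₂⟩, hr⟩ := hc _ q₁ q₂
  have r₁' : r.left ≫ c₁.left = f' ≫ φ := congrArg CommaMorphism.left r₁
  have r₂' : r.left ≫ d₂ = g.left := congrArg CommaMorphism.left r₂
  let m : u ⟶ v := CostructuredArrow.homMk r.left (by
    change X.p.map r.left ≫ X.p.map d₂ ≫ w.hom = u.hom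
    rw [← Category.assoc, ← X.p.map_comp]
    exact (congrArg (fun k => X.p.map k ≫ w.hom) r₂').trans t₂)
  refine ⟨m, ⟨?_, ?_⟩, ?_⟩
  · refine (key u (f' ≫ φ) ?_).unique ?_ rfl
    · rw [X.p.map_comp, Category.assoc, hsw, ← Category.assoc, t₁]
    · refine Eq.trans ?_ r₁'
      rw [← ha]
      exact Category.assoc _ _ _
  · ext
    exact r₂'
  · rintro m' ⟨m₁, m₂⟩
    have m₁' : m'.left ≫ a.left = f.left := congrArg CommaMorphism.left m₁
    have m₂' : m'.left ≫ d₂ = g.left := congrArg CommaMorphism.left m₂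
    let n : (CostructuredArrow.mk (u.hom ≫ h) : ProdScheme X T) ⟶ c :=
      CostructuredArrow.homMk m'.left (by
        change X.p.map m'.left ≫ c.hom = u.hom ≫ h
        have m₃ : X.p.map m'.left ≫ X.p.map d₂ = X.p.map g.left := by
          rw [← m₂']; exact (X.p.map_comp _ _).symm
        have e₂' : X.p.map d₂ ≫ w.hom ≫ h = c.hom := e₂
        rw [← e₂', ← t₂, ← m₃, Category.assoc, Category.assoc])
    have : n = r := by
      refine hr n ⟨?_, ?_⟩
      · ext
        change m'.left ≫ c₁.left = f' ≫ φ
        rw [← ha]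
        refine (Category.assoc _ _ _).symm.trans ?_
        exact congrArg (fun k => k ≫ φ) m₁'
      · ext
        exact m₂'
    ext
    exact congrArg (fun k : (CostructuredArrow.mk (u.hom ≫ h) : ProdScheme X T) ⟶ c => k.left) this

namespace PrincipalBundleOn.Hom

/-- The identity pull-back diagram. -/
def id {S : SchC} (E : PrincipalBundleOn G (ProdScheme.p X S)) : E.Hom E (𝟙 S) where
  app x hx y hy k hk := E.map hx hy (CostructuredArrow.homMk k (hk.trans (Category.comp_id _)))
  map_app {x' x} hx' hx {y} hy a k k' hk hk' e := by
    rw [← E.map_comp]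
    exact congrArg (fun l => (E.map hx' hy l).hom) (CostructuredArrow.hom_ext _ _ e.symm)
  app_map {x} hx {y y'} hy hy' k b k' hk hk' e := by
    rw [← E.map_comp]
    exact congrArg (fun l => (E.map hx hy' l).hom) (CostructuredArrow.hom_ext _ _ e.symm)

section comp

variable [IsFiberedInGroupoids X] {S T V : SchC} {E : PrincipalBundleOn G (ProdScheme.p X S)}
  {F : PrincipalBundleOn G (ProdScheme.p X T)} {H : PrincipalBundleOn G (ProdScheme.p X V)}
  {h : S ⟶ T} {h' : T ⟶ V}

/-- The value of a composite of pull-back diagrams at `k : x ⟶ z` is the composite of the values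
along any factorization of `k` through a smooth atlas; the resulting morphism exists and does not
depend on the factorization. -/
lemma exists_comp (φ : E.Hom F h) (ψ : F.Hom H h') (x : ProdScheme X S)
    (hx : IsSmoothAtlas (ProdScheme.p X S) x) (z : ProdScheme X V)
    (hz : IsSmoothAtlas (ProdScheme.p X V) z) (k : x.left ⟶ z.left)
    (hk : X.p.map k ≫ z.hom = x.hom ≫ h ≫ h') :
    ∃ χ : (E.obj x hx).Hom (H.obj z hz) (X.p.map k),
      ∀ (y : ProdScheme X T) (hy : IsSmoothAtlas (ProdScheme.p X T) y) (a : x.left ⟶ y.left)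
        (b : y.left ⟶ z.left) (ha : X.p.map a ≫ y.hom = x.hom ≫ h)
        (hb : X.p.map b ≫ z.hom = y.hom ≫ h'), a ≫ b = k →
        χ.hom = (φ.app x hx y hy a ha).hom ≫ (ψ.app y hy z hz b hb).hom := by
  obtain ⟨z', π, hz', hπ, key⟩ := exists_baseChange h' z hz
  obtain ⟨c, hc, -⟩ := key (CostructuredArrow.mk (x.hom ≫ h)) k (by
    rw [hk]; exact (Category.assoc _ _ _).symm)
  let c' : x.left ⟶ z'.left := c.left
  have hc' : X.p.map c' ≫ z'.hom = x.hom ≫ h := CostructuredArrow.w c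
  have hcπ : c' ≫ π = k := hc
  refine ⟨(φ.app x hx z' hz' c' hc').comp (ψ.app z' hz' z hz π hπ) 
    ((X.p.map_comp c' π).symm.trans (congrArg X.p.map hcπ)), ?_⟩
  intro y hy a b ha hb hab
  obtain ⟨d, hd, -⟩ := key y b hb
  rw [ψ.map_app hy hz' hz d π b hπ hb hd, ← Category.assoc,
    ← φ.app_map hx hy hz' a d c' ha hc']
  · rfl
  · let a' : (CostructuredArrow.mk (x.hom ≫ h) : ProdScheme X T) ⟶ y :=
      CostructuredArrow.homMk a ha
    have : a' ≫ d = c := by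
      refine (key (CostructuredArrow.mk (x.hom ≫ h)) k ?_).unique ?_ hc
      · rw [hk]; exact (Category.assoc _ _ _).symm
      · change (a ≫ d.left) ≫ π = k
        rw [Category.assoc, hd, hab]
    exact congrArg
      (fun l : (CostructuredArrow.mk (x.hom ≫ h) : ProdScheme X T) ⟶ z' => l.left) this

/-- Any arrow over `h ≫ h'` with smooth source and target factors through a smooth atlas. -/
lemma exists_factor (h : S ⟶ T) (h' : T ⟶ V) (x : ProdScheme X S) (z : ProdScheme X V)
    (hz : IsSmoothAtlas (ProdScheme.p X V) z) (k : x.left ⟶ z.left)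
    (hk : X.p.map k ≫ z.hom = x.hom ≫ h ≫ h') :
    ∃ (y : ProdScheme X T) (_ : IsSmoothAtlas (ProdScheme.p X T) y) (a : x.left ⟶ y.left)
      (b : y.left ⟶ z.left), X.p.map a ≫ y.hom = x.hom ≫ h ∧ X.p.map b ≫ z.hom = y.hom ≫ h' ∧
        a ≫ b = k := by
  obtain ⟨z', π, hz', hπ, key⟩ := exists_baseChange h' z hz
  obtain ⟨c, hc, -⟩ := key (CostructuredArrow.mk (x.hom ≫ h)) k (by
    rw [hk]; exact (Category.assoc _ _ _).symm)
  exact ⟨z', hz', c.left, π, CostructuredArrow.w c, hπ, hc⟩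

/-- The composite of two pull-back diagrams of principal bundles. -/
def comp (φ : E.Hom F h) (ψ : F.Hom H h') : E.Hom H (h ≫ h') where
  app x hx z hz k hk := (exists_comp φ ψ x hx z hz k hk).choose
  map_app {x' x} hx' hx {z} hz a k k' hk hk' e := by
    obtain ⟨y, hy, c, b, hc, hb, hcb⟩ := exists_factor h h' x z hz k hk
    have hac : X.p.map (a.left ≫ c) ≫ y.hom = x'.hom ≫ h := by
      have := CostructuredArrow.w a
      rw [X.p.map_comp, Category.assoc, hc, ← Category.assoc, this]
    rw [(exists_comp φ ψ x' hx' z hz k' hk').choose_spec y hy (a.left ≫ c) b hac hb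
        (by rw [Category.assoc, hcb, e]),
      (exists_comp φ ψ x hx z hz k hk).choose_spec y hy c b hc hb hcb,
      φ.map_app hx' hx hy a c _ hc hac rfl, Category.assoc]
  app_map {x} hx {z z'} hz hz' k b k' hk hk' e := by
    obtain ⟨y, hy, c, d, hc, hd, hcd⟩ := exists_factor h h' x z hz k hk
    have hdb : X.p.map (d ≫ b.left) ≫ z'.hom = y.hom ≫ h' := by
      have := CostructuredArrow.w b
      rw [X.p.map_comp, Category.assoc, this, hd]
    rw [(exists_comp φ ψ x hx z' hz' k' hk').choose_spec y hy c (d ≫ b.left) hc hdb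
        (by rw [← Category.assoc, hcd, e]),
      (exists_comp φ ψ x hx z hz k hk).choose_spec y hy c d hc hd hcd,
      ψ.app_map hy hz hz' d b _ hd hdb rfl, Category.assoc]

lemma comp_app (φ : E.Hom F h) (ψ : F.Hom H h') {x : ProdScheme X S}
    (hx : IsSmoothAtlas (ProdScheme.p X S) x) {y : ProdScheme X T}
    (hy : IsSmoothAtlas (ProdScheme.p X T) y) {z : ProdScheme X V}
    (hz : IsSmoothAtlas (ProdScheme.p X V) z) (a : x.left ⟶ y.left) (b : y.left ⟶ z.left)
    (k : x.left ⟶ z.left) (ha : X.p.map a ≫ y.hom = x.hom ≫ h)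
    (hb : X.p.map b ≫ z.hom = y.hom ≫ h') (hk : X.p.map k ≫ z.hom = x.hom ≫ h ≫ h')
    (e : a ≫ b = k) :
    ((φ.comp ψ).app x hx z hz k hk).hom =
      (φ.app x hx y hy a ha).hom ≫ (ψ.app y hy z hz b hb).hom :=
  (exists_comp φ ψ x hx z hz k hk).choose_spec y hy a b ha hb e

end comp

end PrincipalBundleOn.Hom

end Bun

/-- An object of `Bun_G X` over a `ℂ`-scheme: a principal `G`-bundle on the product of `X` with that
scheme. -/
structure BunObj (G : SchC) [GrpObj G] (X : BasedCategory.{0, 1} SchC) where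
  base : SchC
  bundle : PrincipalBundleOn G (ProdScheme.p X base)

namespace BunObj

variable {G : SchC} [GrpObj G] {X : BasedCategory.{0, 1} SchC}

/-- A morphism of `Bun_G X`: a morphism of base schemes and a pull-back diagram over it. -/
structure Hom (a b : BunObj G X) where
  base : a.base ⟶ b.base
  map : a.bundle.Hom b.bundle base

lemma Hom.ext' {a b : BunObj G X} {f g : Hom a b} (h : f.base = g.base)
    (h' : ∀ x hx y hy k hk hk',
      (f.map.app x hx y hy k hk).hom = (g.map.app x hx y hy k hk').hom) : f = g := by
  obtain ⟨f₀, f₁⟩ := f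
  obtain ⟨g₀, g₁⟩ := g
  obtain rfl : f₀ = g₀ := h
  congr 1
  ext x hx y hy k : 6
  funext hk
  exact PrincipalBundle.Hom.ext (h' x hx y hy k hk hk)

instance [IsFiberedInGroupoids X] : Category.{1} (BunObj G X) where
  Hom := Hom
  id a := ⟨𝟙 _, .id _⟩
  comp f g := ⟨f.base ≫ g.base, f.map.comp g.map⟩
  id_comp {a b} f := by
    refine Hom.ext' (Category.id_comp _) fun x hx y hy k hk hk' => ?_
    refine (PrincipalBundleOn.Hom.comp_app _ _ hx hx hy (𝟙 _) k k (by simp) hk' hk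
      (Category.id_comp _)).trans ?_
    exact (congrArg (· ≫ _) (a.bundle.map_id hx)).trans (Category.id_comp _)
  comp_id {a b} f := by
    refine Hom.ext' (Category.comp_id _) fun x hx y hy k hk hk' => ?_
    refine (PrincipalBundleOn.Hom.comp_app _ _ hx hy hy k (𝟙 _) k hk' (by simp) hk
      (Category.comp_id _)).trans ?_
    exact (congrArg (_ ≫ ·) (b.bundle.map_id hy)).trans (Category.comp_id _)
  assoc {a b c d} f g h := by
    refine Hom.ext' (Category.assoc _ _ _) fun x hx w hw k hk hk' => ?_
    obtain ⟨z, hz, k₁, k₂, h₁, h₂, e₁⟩ := PrincipalBundleOn.Hom.exists_factor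
      (f.base ≫ g.base) h.base x w hw k hk
    obtain ⟨y, hy, l₁, l₂, h₃, h₄, e₂⟩ := PrincipalBundleOn.Hom.exists_factor
      f.base g.base x z hz k₁ h₁
    have h₅ : X.p.map (l₂ ≫ k₂) ≫ w.hom = y.hom ≫ g.base ≫ h.base := by
      rw [X.p.map_comp, Category.assoc, h₂, ← Category.assoc, h₄, Category.assoc]
    refine (PrincipalBundleOn.Hom.comp_app (f.map.comp g.map) h.map hx hz hw k₁ k₂ k h₁ h₂ hk
      e₁).trans ?_
    refine Eq.trans ?_ (PrincipalBundleOn.Hom.comp_app f.map (g.map.comp h.map) hx hy hw l₁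
      (l₂ ≫ k₂) k h₃ h₅ hk' (by rw [← Category.assoc, e₂, e₁])).symm
    rw [PrincipalBundleOn.Hom.comp_app f.map g.map hx hy hz l₁ l₂ k₁ h₃ h₄ h₁ e₂,
      PrincipalBundleOn.Hom.comp_app g.map h.map hy hz hw l₂ k₂ (l₂ ≫ k₂) h₄ h₂ h₅ rfl,
      Category.assoc]

variable (G X) in
/-- The projection of `Bun_G X` to the category of `ℂ`-schemes. -/
def forget [IsFiberedInGroupoids X] : BunObj G X ⥤ SchC where
  obj a := a.base
  map f := Hom.base f

end BunObj

/-- The fibred category `Bun_G X` of principal `G`-bundles on `X`, for `X` fibred in groupoids over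
`ℂ`-schemes. -/
abbrev Bun (G : SchC) [GrpObj G] (X : BasedCategory.{0, 1} SchC) [IsFiberedInGroupoids X] :
    BasedCategory SchC :=
  BasedCategory.ofFunctor (BunObj.forget G X)

/-! ### `(Γ, G)`-bundles -/

/-- The action of `Γ` on `Y × T` induced by its action on `Y`. -/
def prodAction (Γ : SchC) [GrpObj Γ] (Y : SchC) [ModObj Γ Y] (T : SchC) : Γ ⊗ (Y ⊗ T) ⟶ Y ⊗ T :=
  (α_ Γ Y T).inv ≫ γ[Γ, Y] ▷ T

/-- An object of `Bun_{Γ, G} Y` over `base`: a `(Γ, G)`-bundle over `Y × base`, that is, a principal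
`G`-bundle over `Y × base` with a left action of `Γ` on its total space which makes the projection
equivariant and commutes with the action of `G`. -/
structure EquivariantBunObj (Γ : SchC) [GrpObj Γ] (G : SchC) [GrpObj G] (Y : SchC)
    [ModObj Γ Y] where
  base : SchC
  bundle : PrincipalBundle G (Y ⊗ base)
  [act : ModObj Γ bundle.tot]
  act_proj : γ[Γ, bundle.tot] ≫ bundle.proj = Γ ◁ bundle.proj ≫ prodAction Γ Y base
  act_comm : Γ ◁ bundle.act ≫ γ[Γ, bundle.tot] =
    (α_ Γ bundle.tot G).inv ≫ γ[Γ, bundle.tot] ▷ G ≫ bundle.act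

attribute [instance] EquivariantBunObj.act

namespace EquivariantBunObj

variable {Γ : SchC} [GrpObj Γ] {G : SchC} [GrpObj G] {Y : SchC} [ModObj Γ Y]

/-- A morphism of `Bun_{Γ, G} Y`: a morphism `base : S ⟶ T` of base schemes and a `Γ`-equivariant
pull-back diagram of principal `G`-bundles over `Y × S ⟶ Y × T`. -/
structure Hom (a b : EquivariantBunObj Γ G Y) where
  base : a.base ⟶ b.base
  map : a.bundle.Hom b.bundle (Y ◁ base)
  equivariant : γ[Γ, a.bundle.tot] ≫ map.hom = Γ ◁ map.hom ≫ γ[Γ, b.bundle.tot]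

lemma Hom.ext' {a b : EquivariantBunObj Γ G Y} {f g : Hom a b} (h : f.base = g.base)
    (h' : f.map.hom = g.map.hom) : f = g := by
  obtain ⟨f₀, f₁, f₂⟩ := f
  obtain ⟨g₀, g₁, g₂⟩ := g
  obtain rfl : f₀ = g₀ := h
  congr 1
  exact PrincipalBundle.Hom.ext h'

instance : Category (EquivariantBunObj Γ G Y) where
  Hom := Hom
  id a :=
    { base := 𝟙 _
      map := (PrincipalBundle.Hom.id a.bundle).comp (PrincipalBundle.Hom.id a.bundle) (by simp)
      equivariant := by simp [PrincipalBundle.Hom.comp, PrincipalBundle.Hom.id] }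
  comp f g :=
    { base := f.base ≫ g.base
      map := f.map.comp g.map (by simp)
      equivariant := by
        change _ ≫ f.map.hom ≫ g.map.hom = Γ ◁ (f.map.hom ≫ g.map.hom) ≫ _
        rw [← Category.assoc, f.equivariant, Category.assoc, g.equivariant,
          MonoidalCategory.whiskerLeft_comp, Category.assoc] }
  id_comp f := Hom.ext' (Category.id_comp _) (by
    simp [PrincipalBundle.Hom.comp, PrincipalBundle.Hom.id])
  comp_id f := Hom.ext' (Category.comp_id _) (by
    simp [PrincipalBundle.Hom.comp, PrincipalBundle.Hom.id])
  assoc f g h := Hom.ext' (Category.assoc _ _ _) (Category.assoc _ _ _)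

variable (Γ G Y) in
/-- The projection of `Bun_{Γ, G} Y` to the category of `ℂ`-schemes. -/
def forget : EquivariantBunObj Γ G Y ⥤ SchC where
  obj a := a.base
  map f := Hom.base f

end EquivariantBunObj

/-- The fibred category `Bun_{Γ, G} Y` of `(Γ, G)`-bundles on `Y`. -/
abbrev EquivariantBun (Γ : SchC) [GrpObj Γ] (G : SchC) [GrpObj G] (Y : SchC) [ModObj Γ Y] :
    BasedCategory SchC :=
  BasedCategory.ofFunctor (EquivariantBunObj.forget Γ G Y)

/-- Two categories over the category of `ℂ`-schemes are equivalent: there are functors over the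
base in both directions whose composites are isomorphic, over the base, to the identities. -/
def IsEquivalent (X : BasedCategory.{0, 1} SchC) (Z : BasedCategory.{1, 1} SchC) : Prop :=
  ∃ (F : BasedFunctor X Z) (R : BasedFunctor Z X),
    Nonempty (F.comp R ≅ BasedFunctor.id X) ∧ Nonempty (R.comp F ≅ BasedFunctor.id Z)

end BundleStacks

end

namespace BundleStacks

noncomputable section

/-! ### Descent along coverings of schemes -/

section DescentRel

universe v u

variable {C : Type u} [Category.{v} C]

/-! An object of `[Γ\Y] × S` over `U` is a `Γ`-torsor `M → U` with an equivariant map `M → Y × S`. A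
`(Γ, G)`-bundle `P` on `Y × S` pulls back to a `G`-bundle on `M` with a compatible `Γ`-action, and
this descends along the smooth surjection `M → U` to a `G`-bundle on `U`
(`PrincipalBundle.exists_quotient`). The bundles so obtained form a principal bundle on the stack.
Conversely, `Y × S` with its trivial torsor is a smooth atlas `zObj`: its product with an object `x`
is the trivial object `triv x` on the total space `M`, and `M → U` is smooth because a reduced group
of finite type over `ℂ` is smooth. A bundle `E` on the stack is evaluated at this atlas, and the two
projections from the product of `zObj` with itself, which lies over `Γ × Y × S`, give the `Γ`-action
on the value.

The two constructions are not compared by formulas. They are tied together by the relation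
`Realization P E`: for every atlas, the pull-backs to `M` of `P` and of the value of `E` are
identified, invariantly under `Γ` and naturally in the atlas. Every `P` is realized by some `E`
(`exists_realization`), every `E` realizes some `P` (`exists_equivariant`), and morphisms on the two
sides correspond bijectively (`exists_compat_right`, `exists_compat_left`, `Compat.left_unique`,
`Compat.right_unique`). Functors defined by choosing realizations are then automatically
quasi-inverse over the base.

The geometric input is effective descent. A descent datum on `N → V` along `V → U` is encoded as an
equivalence relation on the `T`-points of `N` by which a point can be moved, in exactly one way,
over any point of `V` with the same image in `U`; for a torsor it is the relation of lying in one
`Γ`-orbit. It is effective here because `G` is affine, so that a `G`-bundle becomes affine over its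
base after an étale base change. One reduces to an affine base by gluing, then to an affine covering
by refinement, and there it is flat descent of algebras (`isPushout_equalizer_of_descent`). The
action of `G` descends because it commutes with `Γ`, and the quotient is étale-locally trivial
because torsors have sections étale-locally. -/

lemma isPullback_of_existsUnique {P X Y Z : C} {fst : P ⟶ X} {snd : P ⟶ Y} {f : X ⟶ Z} {g : Y ⟶ Z}
    (w : fst ≫ f = snd ≫ g)
    (H : ∀ (T : C) (a : T ⟶ X) (b : T ⟶ Y), a ≫ f = b ≫ g → ∃ l : T ⟶ P, l ≫ fst = a ∧ l ≫ snd = b)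
    (H' : ∀ (T : C) (l l' : T ⟶ P), l ≫ fst = l' ≫ fst → l ≫ snd = l' ≫ snd → l = l') :
    IsPullback fst snd f g :=
  .of_isLimit' ⟨w⟩ (PullbackCone.IsLimit.mk _ (fun s => (H _ s.fst s.snd s.condition).choose)
    (fun s => (H _ s.fst s.snd s.condition).choose_spec.1)
    (fun s => (H _ s.fst s.snd s.condition).choose_spec.2)
    (fun s _ h₁ h₂ => H' _ _ _ (h₁.trans (H _ s.fst s.snd s.condition).choose_spec.1.symm)
      (h₂.trans (H _ s.fst s.snd s.condition).choose_spec.2.symm)))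

/-- A descent datum on `g : N ⟶ V` along `f : V ⟶ U`, given by the equivalence relation on the
points of `N` whose quotient is the descended object. -/
structure DescentRel {N V U : C} (g : N ⟶ V) (f : V ⟶ U) where
  rel : ∀ {T : C}, (T ⟶ N) → (T ⟶ N) → Prop
  refl : ∀ {T : C} (n : T ⟶ N), rel n n
  symm : ∀ {T : C} {n n' : T ⟶ N}, rel n n' → rel n' n
  trans : ∀ {T : C} {n n' n'' : T ⟶ N}, rel n n' → rel n' n'' → rel n n''
  precomp : ∀ {T' T : C} (t : T' ⟶ T) {n n' : T ⟶ N}, rel n n' → rel (t ≫ n) (t ≫ n')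
  comp_eq : ∀ {T : C} {n n' : T ⟶ N}, rel n n' → n ≫ g ≫ f = n' ≫ g ≫ f
  lift : ∀ {T : C} (n : T ⟶ N) (v : T ⟶ V), v ≫ f = n ≫ g ≫ f → ∃ n', rel n n' ∧ n' ≫ g = v
  uniq : ∀ {T : C} {n n' : T ⟶ N}, rel n n' → n ≫ g = n' ≫ g → n = n'

namespace DescentRel

variable {N V U : C} {g : N ⟶ V} {f : V ⟶ U}

/-- `q : N ⟶ N₀` exhibits `h : N₀ ⟶ U` as the object obtained from a descent datum. -/
structure IsQuotient (r : DescentRel g f) {N₀ : C} (h : N₀ ⟶ U) (q : N ⟶ N₀) : Prop where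
  isPullback : IsPullback q g h f
  eq_of_rel : ∀ {T : C} {n n' : T ⟶ N}, r.rel n n' → n ≫ q = n' ≫ q

/-- A descent datum is effective if it comes from an object over the base. -/
def IsEffective (r : DescentRel g f) : Prop :=
  ∃ (N₀ : C) (h : N₀ ⟶ U) (q : N ⟶ N₀), r.IsQuotient h q

/-- Move `n` along the relation over the point of `V` below `n'`. The result has the same two
projections as `n'`, so it is `n'` by cartesianness. Together with `eq_of_rel` this makes the
relation the kernel pair of `q`. -/
lemma IsQuotient.rel_of_eq {r : DescentRel g f} {N₀ : C} {h : N₀ ⟶ U} {q : N ⟶ N₀}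
    (H : r.IsQuotient h q) {T : C} {n n' : T ⟶ N} (e : n ≫ q = n' ≫ q) : r.rel n n' := by
  obtain ⟨n'', h₁, h₂⟩ := r.lift n (n' ≫ g) (by
    rw [Category.assoc, ← H.isPullback.w, reassoc_of% e])
  have : n'' = n' := H.isPullback.hom_ext ((H.eq_of_rel h₁).symm.trans e) h₂
  exact this ▸ h₁

/-- The base change of a descent datum. -/
def baseChange (r : DescentRel g f) {N' V' U' : C} {m : N' ⟶ N} {g' : N' ⟶ V'} {c : V' ⟶ V}
    (H : IsPullback m g' g c) (f' : V' ⟶ U') (j : U' ⟶ U) [Mono j] (e : c ≫ f = f' ≫ j) :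
    DescentRel g' f' where
  rel n n' := r.rel (n ≫ m) (n' ≫ m)
  refl _ := r.refl _
  symm h := r.symm h
  trans h h' := r.trans h h'
  precomp t n n' h := by simpa using r.precomp t h
  comp_eq {T n n'} h := by
    have h := r.comp_eq h
    simp only [Category.assoc, reassoc_of% H.w, e] at h
    simpa [← cancel_mono j] using h
  lift {T} n v h := by
    obtain ⟨n', h₁, h₂⟩ := r.lift (n ≫ m) (v ≫ c) (by
      simp only [Category.assoc, reassoc_of% H.w, e, reassoc_of% h])
    refine ⟨H.lift n' v h₂, ?_, by simp⟩
    rwa [H.lift_fst]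
  uniq {T n n'} h h' := by
    refine H.hom_ext (r.uniq h ?_) h'
    simp only [Category.assoc, H.w, reassoc_of% h']

end DescentRel

end DescentRel

/-- Coverings of schemes: surjective flat morphisms locally of finite presentation. -/
abbrev covering : MorphismProperty Scheme.{0} := @Surjective ⊓ @Flat ⊓ @LocallyOfFinitePresentation

instance : covering.IsStableUnderBaseChange :=
  have : (@Surjective ⊓ @Flat : MorphismProperty Scheme.{0}).IsStableUnderBaseChange :=
    .inf (P := @Surjective) (Q := @Flat)
  .inf (P := @Surjective ⊓ @Flat) (Q := @LocallyOfFinitePresentation)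

instance : covering.IsStableUnderComposition where
  comp_mem _ _ := by
    rintro ⟨⟨_, _⟩, _⟩ ⟨⟨_, _⟩, _⟩
    exact ⟨⟨inferInstance, inferInstance⟩, inferInstance⟩

/-- Subcanonicity of the flat topology; all descent of morphisms below rests on it. -/
lemma covering.effectiveEpi {X Y : Scheme.{0}} {f : X ⟶ Y} (hf : covering f) : EffectiveEpi f := by
  obtain ⟨⟨_, _⟩, _⟩ := hf
  infer_instance

lemma covering.epi {X Y : Scheme.{0}} {f : X ⟶ Y} (hf : covering f) : Epi f :=
  have := hf.effectiveEpi
  inferInstance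

lemma covering.of_etale {X Y : Scheme.{0}} {f : X ⟶ Y} (h : Etale f) (h' : Surjective f) :
    covering f :=
  ⟨⟨h', inferInstance⟩, inferInstance⟩

lemma covering.of_smooth {X Y : Scheme.{0}} {f : X ⟶ Y} (h : Smooth f) (h' : Surjective f) :
    covering f :=
  ⟨⟨h', inferInstance⟩, inferInstance⟩

lemma covering.exists_desc {X Y W : Scheme.{0}} {f : X ⟶ Y} (hf : covering f) (e : X ⟶ W)
    (h : ∀ {T : Scheme.{0}} (a b : T ⟶ X), a ≫ f = b ≫ f → a ≫ e = b ≫ e) :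
    ∃ d : Y ⟶ W, f ≫ d = e :=
  have := hf.effectiveEpi
  ⟨EffectiveEpi.desc f e h, EffectiveEpi.fac f e h⟩

/-- A commutative square is cartesian if it becomes so after a base change along a covering. -/
lemma covering.isPullback_of_left {E₁ E₂ E₃ U₁ U₂ U₃ : Scheme.{0}} {a : E₁ ⟶ E₂} {b : E₂ ⟶ E₃}
    {p₁ : E₁ ⟶ U₁} {p₂ : E₂ ⟶ U₂} {p₃ : E₃ ⟶ U₃} {k : U₁ ⟶ U₂} {l : U₂ ⟶ U₃} (hk : covering k)
    (h₁ : IsPullback a p₁ p₂ k) (h : IsPullback (a ≫ b) p₁ p₃ (k ≫ l)) (w : b ≫ p₃ = p₂ ≫ l) :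
    IsPullback b p₂ p₃ l := by
  let φ : E₂ ⟶ pullback p₃ l := pullback.lift b p₂ w
  have hφ : φ ≫ pullback.snd p₃ l = p₂ := pullback.lift_snd _ _ w
  have hr : IsPullback (pullback.fst p₃ l) (pullback.snd p₃ l) p₃ l := .of_hasPullback _ _
  have h₂ : IsPullback (a ≫ φ) p₁ (pullback.snd p₃ l) k := by
    refine .of_right ?_ (by rw [Category.assoc, hφ, h₁.w]) hr
    rwa [Category.assoc, pullback.lift_fst]
  -- The square exhibits the identity of `E₁` as the base change of the comparison map `φ` along the
  -- covering `a ≫ φ`, and being an isomorphism descends along coverings.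
  have h₃ : IsPullback a (𝟙 E₁) φ (a ≫ φ) := by
    refine .of_bot (v₂₁ := p₁) (v₂₂ := pullback.snd p₃ l) (h₃₁ := k) ?_ (by simp) h₂
    rwa [Category.id_comp, hφ]
  have : IsIso φ := by
    have : covering (a ≫ φ) := MorphismProperty.of_isPullback h₂.flip hk
    exact MorphismProperty.of_isPullback_of_descendsAlong
      (P := MorphismProperty.isomorphisms Scheme.{0}) h₃.flip this (inferInstanceAs (IsIso (𝟙 E₁)))
  exact .of_iso hr (asIso φ).symm (.refl _) (.refl _) (.refl _)
    (by simp [φ, pullback.lift_fst]) (by simp [φ, pullback.lift_snd]) (by simp) (by simp)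

namespace DescentRel

/-- To show that a descent datum is effective one may replace `V` by any covering of `U` which
factors through it. -/
lemma IsEffective.of_covering {N V U : Scheme.{0}} {g : N ⟶ V} {f : V ⟶ U} (r : DescentRel g f)
    {N' V' : Scheme.{0}} {m : N' ⟶ N} {g' : N' ⟶ V'} {c : V' ⟶ V} (H : IsPullback m g' g c)
    (hc : covering (c ≫ f))
    (h : (r.baseChange H (c ≫ f) (𝟙 U) (Category.comp_id _).symm).IsEffective) :
    r.IsEffective := by
  obtain ⟨N₀, h, q', hq⟩ := h
  set r' := r.baseChange H (c ≫ f) (𝟙 U) (Category.comp_id _).symm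
  have hsq := hq.isPullback
  -- `K` is `N ×_U V'`, a covering of `N`. Moving its `N`-component over its `V'`-component gives `K
  -- ⟶ N'`, and composing with `q'` gives a map that is constant on the fibres of `p₂`. It therefore
  -- descends to the required quotient map `q` on `N`.
  obtain ⟨K, p₁, p₂, hK⟩ : ∃ (K : Scheme.{0}) (p₁ : K ⟶ V') (p₂ : K ⟶ N),
      IsPullback p₂ p₁ (g ≫ f) (c ≫ f) := ⟨_, _, _, .of_hasPullback _ _⟩
  have hp₂ : covering p₂ := MorphismProperty.of_isPullback hK.flip hc
  have := hp₂.epi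
  obtain ⟨n, hn, hng⟩ := r.lift p₂ (p₁ ≫ c) (by rw [Category.assoc, hK.w])
  let n' : K ⟶ N' := H.lift n p₁ hng
  have hn'm : n' ≫ m = n := H.lift_fst _ _ _
  have hn'g : n' ≫ g' = p₁ := H.lift_snd _ _ _
  obtain ⟨q, hq'⟩ := hp₂.exists_desc (n' ≫ q') (by
    intro T a b e
    rw [← Category.assoc, ← Category.assoc]
    refine hq.eq_of_rel ?_
    change r.rel ((a ≫ n') ≫ m) ((b ≫ n') ≫ m)
    rw [Category.assoc, Category.assoc, hn'm]
    refine r.trans (r.symm (r.precomp a hn)) ?_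
    rw [e]
    exact r.precomp b hn)
  have hqh : q ≫ h = g ≫ f := by
    rw [← cancel_epi p₂, reassoc_of% hq', hsq.w, reassoc_of% hn'g, hK.w]
  have hk : ∀ {T : Scheme.{0}} (k k' : T ⟶ K), r.rel (k ≫ p₂) (k' ≫ p₂) ↔
      k ≫ p₂ ≫ q = k' ≫ p₂ ≫ q := by
    intro T k k'
    have h₁ := r.precomp k hn
    have h₂ := r.precomp k' hn
    rw [hq', ← Category.assoc, ← Category.assoc]
    have : r.rel (k ≫ p₂) (k' ≫ p₂) ↔ r'.rel (k ≫ n') (k' ≫ n') := by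
      change _ ↔ r.rel ((k ≫ n') ≫ m) ((k' ≫ n') ≫ m)
      rw [Category.assoc, Category.assoc, hn'm]
      exact ⟨fun h => r.trans (r.symm h₁) (r.trans h h₂), fun h =>
        r.trans h₁ (r.trans h (r.symm h₂))⟩
    rw [this]
    exact ⟨hq.eq_of_rel, hq.rel_of_eq⟩
  -- After a covering of `T`, two points of `N` over the same point of `U` lift to `K` with a common
  -- `V'`-component, so that `hk` compares the relation with equality under `q`.
  have hcov : ∀ {T : Scheme.{0}} (x y : T ⟶ N), x ≫ g ≫ f = y ≫ g ≫ f →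
      ∃ (T' : Scheme.{0}) (t : T' ⟶ T) (k k' : T' ⟶ K), Epi t ∧ k ≫ p₂ = t ≫ x ∧
        k' ≫ p₂ = t ≫ y := by
    intro T x y e
    have hp : IsPullback (pullback.fst (x ≫ g ≫ f) (c ≫ f)) (pullback.snd (x ≫ g ≫ f) (c ≫ f)) _ _ :=
      .of_hasPullback (x ≫ g ≫ f) (c ≫ f)
    have : covering (pullback.fst (x ≫ g ≫ f) (c ≫ f)) :=
      MorphismProperty.of_isPullback hp.flip hc
    exact ⟨_, _, hK.lift (pullback.fst (x ≫ g ≫ f) (c ≫ f) ≫ x) (pullback.snd _ _) (by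
      rw [Category.assoc, hp.w]), hK.lift (pullback.fst (x ≫ g ≫ f) (c ≫ f) ≫ y)
        (pullback.snd _ _) (by rw [Category.assoc, ← e, hp.w]), this.epi, by simp, by simp⟩
  have hrel : ∀ {T : Scheme.{0}} {x y : T ⟶ N}, r.rel x y → x ≫ q = y ≫ q := by
    intro T x y e
    obtain ⟨T', t, k, k', ht, h₁, h₂⟩ := hcov x y (r.comp_eq e)
    rw [← cancel_epi t, ← reassoc_of% h₁, ← reassoc_of% h₂]
    refine (hk k k').1 ?_
    rw [h₁, h₂]
    exact r.precomp t e
  have hmq : m ≫ q = q' := by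
    let k : N' ⟶ K := hK.lift m g' (by rw [reassoc_of% H.w])
    have hk₂ : k ≫ p₂ = m := hK.lift_fst _ _ _
    rw [← hk₂, Category.assoc, hq']
    have : r'.rel (k ≫ n') (𝟙 _) := by
      change r.rel ((k ≫ n') ≫ m) (𝟙 _ ≫ m)
      rw [Category.assoc, hn'm, Category.id_comp]
      have := r.precomp k hn
      rw [hk₂] at this
      exact r.symm this
    simpa using hq.eq_of_rel this
  refine ⟨N₀, h, q, isPullback_of_existsUnique hqh ?_ ?_, hrel⟩
  · intro T y v e
    have hp : IsPullback (pullback.fst (y ≫ h) (c ≫ f)) (pullback.snd (y ≫ h) (c ≫ f)) _ _ :=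
      .of_hasPullback (y ≫ h) (c ≫ f)
    have ht : covering (pullback.fst (y ≫ h) (c ≫ f)) :=
      MorphismProperty.of_isPullback hp.flip hc
    set t := pullback.fst (y ≫ h) (c ≫ f)
    set w := pullback.snd (y ≫ h) (c ≫ f)
    have := ht.epi
    -- Locally the point of `N₀` lifts to `N'`; its image in `N` is then moved over the prescribed
    -- point `v`. Since this is possible in only one way, the local solutions agree and descend to
    -- `T`.
    let n₁' := hsq.lift (t ≫ y) w (by rw [Category.assoc, hp.w])
    have e₁ : n₁' ≫ q' = t ≫ y := hsq.lift_fst _ _ _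
    have e₂ : n₁' ≫ g' = w := hsq.lift_snd _ _ _
    obtain ⟨n₂, h₁, h₂⟩ := r.lift (n₁' ≫ m) (t ≫ v) (by
      rw [Category.assoc, Category.assoc, reassoc_of% H.w, reassoc_of% e₂, ← e, hp.w])
    obtain ⟨n₃, h₃⟩ := ht.exists_desc n₂ (by
      intro T' a b eab
      refine r.uniq (r.trans (r.symm (r.precomp a h₁)) (r.trans ?_ (r.precomp b h₁))) ?_
      · have : r'.rel (a ≫ n₁') (b ≫ n₁') := by
          refine hq.rel_of_eq ?_
          rw [Category.assoc, Category.assoc, e₁, reassoc_of% eab]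
        rw [← Category.assoc, ← Category.assoc]
        exact this
      · rw [Category.assoc, Category.assoc, h₂, reassoc_of% eab])
    refine ⟨n₃, ?_, ?_⟩
    · rw [← cancel_epi t, reassoc_of% h₃, ← hrel h₁, Category.assoc, hmq, e₁]
    · rw [← cancel_epi t, reassoc_of% h₃, h₂]
  · intro T x y e₁ e₂
    obtain ⟨T', t, k, k', ht, h₁, h₂⟩ := hcov x y (by rw [reassoc_of% e₂])
    rw [← cancel_epi t]
    refine r.uniq ?_ (by rw [Category.assoc, Category.assoc, e₂])
    rw [← h₁, ← h₂, hk, reassoc_of% h₁, reassoc_of% h₂, e₁]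

end DescentRel

end

end BundleStacks

/-! ### Flat descent for affine schemes -/

namespace BundleStacks

noncomputable section

section AffineDescent

open scoped TensorProduct
open Algebra.TensorProduct

/-- Flat descent for algebras: an algebra `C` over `B` with a descent datum `a` along `A → B` is the
base change of the algebra of invariants. -/
lemma isPushout_equalizer_of_descent {A B C : Type} [CommRing A] [CommRing B] [CommRing C]
    [Algebra A B] [Algebra A C] [Algebra B C] [IsScalarTower A B C] [Module.Flat A B]
    (a : C →ₐ[A] B ⊗[A] C) (h₁ : ∀ b : B, a (algebraMap B C b) = b ⊗ₜ 1)
    (h₂ : ∀ c : C, Algebra.TensorProduct.lift (IsScalarTower.toAlgHom A B C) (AlgHom.id A C)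
      (fun _ _ => Commute.all _ _) (a c) = c)
    (h₃ : (Algebra.TensorProduct.map (AlgHom.id A B) a).comp a =
      (Algebra.TensorProduct.map (AlgHom.id A B) includeRight).comp a) :
    Algebra.IsPushout A B (AlgHom.equalizer a includeRight) C := by
  set K := AlgHom.equalizer a (includeRight : C →ₐ[A] B ⊗[A] C)
  let i : B ⊗[A] K →ₐ[A] B ⊗[A] C := Algebra.TensorProduct.map (AlgHom.id A B) K.val
  have hi : Function.Injective i :=
    Module.Flat.lTensor_preserves_injective_linearMap (M := B) K.val.toLinearMap
      Subtype.val_injective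
  -- Flatness makes `B ⊗ -` commute with the equalizer defining `K`, and the cocycle condition `h₃`
  -- says that `a c` lies in the equalizer after tensoring.
  have hK : ∀ c : C, ∃ x : B ⊗[A] K, i x = a c := by
    intro c
    refine ⟨(AlgHom.tensorEqualizerEquiv B B a includeRight).symm ⟨a c, ?_⟩, ?_⟩
    · exact DFunLike.congr_fun h₃ c
    · have := AlgHom.coe_tensorEqualizer B B a includeRight
        ((AlgHom.tensorEqualizerEquiv B B a includeRight).symm ⟨a c, DFunLike.congr_fun h₃ c⟩)
      rw [← AlgHom.tensorEqualizerEquiv_apply, AlgEquiv.apply_symm_apply] at this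
      exact this.symm
  let l : B ⊗[A] C →ₐ[A] C := Algebra.TensorProduct.lift (IsScalarTower.toAlgHom A B C)
    (AlgHom.id A C) (fun _ _ => Commute.all _ _)
  -- The key identity: `a` followed by multiplication `l` is the identity by `h₂`, and here `a ∘ l`
  -- fixes the image of `i`. Injectivity of `l ∘ i` follows from that of `i`, and surjectivity from
  -- `hK` and `h₂`.
  have hl : ∀ x, a (l (i x)) = i x := by
    intro x
    induction x with
    | zero => simp
    | add x y hx hy => simp only [map_add, hx, hy]
    | tmul b k =>
      have hk : a (k : C) = 1 ⊗ₜ (k : C) := k.2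
      simp [l, i, h₁, hk]
  have hb : Function.Bijective (l.comp i) := by
    refine ⟨fun x y e => hi ?_, fun c => ?_⟩
    · rw [← hl x, ← hl y]
      exact congrArg a e
    · obtain ⟨x, hx⟩ := hK c
      exact ⟨x, (congrArg l hx).trans (h₂ c)⟩
  constructor
  change Function.Bijective _
  convert hb using 1
  ext x
  induction x with
  | zero => simp
  | add x y hx hy => simp only [map_add, hx, hy]
  | tmul b k => simp [l, i, Algebra.smul_def]

/-- The relation is determined by what it does to the universal pair of a point of `N` and a point
of `V` over the same point of `U`. This is one algebra map `a : C → B ⊗ C`; the axioms of the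
relation become the counit and cocycle identities for `a`, and the quotient is the spectrum of the
invariants. -/
lemma DescentRel.isEffective_algebraMap {A B C : Type} [CommRing A] [CommRing B] [CommRing C]
    [Algebra A B] [Algebra A C] [Algebra B C] [IsScalarTower A B C] [Module.Flat A B]
    (r : DescentRel (Spec.map (CommRingCat.ofHom (algebraMap B C)))
      (Spec.map (CommRingCat.ofHom (algebraMap A B)))) : r.IsEffective := by
  let p₁ : Spec (.of (B ⊗[A] C)) ⟶ Spec (.of B) :=
    Spec.map (CommRingCat.ofHom includeLeftRingHom)
  let p₂ : Spec (.of (B ⊗[A] C)) ⟶ Spec (.of C) :=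
    Spec.map (CommRingCat.ofHom (includeRight : C →ₐ[A] B ⊗[A] C).toRingHom)
  have hAC : Spec.map (CommRingCat.ofHom (algebraMap B C)) ≫
      Spec.map (CommRingCat.ofHom (algebraMap A B)) =
      Spec.map (CommRingCat.ofHom (algebraMap A C)) := by
    rw [← Spec.map_comp, ← CommRingCat.ofHom_comp, ← IsScalarTower.algebraMap_eq]
  have hp : IsPullback p₁ p₂ (Spec.map (CommRingCat.ofHom (algebraMap A B)))
      (Spec.map (CommRingCat.ofHom (algebraMap A C))) :=
    isPullback_SpecMap_of_isPushout _ _ _ _ (CommRingCat.isPushout_tensorProduct A B C)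
  -- `Spec (B ⊗ C)` carries the universal pair `(v, n)`; `n₁` is `n` moved over `v`.
  obtain ⟨n₁, hn, hng⟩ := r.lift p₂ p₁ (by rw [hAC, hp.w])
  obtain ⟨a₀, rfl⟩ := Spec.map_surjective n₁
  have h₁ : ∀ b : B, a₀.hom (algebraMap B C b) = b ⊗ₜ 1 := by
    intro b
    rw [← Spec.map_comp] at hng
    exact congrArg (fun φ => φ.hom b) (Spec.map_injective hng)
  let a : C →ₐ[A] B ⊗[A] C :=
    { a₀.hom with
      commutes' := fun x => by
        have := h₁ (algebraMap A B x)
        rw [← IsScalarTower.algebraMap_apply] at this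
        exact this }
  have ha : a₀ = CommRingCat.ofHom a.toRingHom := rfl
  have h₂ : ∀ c : C, Algebra.TensorProduct.lift (IsScalarTower.toAlgHom A B C) (AlgHom.id A C)
      (fun _ _ => Commute.all _ _) (a c) = c := by
    let l : B ⊗[A] C →ₐ[A] C := Algebra.TensorProduct.lift (IsScalarTower.toAlgHom A B C)
      (AlgHom.id A C) (fun _ _ => Commute.all _ _)
    -- `t` is the pair formed by a point of `N` and its own image in `V`. Moving a point to where it
    -- already lies does not change it, which gives the counit identity.
    let t : Spec (.of C) ⟶ Spec (.of (B ⊗[A] C)) := Spec.map (CommRingCat.ofHom l.toRingHom)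
    have t₁ : t ≫ p₁ = Spec.map (CommRingCat.ofHom (algebraMap B C)) := by
      rw [← Spec.map_comp]
      congr 1
      ext b
      simp [l]
    have t₂ : t ≫ p₂ = 𝟙 _ := by
      rw [← Spec.map_comp, ← Spec.map_id]
      congr 1
      ext b
      simp [l]
    have := r.uniq (r.precomp t hn) (by
      rw [Category.assoc, Category.assoc, hng, reassoc_of% t₂, t₁])
    rw [t₂, ← Spec.map_comp, ← Spec.map_id] at this
    intro c
    exact (congrArg (fun φ => φ.hom c) (Spec.map_injective this)).symm
  have h₃ : (Algebra.TensorProduct.map (AlgHom.id A B) a).comp a =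
      (Algebra.TensorProduct.map (AlgHom.id A B) includeRight).comp a := by
    -- On triples `(v₁, v₂, n)`, `w` is `(v₂, n)`, `s₂` is `(v₁, n)` and `s₁` is `v₁` with `n` moved
    -- over `v₂`. The cocycle identity says that moving to `v₂` and then to `v₁` is moving directly
    -- to `v₁`: the results are related and lie over the same point.
    let s₁ : Spec (.of (B ⊗[A] (B ⊗[A] C))) ⟶ Spec (.of (B ⊗[A] C)) :=
      Spec.map (CommRingCat.ofHom (Algebra.TensorProduct.map (AlgHom.id A B) a).toRingHom)
    let s₂ : Spec (.of (B ⊗[A] (B ⊗[A] C))) ⟶ Spec (.of (B ⊗[A] C)) :=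
      Spec.map (CommRingCat.ofHom
        (Algebra.TensorProduct.map (AlgHom.id A B) includeRight).toRingHom)
    let w : Spec (.of (B ⊗[A] (B ⊗[A] C))) ⟶ Spec (.of (B ⊗[A] C)) :=
      Spec.map (CommRingCat.ofHom
        (includeRight : B ⊗[A] C →ₐ[A] B ⊗[A] (B ⊗[A] C)).toRingHom)
    have e₁ : s₁ ≫ p₂ = w ≫ Spec.map a₀ := by
      rw [← Spec.map_comp, ← Spec.map_comp, ha]
      congr 1
    have e₂ : w ≫ p₂ = s₂ ≫ p₂ := by
      rw [← Spec.map_comp, ← Spec.map_comp]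
      congr 1
    have e₃ : s₁ ≫ p₁ = s₂ ≫ p₁ := by
      rw [← Spec.map_comp, ← Spec.map_comp]
      congr 1
      ext c
      simp
    have := r.uniq (r.trans (r.symm (r.precomp s₁ hn)) (r.trans (n' := s₂ ≫ p₂)
      (by rw [e₁, ← e₂]; exact r.symm (r.precomp w hn)) (r.precomp s₂ hn))) (by
      rw [Category.assoc, Category.assoc, hng, e₃])
    rw [← Spec.map_comp, ← Spec.map_comp] at this
    ext c
    exact congrArg (fun φ => φ.hom c) (Spec.map_injective this)
  have hpush := isPushout_equalizer_of_descent a h₁ h₂ h₃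
  let K := AlgHom.equalizer a (includeRight : C →ₐ[A] B ⊗[A] C)
  let q : Spec (.of C) ⟶ Spec (.of K) := Spec.map (CommRingCat.ofHom (algebraMap K C))
  have hq : Spec.map a₀ ≫ q = p₂ ≫ q := by
    rw [← Spec.map_comp, ← Spec.map_comp]
    congr 1
    ext k
    exact k.2
  refine ⟨_, Spec.map (CommRingCat.ofHom (algebraMap A K)), q, ?_, ?_⟩
  · exact (isPullback_SpecMap_of_isPushout _ _ _ _
      (CommRingCat.isPushout_of_isPushout A B K C)).flip
  -- If `x` and `y` are related, then `y` is `x` moved over the image of `y` in `V`, hence is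
  -- obtained from `a` at a point `k` of `Spec (B ⊗ C)`; `q` does not see `a` by definition of the
  -- invariants.
  · intro T x y e
    obtain ⟨k, k₁, k₂⟩ : ∃ k, k ≫ p₁ = y ≫ Spec.map (CommRingCat.ofHom (algebraMap B C)) ∧
        k ≫ p₂ = x :=
      have w := by
        have := r.comp_eq e
        rw [Category.assoc, ← this, hAC]
      ⟨hp.lift _ x w, hp.lift_fst _ _ w, hp.lift_snd _ _ w⟩
    have : k ≫ Spec.map a₀ = y := by
      refine r.uniq (r.trans (r.symm (r.precomp k hn)) ?_) ?_
      · rwa [k₂]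
      · rw [Category.assoc, hng, k₁]
    rw [← this, ← k₂, Category.assoc, Category.assoc, hq]

lemma DescentRel.IsEffective.of_isIso {N V U : Scheme.{0}} {g : N ⟶ V} {f : V ⟶ U}
    (r : DescentRel g f) {N' V' U' : Scheme.{0}} {m : N' ⟶ N} {g' : N' ⟶ V'} {c : V' ⟶ V}
    (H : IsPullback m g' g c) (f' : V' ⟶ U') (j : U' ⟶ U) [IsIso c] [IsIso j]
    (e : c ≫ f = f' ≫ j) (h : (r.baseChange H f' j e).IsEffective) : r.IsEffective := by
  obtain ⟨N₀, h, q, hq⟩ := h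
  have : IsIso m := H.isIso_fst_of_isIso
  refine ⟨N₀, h ≫ j, inv m ≫ q, ?_, ?_⟩
  · refine hq.isPullback.of_iso (asIso m) (.refl _) (asIso c) (asIso j) ?_ ?_ ?_ ?_
    · simp
    · simp [H.w]
    · simp
    · simp [e]
  · intro T x y hxy
    have : (r.baseChange H f' j e).rel (x ≫ inv m) (y ≫ inv m) := by
      change r.rel ((x ≫ inv m) ≫ m) ((y ≫ inv m) ≫ m)
      simpa using hxy
    simpa using hq.eq_of_rel this

/-- Descent data on affine schemes along flat morphisms of affine schemes are effective. -/
lemma DescentRel.isEffective_of_isAffine {N V U : Scheme.{0}} [IsAffine N] [IsAffine V] [IsAffine U]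
    {g : N ⟶ V} {f : V ⟶ U} [Flat f] (r : DescentRel g f) : r.IsEffective := by
  algebraize [(f.appTop).hom, (g.appTop).hom, (g.appTop).hom.comp (f.appTop).hom]
  have : Module.Flat Γ(U, ⊤) Γ(V, ⊤) := f.flat_appTop
  have H : IsPullback N.isoSpec.inv
      (Spec.map (CommRingCat.ofHom (algebraMap Γ(V, ⊤) Γ(N, ⊤)))) g V.isoSpec.inv :=
    .of_horiz_isIso ⟨(Scheme.isoSpec_inv_naturality g).symm⟩
  exact .of_isIso r H (Spec.map (CommRingCat.ofHom (algebraMap Γ(U, ⊤) Γ(V, ⊤)))) U.isoSpec.inv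
    (Scheme.isoSpec_inv_naturality f).symm (isEffective_algebraMap _)

end AffineDescent

end

end BundleStacks

/-! ### From affine schemes to general bases and coverings -/

namespace BundleStacks

noncomputable section

/-- Any covering of an affine scheme is refined by an affine one. -/
lemma covering.exists_isAffine {V U : Scheme.{0}} [IsAffine U] {f : V ⟶ U} (hf : covering f) :
    ∃ (W : Scheme.{0}) (c : W ⟶ V), IsAffine W ∧ covering (c ≫ f) := by
  obtain ⟨⟨h₁, h₂⟩, h₃⟩ := hf
  -- `f` is open and `U` is quasi-compact, so a quasi-compact open part of `V` already surjects onto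
  -- `U`; it has an affine étale covering.
  obtain ⟨V' : V.Opens, hV, e⟩ := f.isOpenMap.exists_opens_image_eq_of_prespectralSpace
    f.continuous (U := Set.univ) (by rw [f.surjective.range_eq]) isOpen_univ isCompact_univ
  have : CompactSpace V'.toScheme := isCompact_iff_compactSpace.mp hV
  have : IsZariskiLocalAtSource @Etale.{0} :=
    HasRingHomProperty.instIsZariskiLocalAtSource (Q := RingHom.Etale)
  have : MorphismProperty.ContainsIdentities @Etale.{0} := ⟨fun _ => inferInstance⟩
  obtain ⟨W, p, hp, hp', hW⟩ := Scheme.exists_hom_isAffine_of_isZariskiLocalAtSource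
    (P := @Etale) V'.toScheme
  refine ⟨W, p ≫ V'.ι, hW, ?_⟩
  have : Surjective (V'.ι ≫ f) :=
    ⟨fun x => have ⟨y, hyV, e⟩ := e.ge (Set.mem_univ x); ⟨⟨y, hyV⟩, e⟩⟩
  rw [Category.assoc]
  exact ⟨⟨inferInstance, inferInstance⟩, inferInstance⟩

/-- A commutative square is cartesian if it becomes so over an open covering. -/
lemma isPullback_of_openCover {E₂ E₃ U₂ U₃ : Scheme.{0}} {b : E₂ ⟶ E₃} {p₂ : E₂ ⟶ U₂}
    {p₃ : E₃ ⟶ U₃} {l : U₂ ⟶ U₃} (𝒰 : U₂.OpenCover) {E₁ : 𝒰.I₀ → Scheme.{0}} {a : ∀ i, E₁ i ⟶ E₂}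
    {p₁ : ∀ i, E₁ i ⟶ 𝒰.X i} (h₁ : ∀ i, IsPullback (a i) (p₁ i) p₂ (𝒰.f i))
    (h : ∀ i, IsPullback (a i ≫ b) (p₁ i) p₃ (𝒰.f i ≫ l)) (w : b ≫ p₃ = p₂ ≫ l) :
    IsPullback b p₂ p₃ l := by
  let φ : E₂ ⟶ pullback p₃ l := pullback.lift b p₂ w
  have hφ : φ ≫ pullback.snd p₃ l = p₂ := pullback.lift_snd _ _ w
  have hr : IsPullback (pullback.fst p₃ l) (pullback.snd p₃ l) p₃ l := .of_hasPullback _ _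
  have h₂ (i) : IsPullback (a i ≫ φ) (p₁ i) (pullback.snd p₃ l) (𝒰.f i) := by
    refine .of_right ?_ (by rw [Category.assoc, hφ, (h₁ i).w]) hr
    rw [Category.assoc, pullback.lift_fst]
    exact h i
  have h₃ (i) : IsPullback (a i) (𝟙 (E₁ i)) φ (a i ≫ φ) := by
    refine .of_bot (v₂₁ := p₁ i) (v₂₂ := pullback.snd p₃ l) (h₃₁ := 𝒰.f i) ?_ (by simp) (h₂ i)
    rw [Category.id_comp, hφ]
    exact h₁ i
  have : IsIso φ := by
    change MorphismProperty.isomorphisms Scheme.{0} φ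
    rw [IsZariskiLocalAtTarget.iff_of_openCover (P := MorphismProperty.isomorphisms Scheme.{0})
      (𝒰.pullback₁ (pullback.snd p₃ l))]
    intro i
    have h₄ : IsPullback (a i) (h₂ i).isoPullback.hom φ (pullback.fst _ (𝒰.f i)) :=
      (h₃ i).of_iso (.refl _) (.refl _) (h₂ i).isoPullback (.refl _) (by simp) (by simp) (by simp)
        (by simp)
    change IsIso (pullback.snd φ (pullback.fst (pullback.snd p₃ l) (𝒰.f i)))
    rw [← h₄.isoPullback_inv_snd]
    infer_instance
  exact .of_iso hr (asIso φ).symm (.refl _) (.refl _) (.refl _)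
    (by simp [φ, pullback.lift_fst]) (by simp [φ, pullback.lift_snd]) (by simp) (by simp)

/-- Keeps only the maps from the pieces and their cartesian squares, so that the construction of the
glued scheme as a colimit is not needed afterwards. -/
lemma exists_glued {U : Scheme.{0}} {𝒰 : U.OpenCover} [Category.{0} 𝒰.I₀]
    [𝒰.LocallyDirected] [Small.{0} 𝒰.I₀] [Quiver.IsThin 𝒰.I₀]
    (D : Scheme.Cover.RelativeGluingData 𝒰) :
    ∃ (X : Scheme.{0}) (b : X ⟶ U) (s : ∀ i, D.functor.obj i ⟶ X),
      (∀ {i j : 𝒰.I₀} (a : i ⟶ j), D.functor.map a ≫ s j = s i) ∧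
        ∀ i, IsPullback (s i) (D.natTrans.app i) b (𝒰.f i) := by
  have : ∀ {i j : 𝒰.I₀} (a : i ⟶ j), IsOpenImmersion (D.functor.map a) := fun a => inferInstance
  have : (D.functor ⋙ Scheme.forget).IsLocallyDirected := inferInstance
  exact ⟨D.glued, D.toBase, colimit.ι D.functor, colimit.w D.functor,
    fun i => (D.isPullback_natTrans_ι_toBase i).flip⟩

namespace DescentRel

/-- Refine the covering `V₁ → U` by an affine scheme `W`. Since `g₁` is affine, the pull-back of
`N₁` to `W` is affine too, and the affine case applies over the covering `W → U`. -/
lemma isEffective_of_isAffine_base {N V U : Scheme.{0}} [IsAffine U] {g : N ⟶ V} {f : V ⟶ U}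
    (r : DescentRel g f) {N₁ V₁ : Scheme.{0}} {m : N₁ ⟶ N} {g₁ : N₁ ⟶ V₁} {c : V₁ ⟶ V}
    (H : IsPullback m g₁ g c) [IsAffineHom g₁] (hc : covering (c ≫ f)) : r.IsEffective := by
  obtain ⟨W, d, hW, hd⟩ := hc.exists_isAffine
  rw [← Category.assoc] at hd
  have H' : IsPullback (pullback.fst g₁ d ≫ m) (pullback.snd g₁ d) g (d ≫ c) :=
    (IsPullback.of_hasPullback g₁ d).paste_horiz H
  have : IsAffine (pullback g₁ d) := isAffine_of_isAffineHom (pullback.snd g₁ d)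
  have : Flat ((d ≫ c) ≫ f) := hd.1.2
  exact .of_covering r H' hd (isEffective_of_isAffine _)

/-- Effectivity of descent data is local on the base. -/
lemma isEffective_of_openCover {N V U : Scheme.{0}} {g : N ⟶ V} {f : V ⟶ U}
    (r : DescentRel g f) (hf : covering f) (𝒰 : U.OpenCover) [Category.{0} 𝒰.I₀]
    [𝒰.LocallyDirected] [Small.{0} 𝒰.I₀] [Quiver.IsThin 𝒰.I₀]
    (heff : ∀ (i : 𝒰.I₀) {N' V' : Scheme.{0}} {n : N' ⟶ N} {g' : N' ⟶ V'} {v : V' ⟶ V}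
      {f' : V' ⟶ 𝒰.X i} (hN : IsPullback n g' g v)
      (hv : IsPullback v f' f (𝒰.f i)), (r.baseChange hN f' (𝒰.f i) hv.w).IsEffective) :
    r.IsEffective := by
  let V' (i) := pullback f (𝒰.f i)
  let N' (i) := pullback (g ≫ f) (𝒰.f i)
  let f' (i) : V' i ⟶ 𝒰.X i := pullback.snd _ _
  let v (i) : V' i ⟶ V := pullback.fst _ _
  let n (i) : N' i ⟶ N := pullback.fst _ _
  have hv (i) : IsPullback (v i) (f' i) f (𝒰.f i) := .of_hasPullback _ _
  let g' (i) : N' i ⟶ V' i := (hv i).lift (n i ≫ g) (pullback.snd _ _) (by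
    rw [Category.assoc]; exact pullback.condition)
  have hg'v (i) : g' i ≫ v i = n i ≫ g := (hv i).lift_fst _ _ _
  have hg'f (i) : g' i ≫ f' i = pullback.snd _ _ := (hv i).lift_snd _ _ _
  have hN (i) : IsPullback (n i) (g' i) g (v i) := by
    refine .of_bot ?_ (hg'v i).symm (hv i)
    rw [hg'f]
    exact .of_hasPullback _ _
  let r' (i) := r.baseChange (hN i) (f' i) (𝒰.f i) (hv i).w
  have heff (i) : (r' i).IsEffective := heff i (hN i) (hv i)
  choose N₀ h q hq using heff
  have hqc (i) : covering (q i) := by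
    refine MorphismProperty.of_isPullback (hq i).isPullback.flip ?_
    exact MorphismProperty.of_isPullback (hv i) hf
  have hqe (i) : Epi (q i) := (hqc i).epi
  let 𝒩 := 𝒰.pullback₁ (g ≫ f)
  let tr {i j : 𝒰.I₀} (a : i ⟶ j) : N' i ⟶ N' j := Scheme.Cover.trans 𝒩 a
  have htr {i j : 𝒰.I₀} (a : i ⟶ j) : tr a ≫ n j = n i := Scheme.Cover.trans_map 𝒩 a
  have htr' {i j : 𝒰.I₀} (a : i ⟶ j) : tr a ≫ g' j ≫ f' j = (g' i ≫ f' i) ≫ 𝒰.trans a := by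
    rw [← cancel_mono (𝒰.f j)]
    simp only [Category.assoc, ← (hv _).w, Scheme.Cover.trans_map]
    rw [reassoc_of% hg'v, reassoc_of% hg'v, reassoc_of% htr]
  -- All the relations are restrictions of `r`, so the transition maps of the pull-backs of `N`
  -- respect them and descend along the coverings `q i`.
  have hmap (i j : 𝒰.I₀) (a : i ⟶ j) : ∃ d : N₀ i ⟶ N₀ j, q i ≫ d = tr a ≫ q j := by
    refine (hqc i).exists_desc _ fun {T} x y e => ?_
    rw [← Category.assoc, ← Category.assoc]
    refine (hq j).eq_of_rel ?_
    change r.rel ((x ≫ tr a) ≫ n j) ((y ≫ tr a) ≫ n j)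
    rw [Category.assoc, Category.assoc, htr]
    exact (hq i).rel_of_eq e
  choose d hd using hmap
  have hdh {i j : 𝒰.I₀} (a : i ⟶ j) : d i j a ≫ h j = h i ≫ Scheme.Cover.trans 𝒰 a := by
    rw [← cancel_epi (q i), reassoc_of% hd, (hq j).isPullback.w, htr' a, Category.assoc,
      ← Category.assoc, ← Category.assoc, ← (hq i).isPullback.w, Category.assoc]
  let D : Scheme.Cover.RelativeGluingData 𝒰 :=
    { functor :=
        { obj := N₀
          map a := d _ _ a
          map_id i := by
            rw [← cancel_epi (q i), hd, Category.comp_id]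
            exact (congrArg (· ≫ q i) (Scheme.Cover.trans_id 𝒩 i)).trans (Category.id_comp _)
          map_comp {i j k} a b := by
            rw [← cancel_epi (q _), hd, reassoc_of% hd, hd, ← Category.assoc]
            exact congrArg (· ≫ q k) (Scheme.Cover.trans_comp 𝒩 a b) }
      natTrans :=
        { app := h
          naturality i j a := hdh a }
      equifibered := by
        intro i j a
        -- The transition square of the quotients becomes, over the covering `V' i`, a composite of
        -- cartesian squares; hence it is itself cartesian.
        let tv : V' i ⟶ V' j := (hv j).lift (v i) (f' i ≫ 𝒰.trans a) (by
          rw [Category.assoc, Scheme.Cover.trans_map, (hv i).w])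
        have htv : tv ≫ v j = v i := (hv j).lift_fst _ _ _
        have htf : tv ≫ f' j = f' i ≫ 𝒰.trans a := (hv j).lift_snd _ _ _
        have h₁ : IsPullback (tr a) (g' i) (g' j) tv := by
          refine .of_right ?_ ?_ (hN j)
          · rw [htr, htv]
            exact hN i
          · refine (hv j).hom_ext ?_ ?_
            · rw [Category.assoc, Category.assoc, hg'v, htv, hg'v, reassoc_of% htr]
            · rw [Category.assoc, Category.assoc, htr', htf, Category.assoc]
        have h₂ := h₁.paste_horiz (hq j).isPullback
        rw [← hd, htf] at h₂
        exact covering.isPullback_of_left (MorphismProperty.of_isPullback (hv i) hf)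
          (hq i).isPullback h₂ (hdh a) }
  obtain ⟨N₀', b, s, hs, hD⟩ : ∃ (X : Scheme.{0}) (b : X ⟶ U) (s : ∀ i, N₀ i ⟶ X),
      (∀ {i j : 𝒰.I₀} (a : i ⟶ j), d i j a ≫ s j = s i) ∧
        ∀ i, IsPullback (s i) (h i) b (𝒰.f i) := exists_glued D
  have hglue {i j : 𝒰.I₀} (a : i ⟶ j) : tr a ≫ q j ≫ s j = q i ≫ s i := by
    rw [← Category.assoc, ← hd, Category.assoc, hs]
  let q₀ : N ⟶ N₀' := Scheme.OpenCover.glueMorphismsOfLocallyDirected 𝒩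
    (fun i => q i ≫ s i) hglue
  have hq₀ (i) : n i ≫ q₀ = q i ≫ s i :=
    Scheme.OpenCover.map_glueMorphismsOfLocallyDirected 𝒩 _ _ i
  have hout (i : 𝒰.I₀) : IsPullback (n i ≫ q₀) (g' i) b (v i ≫ f) := by
    rw [hq₀, (hv i).w]
    exact (hq i).isPullback.paste_horiz (hD i)
  have hcomm (i : 𝒰.I₀) : n i ≫ q₀ ≫ b = n i ≫ g ≫ f := by
    rw [reassoc_of% hq₀, (hD i).w, ← reassoc_of% hg'v, (hv i).w, reassoc_of% (hq i).isPullback.w]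
  refine ⟨N₀', b, q₀, isPullback_of_openCover (𝒰.pullback₁ f) hN hout
    (Scheme.Cover.hom_ext 𝒩 _ _ hcomm), ?_⟩
  · intro T x y e
    -- Related points have the same image in `U`, so one open covering of `T` brings both into the
    -- same member of the cover of `U`, where the quotient property of the pieces applies.
    refine Scheme.Cover.hom_ext (𝒰.pullback₁ (x ≫ g ≫ f)) _ _ fun i => ?_
    let t : pullback (x ≫ g ≫ f) (𝒰.f i) ⟶ T := pullback.fst _ _
    change t ≫ _ = t ≫ _
    have hn : IsPullback (n i) (pullback.snd _ _) (g ≫ f) (𝒰.f i) := .of_hasPullback _ _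
    obtain ⟨x', hx'⟩ : ∃ x', x' ≫ n i = t ≫ x := ⟨hn.lift (t ≫ x) (pullback.snd _ _) (by
      rw [Category.assoc, pullback.condition]), hn.lift_fst _ _ _⟩
    obtain ⟨y', hy'⟩ : ∃ y', y' ≫ n i = t ≫ y := ⟨hn.lift (t ≫ y) (pullback.snd _ _) (by
      rw [Category.assoc, ← r.comp_eq e, pullback.condition]), hn.lift_fst _ _ _⟩
    have : (r' i).rel x' y' := by
      change r.rel (x' ≫ n i) (y' ≫ n i)
      rw [hx', hy']
      exact r.precomp t e
    rw [← reassoc_of% hx', ← reassoc_of% hy']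
    refine (congrArg (x' ≫ ·) (hq₀ i)).trans (Eq.trans ?_ (congrArg (y' ≫ ·) (hq₀ i)).symm)
    rw [reassoc_of% (hq i).eq_of_rel this]

/-- Effectivity of descent along coverings, for morphisms which are affine after a base change along
a covering. -/
theorem isEffective_of_isAffineHom {N V U : Scheme.{0}} {g : N ⟶ V} {f : V ⟶ U}
    (r : DescentRel g f) {N₁ V₁ : Scheme.{0}} {m : N₁ ⟶ N} {g₁ : N₁ ⟶ V₁} {c : V₁ ⟶ V}
    (H : IsPullback m g₁ g c) [IsAffineHom g₁] (hf : covering f) (hc : covering (c ≫ f)) :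
    r.IsEffective := by
  refine r.isEffective_of_openCover hf U.directedAffineCover fun i N' V' n g' v f' hN hv => ?_
  -- Over an affine open of `U` the base change `V₁ ×_V V'` serves in place of `V₁`: it is still a
  -- covering of the base, and the pull-back of `N` to it is still affine.
  have H₁ : IsPullback (pullback.snd c v) (pullback.fst c v) v c :=
    (IsPullback.of_hasPullback c v).flip
  let m' : pullback g₁ (pullback.fst c v) ⟶ N' := hN.lift (pullback.fst _ _ ≫ m)
    (pullback.snd _ _ ≫ pullback.snd _ _)
    (by simp only [Category.assoc, H.w, pullback.condition, pullback.condition_assoc])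
  have hm' : m' ≫ n = pullback.fst _ _ ≫ m := hN.lift_fst _ _ _
  have H₂ : IsPullback m' (pullback.snd g₁ (pullback.fst c v)) g' (pullback.snd c v) := by
    refine .of_right ?_ (hN.lift_snd _ _ _) hN
    rw [hm', H₁.w]
    exact (IsPullback.of_hasPullback g₁ (pullback.fst c v)).paste_horiz H
  have : IsAffine (U.directedAffineCover.X i) := i.2
  have : IsAffineHom (pullback.snd g₁ (pullback.fst c v)) :=
    MorphismProperty.of_isPullback (P := @IsAffineHom) (.of_hasPullback _ _) ‹_›
  exact isEffective_of_isAffine_base _ H₂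
    (MorphismProperty.of_isPullback (H₁.flip.paste_vert hv) hc)

end DescentRel

end

end BundleStacks

namespace BundleStacks

noncomputable section

/-! ### Algebraic groups are smooth -/

/-- Homogeneity. The smooth locus of a reduced scheme of finite type over `ℂ` is open and dense, so
it contains a closed point. If its complement were nonempty, it would contain one as well, and a
translation carries one to the other, although automorphisms preserve the smooth locus. -/
lemma IsAlgebraicGroup.smooth (G : SchC) [GrpObj G] [IsAlgebraicGroup G] : Smooth G.hom := by
  have := IsAlgebraicGroup.locallyOfFiniteType (G := G)
  have := IsAlgebraicGroup.reduced (G := G)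
  have := LocallyOfFiniteType.jacobsonSpace G.hom
  have : Nonempty G.left := ⟨η[G].left (IsLocalRing.closedPoint ℂ)⟩
  rw [← Scheme.Hom.smoothLocus_eq_top_iff, ← TopologicalSpace.Opens.coe_eq_univ,
    ← not_ne_iff, ← Set.nonempty_compl]
  intro H
  obtain ⟨x, hx, hxc⟩ :=
    nonempty_inter_closedPoints H G.hom.smoothLocus.2.isClosed_compl.isLocallyClosed
  obtain ⟨y, hy, hyc⟩ := nonempty_inter_closedPoints
    G.hom.dense_smoothLocus_of_perfectField.nonempty G.hom.smoothLocus.2.isLocallyClosed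
  -- Closed points are `ℂ`-points, since `ℂ` is algebraically closed.
  obtain ⟨x', hx'⟩ : ∃ x' : 𝟙_ SchC ⟶ G, x'.left (IsLocalRing.closedPoint ℂ) = x :=
    ⟨Over.homMk _ ((pointEquivClosedPoint G.hom).symm ⟨x, hxc⟩).2,
      congrArg Subtype.val ((pointEquivClosedPoint G.hom).apply_symm_apply ⟨x, hxc⟩)⟩
  obtain ⟨y', hy'⟩ : ∃ y' : 𝟙_ SchC ⟶ G, y'.left (IsLocalRing.closedPoint ℂ) = y :=
    ⟨Over.homMk _ ((pointEquivClosedPoint G.hom).symm ⟨y, hyc⟩).2,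
      congrArg Subtype.val ((pointEquivClosedPoint G.hom).apply_symm_apply ⟨y, hyc⟩)⟩
  -- The translation that carries `x'` to the unit, followed by the one that carries the unit to
  -- `y'`.
  let α : G ≅ G := (GrpObj.mulRight x').symm ≪≫ GrpObj.mulRight y'
  have hα : x' ≫ α.hom = y' := by
    dsimp only [Iso.trans_hom, Iso.symm_hom, α]
    rw [← Category.assoc, ← Iso.eq_comp_inv]
    simp [comp_lift_assoc]
  have hα' : α.hom.left x = y := by
    rw [← hx', ← hy', ← hα]
    rfl
  have : IsIso α.hom.left := inferInstanceAs (IsIso ((Over.forget _).map α.hom))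
  have h : α.hom.left ⁻¹ᵁ G.hom.smoothLocus = G.hom.smoothLocus := by
    rw [Scheme.Hom.preimage_smoothLocus_eq]
    congr 1
    exact Over.w α.hom
  have hxs : x ∈ α.hom.left ⁻¹ᵁ G.hom.smoothLocus := by
    change α.hom.left x ∈ G.hom.smoothLocus
    rw [hα']
    exact hy
  rw [h] at hxs
  exact hx hxs

/-! ### Coverings of `ℂ`-schemes -/

/-- Coverings of `ℂ`-schemes. -/
def Cov {U V : SchC} (f : U ⟶ V) : Prop := covering f.left

lemma isPullback_left {P X Y Z : SchC} {fst : P ⟶ X} {snd : P ⟶ Y} {f : X ⟶ Z} {g : Y ⟶ Z}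
    (h : IsPullback fst snd f g) : IsPullback fst.left snd.left f.left g.left :=
  h.map (Over.forget _)

lemma isPullback_of_isPullback_left {P X Y Z : SchC} {fst : P ⟶ X} {snd : P ⟶ Y} {f : X ⟶ Z}
    {g : Y ⟶ Z} (h : IsPullback fst.left snd.left f.left g.left) : IsPullback fst snd f g :=
  .of_map (Over.forget _) (by ext; exact h.w) h

namespace Cov

variable {U V W : SchC}

lemma of_isPullback {P X Y Z : SchC} {fst : P ⟶ X} {snd : P ⟶ Y} {f : X ⟶ Z} {g : Y ⟶ Z}
    (h : IsPullback fst snd f g) (hg : Cov g) : Cov fst :=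
  MorphismProperty.of_isPullback (P := covering) (isPullback_left h).flip hg

lemma of_etale {f : U ⟶ V} (h : Etale f.left) (h' : Surjective f.left) : Cov f :=
  covering.of_etale h h'

lemma epi {f : U ⟶ V} (hf : Cov f) : Epi f :=
  have : Epi f.left := covering.epi hf
  Over.epi_of_epi_left f

lemma exists_desc {f : U ⟶ V} (hf : Cov f) (e : U ⟶ W)
    (h : ∀ {T : SchC} (a b : T ⟶ U), a ≫ f = b ≫ f → a ≫ e = b ≫ e) : ∃ d : V ⟶ W, f ≫ d = e := by
  obtain ⟨d, hd⟩ := covering.exists_desc hf e.left (by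
    intro T a b hab
    -- Points of the underlying scheme identified by `f` have the same structure map to `Spec ℂ`, so
    -- they are points from one `ℂ`-scheme and the hypothesis applies to them.
    have hw : b ≫ U.hom = a ≫ U.hom := by
      rw [← Over.w f, reassoc_of% hab]
    exact congrArg CommaMorphism.left (h (T := Over.mk (a ≫ U.hom)) (Over.homMk a)
      (Over.homMk b hw) (by ext; exact hab)))
  have := covering.epi hf
  refine ⟨Over.homMk d ?_, ?_⟩
  · rw [← cancel_epi f.left, reassoc_of% hd, Over.w, Over.w]
  · ext
    exact hd

lemma isPullback_of_left {E₁ E₂ E₃ U₁ U₂ U₃ : SchC} {a : E₁ ⟶ E₂} {b : E₂ ⟶ E₃}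
    {p₁ : E₁ ⟶ U₁} {p₂ : E₂ ⟶ U₂} {p₃ : E₃ ⟶ U₃} {k : U₁ ⟶ U₂} {l : U₂ ⟶ U₃} (hk : Cov k)
    (h₁ : IsPullback a p₁ p₂ k) (h : IsPullback (a ≫ b) p₁ p₃ (k ≫ l)) (w : b ≫ p₃ = p₂ ≫ l) :
    IsPullback b p₂ p₃ l :=
  isPullback_of_isPullback_left (covering.isPullback_of_left hk (isPullback_left h₁)
    (isPullback_left h) (congrArg CommaMorphism.left w))

end Cov

/-- Effective descent along coverings for morphisms which are affine over a covering. -/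
theorem DescentRel.isEffective_of_isPullback {N V U N' V' : SchC} {g : N ⟶ V} {f : V ⟶ U}
    (r : DescentRel g f) {m : N' ⟶ N} {g' : N' ⟶ V'} {c : V' ⟶ V} (H : IsPullback m g' g c)
    (hg : IsAffineHom g'.left) (hf : Cov f) (hc : Cov c) : r.IsEffective := by
  -- Two points of the underlying schemes are declared related when they have the same structure map
  -- to `Spec ℂ` and are related as morphisms of `ℂ`-schemes.
  let r' : DescentRel g.left f.left :=
    { rel := fun {T} n n' => ∃ (t : T ⟶ Spec (.of ℂ)) (e : n ≫ N.hom = t) (e' : n' ≫ N.hom = t),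
        r.rel (Over.homMk n e : Over.mk t ⟶ N) (Over.homMk n' e')
      refl := fun n => ⟨_, rfl, rfl, r.refl _⟩
      symm := fun ⟨t, e, e', h⟩ => ⟨t, e', e, r.symm h⟩
      trans := by
        rintro T n n' n'' ⟨t, e, e', h⟩ ⟨_, rfl, e₃, h'⟩
        obtain rfl := e'
        exact ⟨_, e, e₃, r.trans h h'⟩
      precomp := by
        rintro T' T a n n' ⟨t, e, e', h⟩
        exact ⟨a ≫ t, by rw [Category.assoc, e], by rw [Category.assoc, e'],
          r.precomp (Over.homMk a : Over.mk (a ≫ t) ⟶ Over.mk t) h⟩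
      comp_eq := by
        rintro T n n' ⟨t, e, e', h⟩
        exact congrArg CommaMorphism.left (r.comp_eq h)
      lift := by
        intro T n v h
        have hv : v ≫ V.hom = n ≫ N.hom := by
          rw [← Over.w f, reassoc_of% h, Over.w, Over.w]
        obtain ⟨n', h₁, h₂⟩ := r.lift (Over.homMk n : Over.mk (n ≫ N.hom) ⟶ N)
          (Over.homMk v hv) (by ext; exact h)
        exact ⟨n'.left, ⟨_, rfl, Over.w n', h₁⟩, congrArg CommaMorphism.left h₂⟩
      uniq := by
        rintro T n n' ⟨t, e, e', h⟩ h'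
        exact congrArg CommaMorphism.left (r.uniq h (by ext; exact h')) }
  obtain ⟨N₀, h, q, hq⟩ : r'.IsEffective :=
    r'.isEffective_of_isAffineHom (isPullback_left H) hf (covering.comp_mem _ _ hc hf)
  have hqU : q ≫ h ≫ U.hom = N.hom := by
    rw [reassoc_of% hq.isPullback.w, Over.w, Over.w]
  refine ⟨Over.mk (h ≫ U.hom), Over.homMk h, Over.homMk q hqU,
    isPullback_of_isPullback_left hq.isPullback, ?_⟩
  intro T n n' hn
  ext
  exact hq.eq_of_rel ⟨T.hom, Over.w n, Over.w n', hn⟩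

end

end BundleStacks

namespace BundleStacks

noncomputable section

lemma covering.descendsAlong (P : MorphismProperty Scheme.{0})
    [P.DescendsAlong (@Surjective ⊓ @Flat ⊓ @QuasiCompact)] [IsZariskiLocalAtTarget P] :
    P.DescendsAlong covering :=
  inferInstance

/-! ### Points of principal bundles -/

lemma isPullback_whiskerRight {X Z : SchC} (f : X ⟶ Z) (Y : SchC) :
    IsPullback (f ▷ Y) (fst X Y) (fst Z Y) f := by
  refine isPullback_of_existsUnique (by simp) (fun T a b h => ⟨lift b (a ≫ snd Z Y), ?_, by simp⟩)
    fun T l l' h h' => ?_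
  · apply CartesianMonoidalCategory.hom_ext
    · simpa using h.symm
    · simp
  · apply CartesianMonoidalCategory.hom_ext
    · exact h'
    · simpa using h =≫ snd Z Y

section actions

variable {Γ : SchC} [GrpObj Γ]

lemma smul_comp {M N : SchC} [ModObj Γ M] [ModObj Γ N] {f : M ⟶ N}
    (hf : γ[Γ, M] ≫ f = Γ ◁ f ≫ γ[Γ, N]) {T : SchC} (g : T ⟶ Γ) (m : T ⟶ M) :
    (g • m) ≫ f = g • (m ≫ f) := by
  simp [Hom.smul_def, hf]

/-- Yoneda: equivariance is tested on the universal pair, the two projections of `Γ ⊗ M`. Identities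
between actions can thus be checked on `T`-points throughout. -/
lemma equivariant_of_smul {M N : SchC} [ModObj Γ M] [ModObj Γ N] {f : M ⟶ N}
    (h : ∀ {T : SchC} (g : T ⟶ Γ) (m : T ⟶ M), (g • m) ≫ f = g • (m ≫ f)) :
    γ[Γ, M] ≫ f = Γ ◁ f ≫ γ[Γ, N] := by
  have := h (fst Γ M) (snd Γ M)
  have e : lift (fst Γ M) (snd Γ M ≫ f) = Γ ◁ f := by
    apply CartesianMonoidalCategory.hom_ext <;> simp
  simpa [Hom.smul_def, e] using this

namespace LeftPrincipalBundle

variable {U : SchC} (M : LeftPrincipalBundle Γ U)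

lemma smul_proj {T : SchC} (g : T ⟶ Γ) (m : T ⟶ M.tot) : (g • m) ≫ M.proj = m ≫ M.proj := by
  simp [Hom.smul_def, M.act_proj]

lemma exists_cover : ∃ (V : SchC) (c : V ⟶ U) (t : Γ ⊗ V ⟶ M.tot), Cov c ∧
    IsPullback t (snd Γ V) M.proj c ∧ ∀ {T : SchC} (g δ : T ⟶ Γ) (v : T ⟶ V),
      lift (g * δ) v ≫ t = g • (lift δ v ≫ t) := by
  obtain ⟨V, c, t, h₁, h₂, h₃, h₄⟩ := M.locallyTrivial
  refine ⟨V, c, t, .of_etale h₁ h₂, h₃, fun g δ v => ?_⟩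
  have := lift (lift g δ) v ≫= h₄
  simpa [Hom.smul_def, Hom.mul_def] using this

/-- Locally, a point of a left principal bundle is given by a point of the group. -/
lemma exists_point {T : SchC} (m : T ⟶ M.tot) : ∃ (T' : SchC) (p : T' ⟶ T), Cov p ∧
    ∃ (V : SchC) (t : Γ ⊗ V ⟶ M.tot) (v : T' ⟶ V),
      (∀ g δ : T' ⟶ Γ, lift (g * δ) v ≫ t = g • (lift δ v ≫ t)) ∧
      (∀ g δ : T' ⟶ Γ, lift g v ≫ t = lift δ v ≫ t → g = δ) ∧
      ∀ m' : T ⟶ M.tot, m' ≫ M.proj = m ≫ M.proj → ∃ g, lift g v ≫ t = p ≫ m' := by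
  obtain ⟨V, c, t, hc, h, ht⟩ := M.exists_cover
  refine ⟨pullback (m ≫ M.proj) c, pullback.fst _ _,
    .of_isPullback (.of_hasPullback _ _) hc, V, t, pullback.snd _ _, fun g δ => ht _ _ _, ?_, ?_⟩
  · intro g δ e
    have := h.hom_ext e (by simp)
    simpa using this =≫ fst Γ V
  · intro m' hm'
    have w : (pullback.fst (m ≫ M.proj) c ≫ m') ≫ M.proj = pullback.snd _ _ ≫ c := by
      rw [Category.assoc, hm', pullback.condition]
    refine ⟨h.lift _ _ w ≫ fst Γ V, ?_⟩
    have : lift (h.lift _ _ w ≫ fst Γ V) (pullback.snd (m ≫ M.proj) c) = h.lift _ _ w := by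
      apply CartesianMonoidalCategory.hom_ext
      · simp
      · rw [lift_snd, h.lift_snd]
    rw [this, h.lift_fst]

/-- Freeness. In a local trivialization the action is left multiplication on the group coordinate,
where one can cancel, and a covering of `T` is an epimorphism. -/
lemma smul_injective {T : SchC} {g δ : T ⟶ Γ} {m : T ⟶ M.tot} (h : g • m = δ • m) : g = δ := by
  obtain ⟨T', p, hp, V, t, v, h₁, h₂, h₃⟩ := M.exists_point m
  obtain ⟨ε, hε⟩ := h₃ m rfl
  have := hp.epi
  have h' := p ≫= h
  rw [ModObj.comp_smul, ModObj.comp_smul, ← hε, ← h₁, ← h₁] at h'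
  rw [← cancel_epi p]
  exact mul_right_cancel (h₂ _ _ h')

/-- Transitivity on fibres. In a local trivialization the element is the quotient `ε * δ⁻¹` of the
group coordinates; by freeness it is unique, so the local solutions descend to `T`. With
`smul_injective` this is `Γ × M ≅ M ×_U M`. -/
lemma exists_smul_eq {T : SchC} {m m' : T ⟶ M.tot} (h : m' ≫ M.proj = m ≫ M.proj) :
    ∃ g : T ⟶ Γ, g • m = m' := by
  obtain ⟨T', p, hp, V, t, v, h₁, h₂, h₃⟩ := M.exists_point m
  obtain ⟨δ, hδ⟩ := h₃ m rfl
  obtain ⟨ε, hε⟩ := h₃ m' h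
  have hgd : (ε * δ⁻¹) • (p ≫ m) = p ≫ m' := by
    rw [← hδ, ← h₁, inv_mul_cancel_right, hε]
  obtain ⟨g, h₄⟩ := hp.exists_desc (ε * δ⁻¹) (by
    intro S a b e
    refine M.smul_injective (m := a ≫ p ≫ m) ?_
    have h₅ := a ≫= hgd
    have h₆ := b ≫= hgd
    rw [ModObj.comp_smul] at h₅ h₆
    have e' : a ≫ p ≫ m = b ≫ p ≫ m := by rw [reassoc_of% e]
    rw [h₅, e', h₆, reassoc_of% e])
  have := hp.epi
  refine ⟨g, ?_⟩
  rw [← cancel_epi p, ModObj.comp_smul, h₄, hgd]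

lemma smooth_snd [IsAlgebraicGroup Γ] (V : SchC) : Smooth (snd Γ V).left := by
  rw [Over.snd_left]
  exact MorphismProperty.of_isPullback (P := @Smooth) (.of_hasPullback _ _)
    (IsAlgebraicGroup.smooth Γ)

/-- Smoothness descends along the étale covering that trivializes the torsor, where the map is a
base change of `Γ → Spec ℂ`. -/
lemma smooth_proj [IsAlgebraicGroup Γ] : Smooth M.proj.left := by
  obtain ⟨V, c, t, hc, h, -⟩ := M.exists_cover
  have : IsZariskiLocalAtTarget @Smooth.{0} :=
    HasRingHomProperty.instIsZariskiLocalAtTarget @Smooth (Q := RingHom.Smooth)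
  have := covering.descendsAlong @Smooth.{0}
  exact MorphismProperty.of_isPullback_of_descendsAlong (P := @Smooth) (isPullback_left h).flip
    hc (smooth_snd V)

/-- This allows descent along the torsor itself. Surjectivity holds because the unit section of a
trivialization lifts the étale covering `c` to `M`. -/
lemma cov_proj [IsAlgebraicGroup Γ] : Cov M.proj := by
  refine covering.of_smooth M.smooth_proj ?_
  obtain ⟨V, c, t, hc, h, -⟩ := M.exists_cover
  have e : (lift 1 (𝟙 V) ≫ t) ≫ M.proj = c := by simp [h.w]
  have e' : (lift 1 (𝟙 V) ≫ t).left ≫ M.proj.left = c.left := congrArg CommaMorphism.left e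
  have : Surjective ((lift 1 (𝟙 V) ≫ t).left ≫ M.proj.left) := e' ▸ hc.1.1
  exact Surjective.of_comp (lift 1 (𝟙 V) ≫ t).left M.proj.left

end LeftPrincipalBundle

end actions

namespace PrincipalBundle

variable {G : SchC} [GrpObj G] {U V W : SchC}

/-- The action of a point of `G` on a point of a principal `G`-bundle. -/
def smul (E : PrincipalBundle G U) {T : SchC} (e : T ⟶ E.tot) (g : T ⟶ G) : T ⟶ E.tot :=
  lift e g ≫ E.act

lemma smul_proj (E : PrincipalBundle G U) {T : SchC} (e : T ⟶ E.tot) (g : T ⟶ G) :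
    E.smul e g ≫ E.proj = e ≫ E.proj := by
  simp [smul, E.act_proj]

lemma Hom.smul_hom {E : PrincipalBundle G U} {F : PrincipalBundle G V} {k : U ⟶ V} (φ : E.Hom F k)
    {T : SchC} (e : T ⟶ E.tot) (g : T ⟶ G) :
    E.smul e g ≫ φ.hom = F.smul (e ≫ φ.hom) g := by
  simp [smul, φ.equivariant]

lemma equivariant_of_smul {E : PrincipalBundle G U} {F : PrincipalBundle G V} {f : E.tot ⟶ F.tot}
    (h : ∀ {T : SchC} (e : T ⟶ E.tot) (g : T ⟶ G), E.smul e g ≫ f = F.smul (e ≫ f) g) :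
    E.act ≫ f = f ▷ G ≫ F.act := by
  have := h (fst E.tot G) (snd E.tot G)
  have e : lift (fst E.tot G ≫ f) (snd E.tot G) = f ▷ G := by
    apply CartesianMonoidalCategory.hom_ext <;> simp
  simpa [smul, e] using this

/-- Morphisms of principal bundles are cartesian. -/
lemma Hom.exists_lift {E : PrincipalBundle G U} {F : PrincipalBundle G V} {H : PrincipalBundle G W}
    {k : U ⟶ V} {l : W ⟶ V} (φ : E.Hom F k) (ψ : H.Hom F l) (g : W ⟶ U) (hg : g ≫ k = l) :
    ∃ χ : H.Hom E g, χ.hom ≫ φ.hom = ψ.hom := by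
  have w : ψ.hom ≫ F.proj = (H.proj ≫ g) ≫ k := by rw [ψ.isPullback.w, Category.assoc, hg]
  obtain ⟨t, t₁, t₂⟩ : ∃ t, t ≫ φ.hom = ψ.hom ∧ t ≫ E.proj = H.proj ≫ g :=
    ⟨φ.isPullback.lift _ _ w, φ.isPullback.lift_fst _ _ w, φ.isPullback.lift_snd _ _ w⟩
  refine ⟨⟨t, ?_, equivariant_of_smul fun e g => ?_⟩, t₁⟩
  · refine .of_right ?_ t₂ φ.isPullback
    rw [t₁, hg]
    exact ψ.isPullback
  · apply φ.isPullback.hom_ext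
    · rw [Category.assoc, t₁, ψ.smul_hom, φ.smul_hom, Category.assoc, t₁]
    · rw [Category.assoc, t₂, reassoc_of% smul_proj, E.smul_proj, Category.assoc, t₂]

/-- Morphisms of principal bundles descend along coverings. -/
lemma Hom.exists_desc {E : PrincipalBundle G U} {F : PrincipalBundle G V} {H : PrincipalBundle G W}
    {k : U ⟶ V} {l : V ⟶ W} (φ : E.Hom F k) (hk : Cov k) (ψ : E.Hom H (k ≫ l))
    (h : ∀ {T : SchC} (a b : T ⟶ E.tot), a ≫ φ.hom = b ≫ φ.hom → a ≫ ψ.hom = b ≫ ψ.hom) :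
    ∃ χ : F.Hom H l, φ.hom ≫ χ.hom = ψ.hom := by
  have hφ : Cov φ.hom := .of_isPullback φ.isPullback hk
  have := hφ.epi
  obtain ⟨d, hd⟩ := hφ.exists_desc ψ.hom h
  have w : d ≫ H.proj = F.proj ≫ l := by
    rw [← cancel_epi φ.hom, reassoc_of% hd, ψ.isPullback.w, reassoc_of% φ.isPullback.w]
  -- The descended square is cartesian since it is so after base change along the covering `k`;
  -- equivariance is checked after the epimorphism `φ.hom ▷ G`.
  refine ⟨⟨d, Cov.isPullback_of_left hk φ.isPullback (hd ▸ ψ.isPullback) w, ?_⟩, hd⟩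
  have := (Cov.of_isPullback (isPullback_whiskerRight φ.hom G) hφ).epi
  rw [← cancel_epi (φ.hom ▷ G), ← comp_whiskerRight_assoc, hd, ← ψ.equivariant,
    ← reassoc_of% φ.equivariant, hd]

end PrincipalBundle

end

end BundleStacks

namespace BundleStacks

noncomputable section

/-! ### Base change of principal bundles -/

lemma whiskerLeft_mul (X G : SchC) [GrpObj G] :
    X ◁ μ[G] = lift (fst X (G ⊗ G)) ((snd _ _ ≫ fst G G) * (snd _ _ ≫ snd G G)) := by
  apply CartesianMonoidalCategory.hom_ext
  · simp
  · rw [lift_snd, whiskerLeft_snd, MonObj.mul_eq_mul, MonObj.comp_mul]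

lemma associator_inv_whiskerRight {X G E : SchC} (t : X ⊗ G ⟶ E) :
    (α_ X G G).inv ≫ t ▷ G =
      lift (lift (fst X (G ⊗ G)) (snd _ _ ≫ fst G G) ≫ t) (snd _ _ ≫ snd G G) := by
  apply CartesianMonoidalCategory.hom_ext
  · rw [lift_fst, Category.assoc, whiskerRight_fst, ← Category.assoc]
    congr 1
    apply CartesianMonoidalCategory.hom_ext <;> simp
  · simp

namespace PrincipalBundle

variable {G : SchC} [GrpObj G] {U V W : SchC}

lemma exists_trivialization (E : PrincipalBundle G V) : ∃ (W : SchC) (c : W ⟶ V) (t : W ⊗ G ⟶ E.tot),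
    Etale c.left ∧ Surjective c.left ∧ IsPullback t (fst W G) E.proj c ∧
      ∀ {T : SchC} (w : T ⟶ W) (g h : T ⟶ G), lift w (g * h) ≫ t = E.smul (lift w g ≫ t) h := by
  obtain ⟨W, c, t, h₁, h₂, h₃, h₄⟩ := E.locallyTrivial
  refine ⟨W, c, t, h₁, h₂, h₃, fun w g h => ?_⟩
  have := lift w (lift g h) ≫= h₄
  simpa [smul, Hom.mul_def, ← comp_lift_assoc] using this

/-- A right action on points comes from a right action. -/
def ofPoints (tot : SchC) (proj : tot ⟶ U) (act : tot ⊗ G ⟶ tot)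
    (act_one : ∀ {T : SchC} (e : T ⟶ tot), lift e 1 ≫ act = e)
    (act_mul : ∀ {T : SchC} (e : T ⟶ tot) (g h : T ⟶ G),
      lift e (g * h) ≫ act = lift (lift e g ≫ act) h ≫ act)
    (act_proj : ∀ {T : SchC} (e : T ⟶ tot) (g : T ⟶ G), (lift e g ≫ act) ≫ proj = e ≫ proj)
    (locallyTrivial : ∃ (V : SchC) (c : V ⟶ U) (t : V ⊗ G ⟶ tot),
      Etale c.left ∧ Surjective c.left ∧ IsPullback t (fst V G) proj c ∧
      ∀ {T : SchC} (v : T ⟶ V) (g h : T ⟶ G),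
        lift v (g * h) ≫ t = lift (lift v g ≫ t) h ≫ act) : PrincipalBundle G U where
  tot := tot
  proj := proj
  act := act
  act_one := by
    rw [← act_one (ρ_ tot).hom]
    congr 1
    apply CartesianMonoidalCategory.hom_ext
    · simp [rightUnitor_hom]
    · rw [lift_snd, whiskerLeft_snd, Hom.one_def]
      congr 1
      exact toUnit_unique _ _
  act_mul := by
    rw [whiskerLeft_mul, reassoc_of% associator_inv_whiskerRight]
    exact act_mul _ _ _
  act_proj := by simpa using act_proj (fst tot G) (snd tot G)
  locallyTrivial := by
    obtain ⟨V, c, t, h₁, h₂, h₃, h₄⟩ := locallyTrivial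
    refine ⟨V, c, t, h₁, h₂, h₃, ?_⟩
    rw [whiskerLeft_mul, reassoc_of% associator_inv_whiskerRight]
    exact h₄ _ _ _

lemma smul_one (E : PrincipalBundle G U) {T : SchC} (e : T ⟶ E.tot) : E.smul e 1 = e := by
  simpa [smul, Hom.one_def] using lift e (toUnit T) ≫= E.act_one

lemma smul_mul (E : PrincipalBundle G U) {T : SchC} (e : T ⟶ E.tot) (g h : T ⟶ G) :
    E.smul e (g * h) = E.smul (E.smul e g) h := by
  simpa [smul, Hom.mul_def] using lift e (lift g h) ≫= E.act_mul

/-- The action map of `baseChange`. -/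
def baseChangeAct (E : PrincipalBundle G V) (f : U ⟶ V) :
    pullback E.proj f ⊗ G ⟶ pullback E.proj f :=
  pullback.lift (pullback.fst E.proj f ▷ G ≫ E.act) (fst _ G ≫ pullback.snd E.proj f) (by
    rw [Category.assoc, E.act_proj, whiskerRight_fst_assoc, Category.assoc, pullback.condition])

lemma baseChangeAct_fst (E : PrincipalBundle G V) (f : U ⟶ V) {T : SchC}
    (e : T ⟶ pullback E.proj f) (g : T ⟶ G) :
    (lift e g ≫ E.baseChangeAct f) ≫ pullback.fst _ _ = E.smul (e ≫ pullback.fst _ _) g := by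
  have : E.baseChangeAct f ≫ pullback.fst _ _ = _ := pullback.lift_fst _ _ _
  rw [Category.assoc, this, lift_whiskerRight_assoc, smul]

lemma baseChangeAct_snd (E : PrincipalBundle G V) (f : U ⟶ V) {T : SchC}
    (e : T ⟶ pullback E.proj f) (g : T ⟶ G) :
    (lift e g ≫ E.baseChangeAct f) ≫ pullback.snd _ _ = e ≫ pullback.snd _ _ := by
  have : E.baseChangeAct f ≫ pullback.snd _ _ = _ := pullback.lift_snd _ _ _
  rw [Category.assoc, this, lift_fst_assoc]

/-- The base change of a principal bundle. -/
def baseChange (E : PrincipalBundle G V) (f : U ⟶ V) : PrincipalBundle G U :=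
  ofPoints (pullback E.proj f) (pullback.snd _ _) (E.baseChangeAct f)
    (fun e => by
      apply pullback.hom_ext
      · rw [baseChangeAct_fst, smul_one]
      · rw [baseChangeAct_snd])
    (fun e g h => by
      apply pullback.hom_ext
      · rw [baseChangeAct_fst, baseChangeAct_fst, baseChangeAct_fst, smul_mul]
      · rw [baseChangeAct_snd, baseChangeAct_snd, baseChangeAct_snd])
    (fun e g => E.baseChangeAct_snd f e g)
    (by
      obtain ⟨W, c, t, h₁, h₂, h₃, h₄⟩ := E.exists_trivialization
      have hp := isPullback_left (IsPullback.of_hasPullback c f)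
      have w : (pullback.fst c f ▷ G ≫ t) ≫ E.proj = (fst _ G ≫ pullback.snd c f) ≫ f := by
        rw [Category.assoc, h₃.w, whiskerRight_fst_assoc, Category.assoc, pullback.condition]
      obtain ⟨s, s₁, s₂⟩ : ∃ s : pullback c f ⊗ G ⟶ pullback E.proj f,
          s ≫ pullback.fst _ _ = pullback.fst c f ▷ G ≫ t ∧
          s ≫ pullback.snd _ _ = fst _ G ≫ pullback.snd c f :=
        ⟨pullback.lift _ _ w, pullback.lift_fst _ _ w, pullback.lift_snd _ _ w⟩
      refine ⟨pullback c f, pullback.snd c f, s,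
        MorphismProperty.of_isPullback (P := @Etale) hp h₁,
        MorphismProperty.of_isPullback (P := @Surjective) hp h₂, ?_, fun v g h => ?_⟩
      · refine .of_right ?_ s₂ (.of_hasPullback E.proj f)
        have := (isPullback_whiskerRight (pullback.fst c f) G).paste_horiz h₃
        rwa [pullback.condition, ← s₁] at this
      · apply pullback.hom_ext
        · rw [baseChangeAct_fst]
          simp [s₁, h₄]
        · rw [baseChangeAct_snd]
          simp [s₂])

/-- The projection from the base change of a principal bundle. -/
def baseChangeHom (E : PrincipalBundle G V) (f : U ⟶ V) : (E.baseChange f).Hom E f where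
  hom := pullback.fst _ _
  isPullback := .of_hasPullback _ _
  equivariant := equivariant_of_smul (E := E.baseChange f) fun e g => E.baseChangeAct_fst f e g

/-- A morphism of principal bundles induces morphisms of their base changes. -/
lemma exists_baseChangeMap {U' V' : SchC} {E : PrincipalBundle G V} {E' : PrincipalBundle G V'}
    {l : V ⟶ V'} (φ : E.Hom E' l) {f : U ⟶ V} {f' : U' ⟶ V'} {k : U ⟶ U'} (h : f ≫ l = k ≫ f') :
    ∃ χ : (E.baseChange f).Hom (E'.baseChange f') k,
      χ.hom ≫ (E'.baseChangeHom f').hom = (E.baseChangeHom f).hom ≫ φ.hom :=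
  (E'.baseChangeHom f').exists_lift ((E.baseChangeHom f).comp φ h) k rfl

end PrincipalBundle

section action

variable {Γ : SchC} [GrpObj Γ]

/-- An action on points is an action. -/
abbrev actionOfPoints (M : SchC) (s : Γ ⊗ M ⟶ M)
    (one : ∀ {T : SchC} (m : T ⟶ M), lift 1 m ≫ s = m)
    (mul : ∀ {T : SchC} (g h : T ⟶ Γ) (m : T ⟶ M), lift (g * h) m ≫ s = lift g (lift h m ≫ s) ≫ s) :
    ModObj Γ M where
  smul := s
  one_smul := by
    change η[Γ] ▷ M ≫ s = (λ_ M).hom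
    rw [← one (λ_ M).hom]
    congr 1
  mul_smul := by
    change μ[Γ] ▷ M ≫ s = (α_ Γ Γ M).hom ≫ Γ ◁ s ≫ s
    have := mul (fst (Γ ⊗ Γ) M ≫ fst Γ Γ) (fst (Γ ⊗ Γ) M ≫ snd Γ Γ) (snd (Γ ⊗ Γ) M)
    convert! this using 1
    · congr 1
      apply CartesianMonoidalCategory.hom_ext
      · rw [lift_fst, whiskerRight_fst, MonObj.mul_eq_mul, MonObj.comp_mul]
      · simp
    · rw [← Category.assoc]
      congr 1
      apply CartesianMonoidalCategory.hom_ext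
      · simp
      · rw [lift_snd, Category.assoc, whiskerLeft_snd, ← Category.assoc]
        congr 1
        apply CartesianMonoidalCategory.hom_ext <;> simp

/-- The action on a fibre product of schemes with actions. -/
abbrev pullbackAct {A B Z : SchC} [ModObj Γ A] [ModObj Γ B] {p : A ⟶ Z} {q : B ⟶ Z}
    (h : ∀ {T : SchC} (g : T ⟶ Γ) (a : T ⟶ A) (b : T ⟶ B), a ≫ p = b ≫ q →
      (g • a) ≫ p = (g • b) ≫ q) : ModObj Γ (pullback p q) :=
  letI w := h (fst Γ (pullback p q)) (snd Γ _ ≫ pullback.fst p q) (snd Γ _ ≫ pullback.snd p q)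
    (by rw [Category.assoc, Category.assoc, pullback.condition])
  have h₁ {T : SchC} (g : T ⟶ Γ) (m : T ⟶ pullback p q) :
      (lift g m ≫ pullback.lift _ _ w) ≫ pullback.fst p q = g • (m ≫ pullback.fst p q) := by
    rw [Category.assoc, pullback.lift_fst, ModObj.comp_smul]
    simp
  have h₂ {T : SchC} (g : T ⟶ Γ) (m : T ⟶ pullback p q) :
      (lift g m ≫ pullback.lift _ _ w) ≫ pullback.snd p q = g • (m ≫ pullback.snd p q) := by
    rw [Category.assoc, pullback.lift_snd, ModObj.comp_smul]
    simp
  actionOfPoints _ (pullback.lift _ _ w)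
    (fun m => by
      apply pullback.hom_ext
      · rw [h₁, one_smul]
      · rw [h₂, one_smul])
    (fun g h m => by
      apply pullback.hom_ext
      · rw [h₁, h₁, h₁, mul_smul]
      · rw [h₂, h₂, h₂, mul_smul])

end action

end

end BundleStacks

namespace BundleStacks

noncomputable section

/-! ### Quotients of equivariant principal bundles over torsors -/

section quotient

variable {Γ : SchC} [GrpObj Γ] {G : SchC} [GrpObj G] {U : SchC}
  (M : LeftPrincipalBundle Γ U) (E : PrincipalBundle G M.tot) [ModObj Γ E.tot]

/-- A principal `G`-bundle on a `Γ`-torsor with a compatible action of `Γ` descends to the base of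
the torsor. -/
theorem PrincipalBundle.exists_quotient [IsAlgebraicGroup Γ] [IsAffine G.left]
    (hp : ∀ {T : SchC} (g : T ⟶ Γ) (e : T ⟶ E.tot), (g • e) ≫ E.proj = g • (e ≫ E.proj))
    (hc : ∀ {T : SchC} (g : T ⟶ Γ) (e : T ⟶ E.tot) (h : T ⟶ G),
      g • E.smul e h = E.smul (g • e) h) :
    ∃ (E₀ : PrincipalBundle G U) (θ : E.Hom E₀ M.proj),
      ∀ {T : SchC} (g : T ⟶ Γ) (e : T ⟶ E.tot), (g • e) ≫ θ.hom = e ≫ θ.hom := by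
  obtain ⟨V', c', t', h₁', h₂', h₃', h₄'⟩ := E.exists_trivialization
  -- Affineness of `G` enters here: a trivial bundle is affine over its base, which is what makes
  -- the descent effective.
  have haff : IsAffineHom (fst V' G).left := by
    rw [Over.fst_left]
    have : IsAffineHom G.hom := inferInstance
    exact MorphismProperty.of_isPullback (P := @IsAffineHom) (.flip (.of_hasPullback _ _)) this
  -- Points are related when they lie in one `Γ`-orbit. Moving a point over a given point of `M`
  -- uses transitivity on the fibres of the torsor; uniqueness uses freeness.
  let r : DescentRel E.proj M.proj :=
    { rel := fun {T} n n' => ∃ g : T ⟶ Γ, g • n = n'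
      refl := fun n => ⟨1, one_smul _ _⟩
      symm := by
        rintro T n _ ⟨g, rfl⟩
        exact ⟨g⁻¹, inv_smul_smul _ _⟩
      trans := by
        rintro T n _ _ ⟨g, rfl⟩ ⟨g', rfl⟩
        exact ⟨g' * g, mul_smul _ _ _⟩
      precomp := by
        rintro T' T a n _ ⟨g, rfl⟩
        exact ⟨a ≫ g, (ModObj.comp_smul _ _ _).symm⟩
      comp_eq := by
        rintro T n _ ⟨g, rfl⟩
        rw [reassoc_of% hp, M.smul_proj, Category.assoc]
      lift := by
        intro T n v h
        obtain ⟨g, hg⟩ := M.exists_smul_eq (m := n ≫ E.proj) (m' := v) (by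
          rw [h, Category.assoc])
        exact ⟨g • n, ⟨g, rfl⟩, by rw [hp, hg]⟩
      uniq := by
        rintro T n _ ⟨g, rfl⟩ h
        rw [hp] at h
        have : (1 : T ⟶ Γ) • n ≫ E.proj = g • n ≫ E.proj := (one_smul _ _).trans h
        rw [← M.smul_injective this, one_smul] }
  obtain ⟨N, h, q, hq⟩ := r.isEffective_of_isPullback h₃' haff M.cov_proj (.of_etale h₁' h₂')
  have hqc : Cov q := .of_isPullback hq.isPullback M.cov_proj
  have := hqc.epi
  have hqG : Cov (q ▷ G) := .of_isPullback (isPullback_whiskerRight q G) hqc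
  -- Since the two actions commute, acting by `G` carries `Γ`-orbits to `Γ`-orbits, so the action of
  -- `G` passes to the quotient.
  obtain ⟨act, hact⟩ := hqG.exists_desc (E.act ≫ q) (by
    intro T a b hab
    obtain ⟨g, hg⟩ := hq.rel_of_eq (n := a ≫ fst _ _) (n' := b ≫ fst _ _) (by
      simpa using hab =≫ fst _ _)
    have h₂ : a ≫ snd _ _ = b ≫ snd _ _ := by simpa using hab =≫ snd _ _
    have e {x : T ⟶ E.tot ⊗ G} : x ≫ E.act = E.smul (x ≫ fst _ _) (x ≫ snd _ _) := by
      simp [PrincipalBundle.smul]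
    rw [← Category.assoc, ← Category.assoc]
    refine hq.eq_of_rel ⟨g, ?_⟩
    rw [e, e, hc, hg, h₂])
  have key {T : SchC} (e : T ⟶ E.tot) (g : T ⟶ G) : lift (e ≫ q) g ≫ act = E.smul e g ≫ q := by
    have := lift e g ≫= hact
    simpa [PrincipalBundle.smul] using this
  /- Points of the quotient lift locally. -/
  have hloc {T : SchC} (e : T ⟶ N) : ∃ (T' : SchC) (p : T' ⟶ T) (e' : T' ⟶ E.tot), Epi p ∧
      p ≫ e = e' ≫ q :=
    ⟨_, pullback.fst e q, pullback.snd e q, (Cov.of_isPullback (.of_hasPullback _ _) hqc).epi,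
      pullback.condition⟩
  let E₀ : PrincipalBundle G U := .ofPoints N h act
    (fun {T} e => by
      obtain ⟨T', p, e', hp, he⟩ := hloc e
      rw [← cancel_epi p, ← Category.assoc, comp_lift, he, MonObj.comp_one, key, E.smul_one])
    (fun {T} e g g' => by
      obtain ⟨T', p, e', hp, he⟩ := hloc e
      rw [← cancel_epi p, comp_lift_assoc, he, MonObj.comp_mul, key, comp_lift_assoc,
        comp_lift_assoc, he, key, key, E.smul_mul])
    (fun {T} e g => by
      obtain ⟨T', p, e', hp, he⟩ := hloc e
      rw [← cancel_epi p, Category.assoc, comp_lift_assoc, he, reassoc_of% key,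
        hq.isPullback.w, reassoc_of% E.smul_proj, reassoc_of% he, hq.isPullback.w])
    (by
      obtain ⟨V, c, t, h₁, h₂, h₃, h₄⟩ := M.locallyTrivial
      -- The projection `M → U` is only smooth, so triviality of `E` over an étale covering of `M`
      -- does not suffice directly. It is pulled back along the unit section `s` of the torsor over
      -- the étale covering `V → U`.
      have hs : (lift 1 (𝟙 V) ≫ t) ≫ M.proj = c := by simp [h₃.w]
      set s := lift 1 (𝟙 V) ≫ t
      have hp := isPullback_left (IsPullback.of_hasPullback c' s)
      have h₅ : Etale (pullback.snd c' s).left :=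
        MorphismProperty.of_isPullback (P := @Etale) hp h₁'
      have h₆ : Surjective (pullback.snd c' s).left :=
        MorphismProperty.of_isPullback (P := @Surjective) hp h₂'
      refine ⟨pullback c' s, pullback.snd c' s ≫ c, pullback.fst c' s ▷ G ≫ t' ≫ q, ?_, ?_, ?_, ?_⟩
      · rw [Over.comp_left]
        infer_instance
      · rw [Over.comp_left]
        infer_instance
      · have := (isPullback_whiskerRight (pullback.fst c' s) G).paste_horiz
          (h₃'.paste_horiz hq.isPullback)
        rwa [← Category.assoc (pullback.fst c' s), pullback.condition, Category.assoc, hs] at this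
      · intro T v g g'
        simp only [lift_whiskerRight_assoc, reassoc_of% h₄', ← key, Category.assoc])
  exact ⟨E₀, ⟨q, hq.isPullback, PrincipalBundle.equivariant_of_smul (F := E₀) fun e g =>
    (key e g).symm⟩, fun g e => (hq.eq_of_rel ⟨g, rfl⟩).symm⟩

end quotient

end

end BundleStacks

namespace BundleStacks

noncomputable section

/-! ### Smooth atlases of the quotient stack -/

section atlas

variable {Γ : SchC} [GrpObj Γ] {Y : SchC} [ModObj Γ Y] {S : SchC}

/-- The object of the quotient stack underlying an object of its product with a scheme. -/
abbrev qobj (x : ProdScheme (quotientStack Γ Y) S) : QuotientObj Γ Y := x.left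

/-- The map to the second factor underlying an object of the product of the quotient stack with a
scheme. -/
abbrev qhom (x : ProdScheme (quotientStack Γ Y) S) : (qobj x).base ⟶ S := x.hom

/-- The arrow of the quotient stack underlying an arrow of its product with a scheme. -/
abbrev qarr {x y : ProdScheme (quotientStack Γ Y) S} (k : x ⟶ y) : (qobj x).Hom (qobj y) := k.left

lemma qarr_base_hom {x y : ProdScheme (quotientStack Γ Y) S} (k : x ⟶ y) :
    (qarr k).base ≫ qhom y = qhom x :=
  CostructuredArrow.w k

@[simp]
lemma qarr_comp_base {x y z : ProdScheme (quotientStack Γ Y) S} (k : x ⟶ y) (l : y ⟶ z) :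
    (qarr (k ≫ l)).base = (qarr k).base ≫ (qarr l).base :=
  rfl

@[simp]
lemma qarr_comp_tot {x y z : ProdScheme (quotientStack Γ Y) S} (k : x ⟶ y) (l : y ⟶ z) :
    (qarr (k ≫ l)).tot = (qarr k).tot ≫ (qarr l).tot :=
  rfl

lemma qarr_ext {x y : ProdScheme (quotientStack Γ Y) S} {k l : x ⟶ y}
    (h : (qarr k).base = (qarr l).base) (h' : (qarr k).tot = (qarr l).tot) : k = l :=
  CostructuredArrow.hom_ext _ _ (QuotientObj.Hom.ext h h')

/-- An object of the product of the quotient stack with a scheme. -/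
abbrev qmk (M : QuotientObj Γ Y) (s : M.base ⟶ S) : ProdScheme (quotientStack Γ Y) S :=
  { left := M, right := ⟨⟨⟩⟩, hom := s }

/-- An arrow in the product of the quotient stack with a scheme. -/
abbrev qhomMk {x y : ProdScheme (quotientStack Γ Y) S} (k : (qobj x).Hom (qobj y))
    (hk : k.base ≫ qhom y = qhom x) : x ⟶ y :=
  CostructuredArrow.homMk (f := x) (f' := y) k hk

/-- Arrows in the product of the quotient stack with a scheme are cartesian. -/
lemma exists_arrow {x' x y : ProdScheme (quotientStack Γ Y) S} (k : x ⟶ y) (l : x' ⟶ y)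
    (g : (qobj x').base ⟶ (qobj x).base) (hg : g ≫ (qarr k).base = (qarr l).base) :
    ∃ m : x' ⟶ x, (qarr m).base = g ∧ m ≫ k = l := by
  obtain ⟨m, h₁, h₂, -⟩ := QuotientObj.existsUnique_lift (qarr k) (qarr l) g hg
  refine ⟨qhomMk m ?_, h₁, qarr_ext ?_ h₂⟩
  · rw [h₁, ← qarr_base_hom k, reassoc_of% hg, qarr_base_hom]
  · change m.base ≫ _ = _
    rw [h₁, hg]

lemma arrow_unique {x' x y : ProdScheme (quotientStack Γ Y) S} (k : x ⟶ y) {m m' : x' ⟶ x}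
    (hm : (qarr m).base = (qarr m').base) (h : m ≫ k = m' ≫ k) : m = m' := by
  obtain ⟨n, -, -, h₃⟩ := QuotientObj.existsUnique_lift (qarr k) (qarr (m ≫ k)) (qarr m).base rfl
  refine qarr_ext hm (congrArg QuotientObj.Hom.tot ((h₃ (qarr m) rfl rfl).trans
    (h₃ (qarr m') hm.symm ?_).symm))
  rw [h, qarr_comp_tot]

/-- An object which is smooth over a smooth atlas is a smooth atlas. -/
lemma isSmoothAtlas_of_smooth {v x : ProdScheme (quotientStack Γ Y) S} (a : v ⟶ x)
    (ha : Smooth (qarr a).base.left) (hx : IsSmoothAtlas (ProdScheme.p (quotientStack Γ Y) S) x) :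
    IsSmoothAtlas (ProdScheme.p (quotientStack Γ Y) S) v := by
  intro w
  obtain ⟨c, c₁, c₂, hc, hsm⟩ := hx w
  -- The product of `v` and `w` is the base change along `v → x` of the product `c` of `x` and `w`.
  -- Its map to `w` is smooth as a composite of a base change of `a` and the map from `c`.
  let q : pullback (qarr a).base (qarr c₁).base ⟶ (qobj c).base := pullback.snd _ _
  let d : ProdScheme (quotientStack Γ Y) S := qmk ((qobj c).baseChange q) (q ≫ qhom c)
  let d₂ : d ⟶ c := qhomMk ((qobj c).baseChangeHom q) rfl
  obtain ⟨d₁, h₁, h₁'⟩ := exists_arrow a (d₂ ≫ c₁) (pullback.fst _ _) pullback.condition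
  refine ⟨d, d₁, d₂ ≫ c₂, fun u f g => ?_, ?_⟩
  · obtain ⟨m, ⟨hm₁, hm₂⟩, hm⟩ := hc u (f ≫ a) g
    have hw : (qarr f).base ≫ (qarr a).base = (qarr m).base ≫ (qarr c₁).base := by
      rw [← qarr_comp_base, ← qarr_comp_base, hm₁]
    obtain ⟨n, hn, hn'⟩ := exists_arrow d₂ m (pullback.lift _ _ hw) (pullback.lift_snd _ _ hw)
    refine ⟨n, ⟨arrow_unique a ?_ ?_, ?_⟩, ?_⟩
    · rw [qarr_comp_base, hn, h₁]
      exact pullback.lift_fst _ _ hw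
    · rw [Category.assoc, h₁', reassoc_of% hn', hm₁]
    · rw [reassoc_of% hn', hm₂]
    · rintro n' ⟨e₁, e₂⟩
      have e₃ : n' ≫ d₂ = m := hm _ ⟨by rw [Category.assoc, ← h₁', reassoc_of% e₁],
        by rw [Category.assoc, e₂]⟩
      refine arrow_unique d₂ (pullback.hom_ext ?_ ?_) (e₃.trans hn'.symm)
      · rw [hn]
        refine Eq.trans ?_ (pullback.lift_fst _ _ hw).symm
        rw [← h₁]
        exact congrArg (fun k => (qarr k).base) e₁
      · rw [hn]
        refine Eq.trans ?_ (pullback.lift_snd _ _ hw).symm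
        exact congrArg (fun k => (qarr k).base) e₃
  · have : Smooth (qarr c₂).base.left := hsm
    have h : Smooth q.left :=
      MorphismProperty.of_isPullback (P := @Smooth) (isPullback_left (.of_hasPullback _ _)) ha
    change Smooth (q.left ≫ (qarr c₂).base.left)
    infer_instance

/-! ### Trivial torsors -/

/-- The action of a group on a trivial left principal bundle. -/
def trivialSmul (Γ : SchC) [GrpObj Γ] (U : SchC) : Γ ⊗ (Γ ⊗ U) ⟶ Γ ⊗ U :=
  lift (fst Γ (Γ ⊗ U) * snd _ _ ≫ fst Γ U) (snd _ _ ≫ snd Γ U)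

lemma lift_trivialSmul {U T : SchC} (g : T ⟶ Γ) (m : T ⟶ Γ ⊗ U) :
    lift g m ≫ trivialSmul Γ U = lift (g * m ≫ fst Γ U) (m ≫ snd Γ U) := by
  simp [trivialSmul, MonObj.comp_mul]

variable (Γ) in
/-- The trivial left principal bundle. -/
def LeftPrincipalBundle.trivial (U : SchC) : LeftPrincipalBundle Γ U :=
  letI act : ModObj Γ (Γ ⊗ U) := actionOfPoints (Γ ⊗ U) (trivialSmul Γ U)
    (fun m => by
      rw [lift_trivialSmul, one_mul]
      apply CartesianMonoidalCategory.hom_ext <;> simp)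
    (fun g h m => by
      simp only [lift_trivialSmul, lift_fst, lift_snd, mul_assoc])
  { tot := Γ ⊗ U
    proj := snd Γ U
    act := act
    act_proj := lift_snd _ _
    locallyTrivial := by
      refine ⟨U, 𝟙 U, 𝟙 _, ?_, ?_, .of_horiz_isIso ⟨by simp⟩, ?_⟩
      · rw [Over.id_left]
        infer_instance
      · rw [Over.id_left]
        infer_instance
      · change _ = (α_ Γ Γ U).hom ≫ Γ ◁ 𝟙 _ ≫ trivialSmul Γ U
        have := lift_trivialSmul (fst (Γ ⊗ Γ) U ≫ fst Γ Γ)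
          (lift (fst (Γ ⊗ Γ) U ≫ snd Γ Γ) (snd (Γ ⊗ Γ) U))
        rw [whiskerLeft_id, Category.id_comp, Category.comp_id]
        convert! this.symm using 1
        · apply CartesianMonoidalCategory.hom_ext
          · rw [lift_fst, lift_fst, whiskerRight_fst, MonObj.mul_eq_mul, MonObj.comp_mul]
          · simp }

section points

variable {U T T' : SchC}

/-- The point of the trivial left principal bundle with given coordinates. -/
def tpt (g : T ⟶ Γ) (u : T ⟶ U) : T ⟶ (LeftPrincipalBundle.trivial Γ U).tot := lift g u

/-- The projection from a trivial left principal bundle to the group. -/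
def tfst : (LeftPrincipalBundle.trivial Γ U).tot ⟶ Γ := fst Γ U

@[simp]
lemma tpt_fst (g : T ⟶ Γ) (u : T ⟶ U) : tpt g u ≫ tfst = g := lift_fst _ _

@[simp]
lemma tpt_proj (g : T ⟶ Γ) (u : T ⟶ U) :
    tpt g u ≫ (LeftPrincipalBundle.trivial Γ U).proj = u :=
  lift_snd _ _

@[simp]
lemma tpt_proj_assoc (g : T ⟶ Γ) (u : T ⟶ U) {W : SchC} (f : U ⟶ W) :
    tpt g u ≫ (LeftPrincipalBundle.trivial Γ U).proj ≫ f = u ≫ f := by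
  rw [← Category.assoc, tpt_proj]

lemma tpt_ext {m m' : T ⟶ (LeftPrincipalBundle.trivial Γ U).tot} (h : m ≫ tfst = m' ≫ tfst)
    (h' : m ≫ (LeftPrincipalBundle.trivial Γ U).proj = m' ≫ (LeftPrincipalBundle.trivial Γ U).proj) :
    m = m' :=
  CartesianMonoidalCategory.hom_ext (X := Γ) (Y := U) _ _ h h'

lemma exists_tpt (m : T ⟶ (LeftPrincipalBundle.trivial Γ U).tot) :
    ∃ (g : T ⟶ Γ) (u : T ⟶ U), m = tpt g u :=
  ⟨m ≫ tfst, m ≫ (LeftPrincipalBundle.trivial Γ U).proj, tpt_ext (by simp) (by simp)⟩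

lemma tpt_inj {g g' : T ⟶ Γ} {u u' : T ⟶ U} (h : tpt g u = tpt g' u') : g = g' ∧ u = u' :=
  ⟨by simpa using h =≫ tfst, by simpa using h =≫ (LeftPrincipalBundle.trivial Γ U).proj⟩

@[simp]
lemma comp_tpt (t : T' ⟶ T) (g : T ⟶ Γ) (u : T ⟶ U) : t ≫ tpt g u = tpt (t ≫ g) (t ≫ u) :=
  tpt_ext (by simp) (by simp)

@[simp]
lemma smul_tpt (d g : T ⟶ Γ) (u : T ⟶ U) : d • tpt g u = tpt (d * g) u := by
  refine (lift_trivialSmul d (lift g u)).trans ?_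
  rw [lift_fst, lift_snd]
  rfl

end points

variable (Γ) in
/-- The trivial object of the quotient stack given by a scheme over `Y`. -/
abbrev QuotientObj.trivial {Z : SchC} (f : Z ⟶ Y) : QuotientObj Γ Y where
  base := Z
  bundle := .trivial Γ Z
  toY := (tfst : (LeftPrincipalBundle.trivial Γ Z).tot ⟶ Γ) •
    ((LeftPrincipalBundle.trivial Γ Z).proj ≫ f)
  equivariant := equivariant_of_smul fun {T} d m => by
    obtain ⟨g, u, rfl⟩ := exists_tpt m
    rw [smul_tpt, ModObj.comp_smul, ModObj.comp_smul, tpt_fst, tpt_proj_assoc, tpt_fst,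
      tpt_proj_assoc, mul_smul]

lemma tpt_toY {Z : SchC} (f : Z ⟶ Y) {T : SchC} (g : T ⟶ Γ) (z : T ⟶ Z) :
    tpt g z ≫ (QuotientObj.trivial Γ f).toY = g • (z ≫ f) := by
  rw [ModObj.comp_smul, tpt_fst, tpt_proj_assoc]

/-- A morphism of schemes over `Y` induces an arrow between the trivial objects. -/
def QuotientObj.trivialMap {Z Z' : SchC} {f : Z ⟶ Y} {f' : Z' ⟶ Y} (k : Z ⟶ Z')
    (h : k ≫ f' = f) : Hom (trivial Γ f) (trivial Γ f') where
  base := k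
  tot := tpt tfst ((LeftPrincipalBundle.trivial Γ Z).proj ≫ k)
  isPullback := by
    refine isPullback_of_existsUnique (tpt_proj _ _)
      (fun T a b h => ⟨tpt (a ≫ tfst) b, ?_, tpt_proj _ _⟩) fun T l l' h h' => ?_
    · exact tpt_ext (by simp) (by simp [h])
    · exact tpt_ext (by simpa using h =≫ tfst) h'
  equivariant := equivariant_of_smul fun {T} d m => by
    obtain ⟨g, u, rfl⟩ := exists_tpt m
    simp
  toY := by
    rw [tpt_toY, Category.assoc, h]

lemma tpt_trivialMap {Z Z' : SchC} {f : Z ⟶ Y} {f' : Z' ⟶ Y} (k : Z ⟶ Z') (h : k ≫ f' = f)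
    {T : SchC} (g : T ⟶ Γ) (z : T ⟶ Z) :
    tpt g z ≫ (QuotientObj.trivialMap k h).tot = tpt g (z ≫ k) := by
  simp [QuotientObj.trivialMap]

/-- The arrow to an object of the quotient stack from the trivial object on its total space. -/
def QuotientObj.fromTrivial (M : QuotientObj Γ Y) : Hom (trivial Γ M.toY) M where
  base := M.bundle.proj
  tot := (tfst : (LeftPrincipalBundle.trivial Γ M.bundle.tot).tot ⟶ Γ) •
    (LeftPrincipalBundle.trivial Γ M.bundle.tot).proj
  -- This is `Γ × M ≅ M ×_U M`: transitivity gives the lift and freeness its uniqueness.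
  isPullback := by
    refine isPullback_of_existsUnique (M.bundle.smul_proj _ _) (fun T a b h => ?_)
      fun T l l' h h' => ?_
    · obtain ⟨g, hg⟩ := M.bundle.exists_smul_eq h
      exact ⟨tpt g b, by rw [ModObj.comp_smul, tpt_fst, tpt_proj, hg], tpt_proj _ _⟩
    · rw [ModObj.comp_smul, ModObj.comp_smul, h'] at h
      exact tpt_ext (M.bundle.smul_injective h) h'
  equivariant := equivariant_of_smul fun {T} d m => by
    obtain ⟨g, u, rfl⟩ := exists_tpt m
    rw [smul_tpt, ModObj.comp_smul, ModObj.comp_smul, tpt_fst, tpt_proj, tpt_fst, tpt_proj,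
      mul_smul]
  toY := by
    rw [smul_comp M.equivariant]

lemma tpt_fromTrivial (M : QuotientObj Γ Y) {T : SchC} (g : T ⟶ Γ) (m : T ⟶ M.bundle.tot) :
    tpt g m ≫ M.fromTrivial.tot = g • m := by
  change tpt g m ≫ (_ • _) = _
  rw [ModObj.comp_smul, tpt_fst, tpt_proj]

end atlas

end

end BundleStacks

/-! ### The atlas `Y × S` of `[Γ\Y] × S` and its products with other objects -/

namespace BundleStacks

noncomputable section

section

variable {Γ : SchC} [GrpObj Γ] {Y : SchC} [ModObj Γ Y] {S : SchC}

lemma lift_prodAction {T : SchC} (g : T ⟶ Γ) (y : T ⟶ Y ⊗ S) :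
    lift g y ≫ prodAction Γ Y S = lift (g • (y ≫ fst Y S)) (y ≫ snd Y S) := by
  have h : lift g y ≫ (α_ Γ Y S).inv = lift (lift g (y ≫ fst Y S)) (y ≫ snd Y S) := by
    apply CartesianMonoidalCategory.hom_ext
    · apply CartesianMonoidalCategory.hom_ext <;> simp
    · simp
  rw [prodAction, reassoc_of% h, lift_whiskerRight, Hom.smul_def]

/-- The action on the product of a scheme with an action and another scheme. -/
instance : ModObj Γ (Y ⊗ S) :=
  actionOfPoints (Y ⊗ S) (prodAction Γ Y S)
    (fun m => by
      rw [lift_prodAction, one_smul]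
      apply CartesianMonoidalCategory.hom_ext <;> simp)
    (fun g h m => by
      simp only [lift_prodAction, lift_fst, lift_snd, mul_smul])

lemma smul_prod {T : SchC} (g : T ⟶ Γ) (y : T ⟶ Y ⊗ S) :
    g • y = lift (g • (y ≫ fst Y S)) (y ≫ snd Y S) :=
  lift_prodAction g y

/-- The map to `Y × S` from the torsor underlying an object of `[Γ \ Y] × S`. -/
def qmap (x : ProdScheme (quotientStack Γ Y) S) : (qobj x).bundle.tot ⟶ Y ⊗ S :=
  lift (qobj x).toY ((qobj x).bundle.proj ≫ qhom x)

lemma smul_qmap (x : ProdScheme (quotientStack Γ Y) S) {T : SchC} (g : T ⟶ Γ)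
    (m : T ⟶ (qobj x).bundle.tot) : (g • m) ≫ qmap x = g • (m ≫ qmap x) := by
  rw [smul_prod, qmap, comp_lift, smul_comp (qobj x).equivariant]
  simp only [Category.assoc, lift_fst, lift_snd]
  rw [← Category.assoc, (qobj x).bundle.smul_proj, Category.assoc]

lemma tot_qmap {S' : SchC} {x : ProdScheme (quotientStack Γ Y) S}
    {y : ProdScheme (quotientStack Γ Y) S'} {h : S ⟶ S'} (k : (qobj x).Hom (qobj y))
    (hk : k.base ≫ qhom y = qhom x ≫ h) : k.tot ≫ qmap y = qmap x ≫ Y ◁ h := by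
  rw [qmap, qmap, comp_lift, k.toY, reassoc_of% k.isPullback.w, hk]
  simp

lemma qarr_qmap {x y : ProdScheme (quotientStack Γ Y) S} (k : x ⟶ y) :
    (qarr k).tot ≫ qmap y = qmap x := by
  rw [tot_qmap (h := 𝟙 S) (qarr k) (by rw [qarr_base_hom, Category.comp_id]), whiskerLeft_id,
    Category.comp_id]

/-- The trivial object of `[Γ \ Y] × S` on `Y × S`. -/
abbrev zObj (Γ : SchC) [GrpObj Γ] (Y : SchC) [ModObj Γ Y] (S : SchC) :
    ProdScheme (quotientStack Γ Y) S :=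
  qmk (.trivial Γ (fst Y S)) (snd Y S)

/-- The trivial object on the total space of the torsor underlying an object of `[Γ \ Y] × S`. -/
abbrev triv (x : ProdScheme (quotientStack Γ Y) S) : ProdScheme (quotientStack Γ Y) S :=
  qmk (.trivial Γ (qobj x).toY) ((qobj x).bundle.proj ≫ qhom x)

/-- The projection from the trivial object. -/
def fromTriv (x : ProdScheme (quotientStack Γ Y) S) : triv x ⟶ x :=
  qhomMk (qobj x).fromTrivial rfl

/-- The map between trivial objects induced by the map to `Y × S`. -/
def trivToZ (x : ProdScheme (quotientStack Γ Y) S) : triv x ⟶ zObj Γ Y S :=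
  qhomMk (x := triv x) (y := zObj Γ Y S) (QuotientObj.trivialMap (qmap x) (lift_fst _ _ : qmap x ≫ fst Y S = (qobj x).toY))
    (lift_snd _ _)

lemma tpt_fromTriv (x : ProdScheme (quotientStack Γ Y) S) {T : SchC} (g : T ⟶ Γ)
    (m : T ⟶ (qobj x).bundle.tot) : tpt g m ≫ (qarr (fromTriv x)).tot = g • m :=
  tpt_fromTrivial (qobj x) g m

lemma tpt_trivToZ (x : ProdScheme (quotientStack Γ Y) S) {T : SchC} (g : T ⟶ Γ)
    (m : T ⟶ (qobj x).bundle.tot) :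
    tpt g m ≫ (qarr (trivToZ x)).tot = tpt g (m ≫ qmap x) :=
  tpt_trivialMap (qmap x) (lift_fst _ _ : qmap x ≫ fst Y S = (qobj x).toY) g m

lemma tpt_qmap_triv (x : ProdScheme (quotientStack Γ Y) S) {T : SchC} (g : T ⟶ Γ)
    (m : T ⟶ (qobj x).bundle.tot) : tpt g m ≫ qmap (triv x) = g • (m ≫ qmap x) := by
  have h := tpt_toY (qobj x).toY g m
  have h' : tpt g m ≫ (LeftPrincipalBundle.trivial Γ (qobj x).bundle.tot).proj ≫
    (qobj x).bundle.proj ≫ qhom x = _ := tpt_proj_assoc g m _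
  rw [smul_prod]
  refine (comp_lift _ _ _).trans ?_
  refine (congrArg₂ lift h h').trans ?_
  simp [qmap]

lemma tpt_qmap_zObj {T : SchC} (g : T ⟶ Γ) (y : T ⟶ Y ⊗ S) :
    tpt g y ≫ qmap (zObj Γ Y S) = g • y := by
  have h := tpt_toY (fst Y S) g y
  have h' : tpt g y ≫ (LeftPrincipalBundle.trivial Γ (Y ⊗ S)).proj ≫ snd Y S = _ :=
    tpt_proj_assoc g y _
  rw [smul_prod]
  exact (comp_lift _ _ _).trans (congrArg₂ lift h h')

/-- Arrows agree if they agree on a section of the torsor. -/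
lemma arrow_ext_of_section {x y : ProdScheme (quotientStack Γ Y) S} {k l : x ⟶ y}
    (h : (qarr k).base = (qarr l).base) (s : (qobj x).base ⟶ (qobj x).bundle.tot)
    (hs : s ≫ (qobj x).bundle.proj = 𝟙 _) (h' : s ≫ (qarr k).tot = s ≫ (qarr l).tot) : k = l := by
  refine qarr_ext h ?_
  obtain ⟨g, hg⟩ := (qobj x).bundle.exists_smul_eq (m := (qobj x).bundle.proj ≫ s)
    (m' := 𝟙 _) (by rw [Category.assoc, hs, Category.comp_id, Category.id_comp])
  rw [← Category.id_comp (qarr k).tot, ← Category.id_comp (qarr l).tot, ← hg,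
    smul_comp (qarr k).equivariant, smul_comp (qarr l).equivariant, Category.assoc, h',
    Category.assoc]

/-- The object `triv x` is the product of `x` and `zObj Γ Y S`. -/
lemma exists_to_triv (x : ProdScheme (quotientStack Γ Y) S) {u : ProdScheme (quotientStack Γ Y) S}
    (f : u ⟶ zObj Γ Y S) (k : u ⟶ x) :
    ∃ m : u ⟶ triv x, m ≫ trivToZ x = f ∧ m ≫ fromTriv x = k ∧
      (∀ m' : u ⟶ triv x, m' ≫ trivToZ x = f → m' ≫ fromTriv x = k → m' = m) ∧
      ∀ s : (qobj u).base ⟶ (qobj u).bundle.tot, s ≫ (qobj u).bundle.proj = 𝟙 _ →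
        s ≫ (qarr f).tot = tpt 1 (qarr f).base → (qarr m).base = s ≫ (qarr k).tot := by
  -- An arrow to the trivial object amounts to a section of the torsor of `u`: here `s` is the
  -- pull-back of the unit section.
  obtain ⟨s, hs, hs'⟩ : ∃ s : (qobj u).base ⟶ (qobj u).bundle.tot,
      s ≫ (qobj u).bundle.proj = 𝟙 _ ∧ s ≫ (qarr f).tot = tpt 1 (qarr f).base := by
    have w : tpt 1 (qarr f).base ≫ (LeftPrincipalBundle.trivial Γ (Y ⊗ S)).proj =
      𝟙 _ ≫ (qarr f).base := by rw [tpt_proj, Category.id_comp]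
    exact ⟨(qarr f).isPullback.lift _ _ w, (qarr f).isPullback.lift_snd _ _ w,
      (qarr f).isPullback.lift_fst _ _ w⟩
  -- The base of an arrow to `triv x` is a point of the torsor of `x`. It is forced to be the image
  -- under `k` of the section attached to `f`, because along that section the group coordinate of
  -- the arrow is `1`.
  have base {m' : u ⟶ triv x} (h₁ : m' ≫ trivToZ x = f) (h₂ : m' ≫ fromTriv x = k)
      (t : (qobj u).base ⟶ (qobj u).bundle.tot) (ht : t ≫ (qobj u).bundle.proj = 𝟙 _)
      (ht' : t ≫ (qarr f).tot = tpt 1 (qarr f).base) :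
      (qarr m').base = t ≫ (qarr k).tot := by
    obtain ⟨g, y, hgy⟩ := exists_tpt (t ≫ (qarr m').tot)
    have e₁ : tpt g y ≫ (qarr (trivToZ x)).tot = tpt 1 (qarr f).base := by
      rw [← hgy, ← ht', ← h₁, Category.assoc]
      rfl
    have e₂ : tpt g y ≫ (qarr (fromTriv x)).tot = t ≫ (qarr k).tot := by
      rw [← hgy, ← h₂, Category.assoc]
      rfl
    rw [tpt_trivToZ] at e₁
    obtain ⟨rfl, -⟩ := tpt_inj e₁
    rw [tpt_fromTriv, one_smul] at e₂
    rw [← e₂]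
    have e₃ := (qarr m').isPullback.w
    have e₄ := t ≫= e₃
    rw [reassoc_of% ht, ← Category.assoc, hgy] at e₄
    exact e₄.symm.trans (tpt_proj _ _)
  -- Arrows are cartesian, so `m` exists as soon as its base is prescribed; its composite with
  -- `trivToZ x` is then compared with `f` along the section `s`.
  obtain ⟨m, hm, hm'⟩ := exists_arrow (fromTriv x) k (s ≫ (qarr k).tot) (by
    have : (s ≫ (qarr k).tot) ≫ (qobj x).bundle.proj = (qarr k).base := by
      rw [Category.assoc, (qarr k).isPullback.w, reassoc_of% hs]
    exact this)
  have h₁ : m ≫ trivToZ x = f := by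
    have hb : (s ≫ (qarr k).tot) ≫ qmap x = (qarr f).base := by
      have e : (tpt 1 (qarr f).base) ≫ qmap (zObj Γ Y S) = s ≫ qmap u := by
        rw [← hs', Category.assoc, qarr_qmap f]
      rw [Category.assoc, qarr_qmap, ← e, tpt_qmap_zObj, one_smul]
    refine arrow_ext_of_section ?_ s hs ?_
    · refine (congrArg (· ≫ qmap x) hm).trans hb
    · obtain ⟨g, y, hgy⟩ := exists_tpt (s ≫ (qarr m).tot)
      have e₁ : y = s ≫ (qarr k).tot := by
        rw [← hm, ← tpt_proj g y, ← hgy, Category.assoc]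
        refine Eq.trans (s ≫= (qarr m).isPullback.w) ?_
        rw [reassoc_of% hs]
      have e₂ : tpt g y ≫ (qarr (fromTriv x)).tot = s ≫ (qarr k).tot := by
        rw [← hgy, ← hm', Category.assoc]
        rfl
      rw [tpt_fromTriv, ← e₁] at e₂
      have e₃ : g = 1 := (qobj x).bundle.smul_injective (e₂.trans (one_smul _ _).symm)
      rw [hs', ← hb, ← e₁, ← e₃, ← tpt_trivToZ, ← hgy, Category.assoc]
      rfl
  refine ⟨m, h₁, hm', fun m' h h' => ?_, base h₁ hm'⟩
  exact arrow_unique (fromTriv x) ((base h h' s hs hs').trans hm.symm) (h'.trans hm'.symm)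

/-- The diagonal of `zObj`. -/
lemma exists_diag : ∃ e : zObj Γ Y S ⟶ triv (zObj Γ Y S), e ≫ trivToZ _ = 𝟙 _ ∧
    e ≫ fromTriv _ = 𝟙 _ ∧ (qarr e).base = tpt (T := Y ⊗ S) 1 (𝟙 (Y ⊗ S)) := by
  obtain ⟨m, h₁, h₂, -, h₃⟩ := exists_to_triv (zObj Γ Y S) (𝟙 _) (𝟙 _)
  refine ⟨m, h₁, h₂, (h₃ (tpt (T := Y ⊗ S) 1 (𝟙 (Y ⊗ S))) (tpt_proj _ _) ?_).trans ?_⟩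
  · exact Category.comp_id _
  · exact Category.comp_id _

variable [IsAlgebraicGroup Γ]

variable (Γ Y S) in
-- The product with `w` is `triv w`, and its projection to `w` lies over the torsor `M → U`, which
-- is smooth because `Γ` is.
lemma isSmoothAtlas_zObj : IsSmoothAtlas (ProdScheme.p (quotientStack Γ Y) S) (zObj Γ Y S) := by
  intro w
  refine ⟨triv w, trivToZ w, fromTriv w, fun u f g => ?_, (qobj w).bundle.smooth_proj⟩
  obtain ⟨m, h₁, h₂, h₃, -⟩ := exists_to_triv w f g
  exact ⟨m, ⟨h₁, h₂⟩, fun m' h => h₃ m' h.1 h.2⟩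

lemma isSmoothAtlas_triv {x : ProdScheme (quotientStack Γ Y) S}
    (hx : IsSmoothAtlas (ProdScheme.p (quotientStack Γ Y) S) x) :
    IsSmoothAtlas (ProdScheme.p (quotientStack Γ Y) S) (triv x) :=
  isSmoothAtlas_of_smooth (fromTriv x) (qobj x).bundle.smooth_proj hx

end

end

end BundleStacks

namespace BundleStacks

noncomputable section

/-! ### Points of base changes -/

namespace PrincipalBundle

variable {G : SchC} [GrpObj G] {U V : SchC} {P : PrincipalBundle G V} {f : U ⟶ V} {T T' : SchC}

/-- The point of the base change of a principal bundle with given components. -/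
def bpt (m : T ⟶ U) (p : T ⟶ P.tot) (h : p ≫ P.proj = m ≫ f) : T ⟶ (P.baseChange f).tot :=
  pullback.lift p m h

lemma bpt_hom (m : T ⟶ U) (p : T ⟶ P.tot) (h : p ≫ P.proj = m ≫ f) :
    bpt m p h ≫ (P.baseChangeHom f).hom = p :=
  pullback.lift_fst _ _ h

lemma bpt_proj (m : T ⟶ U) (p : T ⟶ P.tot) (h : p ≫ P.proj = m ≫ f) :
    bpt m p h ≫ (P.baseChange f).proj = m :=
  pullback.lift_snd _ _ h

lemma bpt_ext {e e' : T ⟶ (P.baseChange f).tot}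
    (h : e ≫ (P.baseChangeHom f).hom = e' ≫ (P.baseChangeHom f).hom)
    (h' : e ≫ (P.baseChange f).proj = e' ≫ (P.baseChange f).proj) : e = e' :=
  (P.baseChangeHom f).isPullback.hom_ext h h'

lemma exists_bpt (e : T ⟶ (P.baseChange f).tot) :
    ∃ (m : T ⟶ U) (p : T ⟶ P.tot) (h : p ≫ P.proj = m ≫ f), e = bpt m p h := by
  refine ⟨e ≫ (P.baseChange f).proj, e ≫ (P.baseChangeHom f).hom, ?_, bpt_ext ?_ ?_⟩
  · rw [Category.assoc, Category.assoc, (P.baseChangeHom f).isPullback.w]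
  · rw [bpt_hom]
  · rw [bpt_proj]

lemma comp_bpt (t : T' ⟶ T) (m : T ⟶ U) (p : T ⟶ P.tot) (h : p ≫ P.proj = m ≫ f) :
    t ≫ bpt m p h = bpt (t ≫ m) (t ≫ p) (by rw [Category.assoc, h, Category.assoc]) :=
  bpt_ext (by rw [Category.assoc, bpt_hom, bpt_hom]) (by rw [Category.assoc, bpt_proj, bpt_proj])

lemma smul_bpt (m : T ⟶ U) (p : T ⟶ P.tot) (h : p ≫ P.proj = m ≫ f) (g : T ⟶ G) :
    (P.baseChange f).smul (bpt m p h) g = bpt m (P.smul p g) (by rw [P.smul_proj, h]) :=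
  bpt_ext (by rw [(P.baseChangeHom f).smul_hom, bpt_hom, bpt_hom])
    (by rw [(P.baseChange f).smul_proj, bpt_proj, bpt_proj])

lemma bpt_congr {m m' : T ⟶ U} {p p' : T ⟶ P.tot} {h : p ≫ P.proj = m ≫ f}
    {h' : p' ≫ P.proj = m' ≫ f} (e : m = m') (e' : p = p') : bpt m p h = bpt m' p' h' := by
  subst e e'
  rfl

end PrincipalBundle

open PrincipalBundle

section

variable {Γ : SchC} [GrpObj Γ]

lemma pullbackAct_smul {A B Z : SchC} [ModObj Γ A] [ModObj Γ B] {p : A ⟶ Z} {q : B ⟶ Z}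
    (h : ∀ {T : SchC} (g : T ⟶ Γ) (a : T ⟶ A) (b : T ⟶ B), a ≫ p = b ≫ q →
      (g • a) ≫ p = (g • b) ≫ q) {T : SchC} (g : T ⟶ Γ) (m : T ⟶ pullback p q) :
    letI := pullbackAct h
    (g • m) ≫ pullback.fst p q = g • (m ≫ pullback.fst p q) ∧
      (g • m) ≫ pullback.snd p q = g • (m ≫ pullback.snd p q) := by
  let := pullbackAct h
  let w := h (fst Γ (pullback p q)) (snd Γ _ ≫ pullback.fst p q) (snd Γ _ ≫ pullback.snd p q)
    (by rw [Category.assoc, Category.assoc, pullback.condition])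
  have e : g • m = lift g m ≫ pullback.lift _ _ w := rfl
  constructor
  · rw [e, Category.assoc, pullback.lift_fst, ModObj.comp_smul]
    simp
  · rw [e, Category.assoc, pullback.lift_snd, ModObj.comp_smul]
    simp

end

section

variable {Γ : SchC} [GrpObj Γ] {G : SchC} [GrpObj G] {Y : SchC} [ModObj Γ Y] {S : SchC}

/-! ### Principal bundles on the quotient stack -/

/-- Smooth atlases of the product of the quotient stack with a scheme. -/
abbrev Atlas (x : ProdScheme (quotientStack Γ Y) S) : Prop :=
  IsSmoothAtlas (ProdScheme.p (quotientStack Γ Y) S) x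

/-- The value of a principal bundle at a smooth atlas. -/
def eobj (E : PrincipalBundleOn G (ProdScheme.p (quotientStack Γ Y) S))
    {x : ProdScheme (quotientStack Γ Y) S} (hx : Atlas x) : PrincipalBundle G (qobj x).base :=
  E.obj x hx

/-- The value of a principal bundle at an arrow between smooth atlases. -/
def emap (E : PrincipalBundleOn G (ProdScheme.p (quotientStack Γ Y) S))
    {x y : ProdScheme (quotientStack Γ Y) S} (hx : Atlas x) (hy : Atlas y) (k : x ⟶ y) :
    (eobj E hx).Hom (eobj E hy) (qarr k).base :=
  E.map hx hy k

lemma emap_comp (E : PrincipalBundleOn G (ProdScheme.p (quotientStack Γ Y) S))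
    {x y z : ProdScheme (quotientStack Γ Y) S} (hx : Atlas x) (hy : Atlas y) (hz : Atlas z)
    (k : x ⟶ y) (l : y ⟶ z) :
    (emap E hx hz (k ≫ l)).hom = (emap E hx hy k).hom ≫ (emap E hy hz l).hom :=
  E.map_comp hx hy hz k l

lemma emap_id (E : PrincipalBundleOn G (ProdScheme.p (quotientStack Γ Y) S))
    {x : ProdScheme (quotientStack Γ Y) S} (hx : Atlas x) : (emap E hx hx (𝟙 x)).hom = 𝟙 _ :=
  E.map_id hx

/-- The value of a pull-back diagram of principal bundles. -/
def happ {S' : SchC} {E : PrincipalBundleOn G (ProdScheme.p (quotientStack Γ Y) S)}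
    {E' : PrincipalBundleOn G (ProdScheme.p (quotientStack Γ Y) S')} {h : S ⟶ S'} (φ : E.Hom E' h)
    {x : ProdScheme (quotientStack Γ Y) S} {y : ProdScheme (quotientStack Γ Y) S'}
    (hx : Atlas x) (hy : Atlas y) (k : (qobj x).Hom (qobj y))
    (hk : k.base ≫ qhom y = qhom x ≫ h) : (eobj E hx).Hom (eobj E' hy) k.base :=
  φ.app x hx y hy k hk

namespace EquivariantBunObj

variable (P : EquivariantBunObj Γ G Y)

lemma smul_proj {T : SchC} (g : T ⟶ Γ) (p : T ⟶ P.bundle.tot) :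
    (g • p) ≫ P.bundle.proj = g • (p ≫ P.bundle.proj) := by
  rw [Hom.smul_def, Category.assoc, P.act_proj, lift_whiskerLeft_assoc]
  rfl

lemma smul_comm {T : SchC} (g : T ⟶ Γ) (p : T ⟶ P.bundle.tot) (h : T ⟶ G) :
    g • P.bundle.smul p h = P.bundle.smul (g • p) h := by
  have := lift g (lift p h) ≫= P.act_comm
  simpa [Hom.smul_def, PrincipalBundle.smul] using this

end EquivariantBunObj

/-- A realization of a `(Γ, G)`-bundle `P` over `Y × S` by a principal bundle `E` on
`[Γ \ Y] × S`: for each smooth atlas, given by a torsor `M ⟶ U` with an equivariant map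
`M ⟶ Y × S`, the pull-back of `P` to `M` is identified with the pull-back of `E` from `U`. -/
structure Realization (P : EquivariantBunObj Γ G Y)
    (E : PrincipalBundleOn G (ProdScheme.p (quotientStack Γ Y) P.base)) where
  hom {x : ProdScheme (quotientStack Γ Y) P.base} (hx : Atlas x) :
    (P.bundle.baseChange (qmap x)).Hom (eobj E hx) (qobj x).bundle.proj
  smul {x : ProdScheme (quotientStack Γ Y) P.base} (hx : Atlas x) {T : SchC} (g : T ⟶ Γ)
    (m : T ⟶ (qobj x).bundle.tot) (p : T ⟶ P.bundle.tot) (h : p ≫ P.bundle.proj = m ≫ qmap x)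
    (h' : (g • p) ≫ P.bundle.proj = (g • m) ≫ qmap x) :
    bpt (g • m) (g • p) h' ≫ (hom hx).hom = bpt m p h ≫ (hom hx).hom
  naturality {x y : ProdScheme (quotientStack Γ Y) P.base} (hx : Atlas x) (hy : Atlas y)
    (k : x ⟶ y) {T : SchC}
    (m : T ⟶ (qobj x).bundle.tot) (p : T ⟶ P.bundle.tot) (h : p ≫ P.bundle.proj = m ≫ qmap x)
    (h' : p ≫ P.bundle.proj = (m ≫ (qarr k).tot) ≫ qmap y) :
    bpt m p h ≫ (hom hx).hom ≫ (emap E hx hy k).hom = bpt (m ≫ (qarr k).tot) p h' ≫ (hom hy).hom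

variable [IsAlgebraicGroup Γ]

/-- Morphisms of `(Γ, G)`-bundles descend to the quotients by `Γ`. -/
lemma exists_desc_map {P P' : EquivariantBunObj Γ G Y} (f : P.Hom P')
    {x : ProdScheme (quotientStack Γ Y) P.base} {y : ProdScheme (quotientStack Γ Y) P'.base}
    (k : (qobj x).Hom (qobj y)) (hk : k.base ≫ qhom y = qhom x ≫ f.base)
    {A : PrincipalBundle G (qobj x).base} {B : PrincipalBundle G (qobj y).base}
    (θ : (P.bundle.baseChange (qmap x)).Hom A (qobj x).bundle.proj)
    (θ' : (P'.bundle.baseChange (qmap y)).Hom B (qobj y).bundle.proj)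
    (hθ' : ∀ {T : SchC} (g : T ⟶ Γ) (m : T ⟶ (qobj y).bundle.tot) (p : T ⟶ P'.bundle.tot)
      (h : p ≫ P'.bundle.proj = m ≫ qmap y) (h' : (g • p) ≫ P'.bundle.proj = (g • m) ≫ qmap y),
      bpt (g • m) (g • p) h' ≫ θ'.hom = bpt m p h ≫ θ'.hom)
    (hθ : ∀ {T : SchC} (g : T ⟶ Γ) (m : T ⟶ (qobj x).bundle.tot) (p : T ⟶ P.bundle.tot)
      (h : p ≫ P.bundle.proj = m ≫ qmap x) (h' : (g • p) ≫ P.bundle.proj = (g • m) ≫ qmap x),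
      bpt (g • m) (g • p) h' ≫ θ.hom = bpt m p h ≫ θ.hom) :
    ∃ χ : A.Hom B k.base, ∀ {T : SchC} (m : T ⟶ (qobj x).bundle.tot) (p : T ⟶ P.bundle.tot)
      (h : p ≫ P.bundle.proj = m ≫ qmap x)
      (h' : (p ≫ f.map.hom) ≫ P'.bundle.proj = (m ≫ k.tot) ≫ qmap y),
      bpt m p h ≫ θ.hom ≫ χ.hom = bpt (m ≫ k.tot) (p ≫ f.map.hom) h' ≫ θ'.hom := by
  -- `ψ₀` is the map induced by `f` and `k` between the pull-backs of the two equivariant bundles to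
  -- the two torsors; it remains to see that it passes to the quotients.
  obtain ⟨ψ₀, hψ₀⟩ := exists_baseChangeMap f.map (tot_qmap k hk).symm
  have hψ {T : SchC} (m : T ⟶ (qobj x).bundle.tot) (p : T ⟶ P.bundle.tot)
      (h : p ≫ P.bundle.proj = m ≫ qmap x)
      (h' : (p ≫ f.map.hom) ≫ P'.bundle.proj = (m ≫ k.tot) ≫ qmap y) :
      bpt m p h ≫ ψ₀.hom = bpt (m ≫ k.tot) (p ≫ f.map.hom) h' := by
    apply bpt_ext
    · rw [Category.assoc, hψ₀, reassoc_of% bpt_hom m p h, bpt_hom]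
    · rw [Category.assoc, ψ₀.isPullback.w, reassoc_of% bpt_proj m p h, bpt_proj]
  have hf {T : SchC} {m : T ⟶ (qobj x).bundle.tot} {p : T ⟶ P.bundle.tot}
      (h : p ≫ P.bundle.proj = m ≫ qmap x) :
      (p ≫ f.map.hom) ≫ P'.bundle.proj = (m ≫ k.tot) ≫ qmap y := by
    rw [Category.assoc, f.map.isPullback.w, reassoc_of% h, Category.assoc, tot_qmap k hk]
  obtain ⟨χ, hχ⟩ := θ.exists_desc (qobj x).bundle.cov_proj (ψ₀.comp θ' k.isPullback.w) (by
    intro T a b e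
    obtain ⟨m, p, h, rfl⟩ := exists_bpt a
    obtain ⟨m', p', h', rfl⟩ := exists_bpt b
    -- The fibres of `θ` are `Γ`-orbits: the torsor components of two such points differ by some
    -- `g`, and as `θ` is cartesian and invariant, so do the points themselves. Invariance of `θ'`
    -- concludes.
    obtain ⟨g, rfl⟩ := (qobj x).bundle.exists_smul_eq (m := m) (m' := m') (by
      rw [← bpt_proj m p h, ← bpt_proj m' p' h', Category.assoc, Category.assoc,
        ← θ.isPullback.w, reassoc_of% e])
    have hg : (g • p) ≫ P.bundle.proj = (g • m) ≫ qmap x := by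
      rw [P.smul_proj, smul_qmap, h]
    have e' : bpt (g • m) (g • p) hg = bpt (g • m) p' h' := by
      refine θ.isPullback.hom_ext ?_ ?_
      · rw [hθ g m p h, e]
      · rw [bpt_proj, bpt_proj]
    obtain rfl : g • p = p' := by
      rw [← bpt_hom (g • m) p' h', ← e', bpt_hom]
    change _ ≫ ψ₀.hom ≫ θ'.hom = _ ≫ ψ₀.hom ≫ θ'.hom
    rw [reassoc_of% hψ m p h (hf h), reassoc_of% hψ (g • m) (g • p) h' (hf h'),
      ← hθ' g (m ≫ k.tot) (p ≫ f.map.hom) (hf h) (by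
        rw [P'.smul_proj, smul_qmap, hf h])]
    congr 1
    exact bpt_congr (smul_comp k.equivariant g m).symm (smul_comp f.equivariant g p).symm)
  refine ⟨χ, fun {T} m p h h' => ?_⟩
  rw [hχ, ← hψ m p h h', Category.assoc]
  rfl

/-- Each `(Γ, G)`-bundle is realized by a principal bundle on the quotient stack. -/
theorem exists_realization [IsAffine G.left] (P : EquivariantBunObj Γ G Y) :
    ∃ E : PrincipalBundleOn G (ProdScheme.p (quotientStack Γ Y) P.base),
      Nonempty (Realization P E) := by
  have H (x : ProdScheme (quotientStack Γ Y) P.base) :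
      ∃ (A : PrincipalBundle G (qobj x).base)
        (θ : (P.bundle.baseChange (qmap x)).Hom A (qobj x).bundle.proj),
        ∀ {T : SchC} (g : T ⟶ Γ) (m : T ⟶ (qobj x).bundle.tot) (p : T ⟶ P.bundle.tot)
          (h : p ≫ P.bundle.proj = m ≫ qmap x)
          (h' : (g • p) ≫ P.bundle.proj = (g • m) ≫ qmap x),
          bpt (g • m) (g • p) h' ≫ θ.hom = bpt m p h ≫ θ.hom := by
    have hg {T : SchC} (g : T ⟶ Γ) (p : T ⟶ P.bundle.tot) (m : T ⟶ (qobj x).bundle.tot)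
        (h : p ≫ P.bundle.proj = m ≫ qmap x) :
        (g • p) ≫ P.bundle.proj = (g • m) ≫ qmap x := by
      rw [P.smul_proj, smul_qmap, h]
    let : ModObj Γ (P.bundle.baseChange (qmap x)).tot := pullbackAct hg
    have hs {T : SchC} (g : T ⟶ Γ) (m : T ⟶ (qobj x).bundle.tot) (p : T ⟶ P.bundle.tot)
        (h : p ≫ P.bundle.proj = m ≫ qmap x) :
        g • (bpt m p h) = bpt (g • m) (g • p) (hg g p m h) := by
      have h₁ := pullbackAct_smul hg g (bpt m p h)
      exact bpt_ext (h₁.1.trans ((congrArg (g • ·) (bpt_hom m p h)).trans (bpt_hom _ _ _).symm))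
        (h₁.2.trans ((congrArg (g • ·) (bpt_proj m p h)).trans (bpt_proj _ _ _).symm))
    obtain ⟨A, θ, hθ⟩ := (P.bundle.baseChange (qmap x)).exists_quotient (qobj x).bundle
      (fun g e => by
        obtain ⟨m, p, h, rfl⟩ := exists_bpt e
        rw [hs, bpt_proj, bpt_proj])
      (fun g e d => by
        obtain ⟨m, p, h, rfl⟩ := exists_bpt e
        rw [smul_bpt, hs, hs, smul_bpt]
        exact bpt_congr rfl (P.smul_comm g p d))
    refine ⟨A, θ, fun g m p h h' => ?_⟩
    exact (congrArg (· ≫ θ.hom) (hs g m p h)).symm.trans (hθ g _)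
  choose A θ hθ using H
  have H' {x y : ProdScheme (quotientStack Γ Y) P.base} (k : x ⟶ y) :
      ∃ χ : (A x).Hom (A y) (qarr k).base,
        ∀ {T : SchC} (m : T ⟶ (qobj x).bundle.tot) (p : T ⟶ P.bundle.tot)
          (h : p ≫ P.bundle.proj = m ≫ qmap x)
          (h' : p ≫ P.bundle.proj = (m ≫ (qarr k).tot) ≫ qmap y),
          bpt m p h ≫ (θ x).hom ≫ χ.hom = bpt (m ≫ (qarr k).tot) p h' ≫ (θ y).hom := by
    -- An arrow of the stack over `S` changes only the torsor, so the transition maps come from the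
    -- identity of `P`.
    obtain ⟨χ, hχ⟩ := exists_desc_map (𝟙 P : P ⟶ P) (x := x) (y := y) (qarr k)
      ((qarr_base_hom k).trans (Category.comp_id _).symm) (θ x) (θ y) (hθ y) (hθ x)
    have e {T : SchC} (p : T ⟶ P.bundle.tot) : p ≫ (𝟙 P : P.Hom P).map.hom = p := by
      change p ≫ 𝟙 _ ≫ 𝟙 _ = p
      simp
    refine ⟨χ, fun m p h h' => ?_⟩
    rw [hχ m p h (by rw [e]; exact h')]
    congr 1
  choose χ hχ using @H'
  have hepi (x : ProdScheme (quotientStack Γ Y) P.base) : Epi (θ x).hom :=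
    (Cov.of_isPullback (θ x).isPullback (qobj x).bundle.cov_proj).epi
  let E : PrincipalBundleOn G (ProdScheme.p (quotientStack Γ Y) P.base) :=
    { obj := fun x _ => A x
      map := fun _ _ k => χ k
      map_comp := fun {x y z} _ _ _ k l => by
        -- Functoriality may be checked on the pull-back of `P` to the torsor, where by `hχ` the
        -- transition maps only move the torsor component.
        rw [← cancel_epi (θ x).hom]
        obtain ⟨m, p, h, e⟩ := exists_bpt (𝟙 (P.bundle.baseChange (qmap x)).tot)
        rw [← Category.id_comp (θ x).hom, e, Category.assoc, Category.assoc,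
          hχ (k ≫ l) m p h (by rw [Category.assoc, qarr_qmap]; exact h),
          reassoc_of% hχ k m p h (by rw [Category.assoc, qarr_qmap]; exact h),
          hχ l _ p _ (by rw [Category.assoc, qarr_qmap, Category.assoc, qarr_qmap]; exact h)]
        congr 1 }
  exact ⟨E, ⟨
    { hom := fun {x} _ => θ x
      smul := fun {x} _ => hθ x
      naturality := fun {x y} _ _ k => hχ k }⟩⟩

end

end

end BundleStacks

namespace BundleStacks

noncomputable section

open PrincipalBundle

section

variable {Γ : SchC} [GrpObj Γ] {G : SchC} [GrpObj G] {Y : SchC} [ModObj Γ Y] {S : SchC}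

/-! ### Maps between trivial objects -/

lemma trivial_hom_ext {U W : SchC} {f f' : (LeftPrincipalBundle.trivial Γ U).tot ⟶ W}
    (h : ∀ {T : SchC} (g : T ⟶ Γ) (u : T ⟶ U), tpt g u ≫ f = tpt g u ≫ f') : f = f' := by
  obtain ⟨g, u, e⟩ := exists_tpt (𝟙 (LeftPrincipalBundle.trivial Γ U).tot)
  rw [← Category.id_comp f, ← Category.id_comp f', e, h]

namespace QuotientObj

lemma trivialMap_tot_comp_fromTrivial {M N : QuotientObj Γ Y} (k : M.Hom N) :
    (trivialMap k.tot k.toY).tot ≫ N.fromTrivial.tot = M.fromTrivial.tot ≫ k.tot :=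
  trivial_hom_ext fun g u => by
    rw [← Category.assoc, tpt_trivialMap, tpt_fromTrivial, ← Category.assoc, tpt_fromTrivial,
      smul_comp k.equivariant]

lemma trivialMap_tot_comp {Z Z' Z'' : SchC} {f : Z ⟶ Y} {f' : Z' ⟶ Y} {f'' : Z'' ⟶ Y} {k : Z ⟶ Z'}
    {l : Z' ⟶ Z''} {m : Z ⟶ Z''} (hk : k ≫ f' = f) (hl : l ≫ f'' = f') (hm : m ≫ f'' = f)
    (h : k ≫ l = m) :
    (trivialMap (Γ := Γ) k hk).tot ≫ (trivialMap l hl).tot = (trivialMap m hm).tot :=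
  trivial_hom_ext fun g u => by
    rw [← Category.assoc, tpt_trivialMap, tpt_trivialMap, tpt_trivialMap, Category.assoc, h]

end QuotientObj

@[simp]
lemma qmap_fst (x : ProdScheme (quotientStack Γ Y) S) : qmap x ≫ fst Y S = (qobj x).toY :=
  lift_fst _ _

/-- Functoriality of `triv`, compatible with both projections of the product with `zObj`; the
naturality of `θ` in `exists_zBundle_hom` comes from it. -/
lemma exists_trivMap {x y : ProdScheme (quotientStack Γ Y) S} (k : x ⟶ y) :
    ∃ l : triv x ⟶ triv y, (qarr l).base = (qarr k).tot ∧ l ≫ trivToZ y = trivToZ x ∧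
      l ≫ fromTriv y = fromTriv x ≫ k := by
  refine ⟨qhomMk (QuotientObj.trivialMap (qarr k).tot (qarr k).toY) ?_, rfl, ?_, ?_⟩
  · change (qarr k).tot ≫ (qobj y).bundle.proj ≫ qhom y = (qobj x).bundle.proj ≫ qhom x
    rw [← Category.assoc, (qarr k).isPullback.w, Category.assoc, qarr_base_hom]
  · exact qarr_ext (qarr_qmap k) (QuotientObj.trivialMap_tot_comp (qarr k).toY (qmap_fst y) (qmap_fst x)
      (qarr_qmap k))
  · exact qarr_ext (qarr k).isPullback.w (QuotientObj.trivialMap_tot_comp_fromTrivial (qarr k))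

lemma act_comm_of_smul {U : SchC} {B : PrincipalBundle G U} [ModObj Γ B.tot]
    (h : ∀ {T : SchC} (g : T ⟶ Γ) (p : T ⟶ B.tot) (d : T ⟶ G),
      g • B.smul p d = B.smul (g • p) d) :
    Γ ◁ B.act ≫ γ[Γ, B.tot] = (α_ Γ B.tot G).inv ≫ γ[Γ, B.tot] ▷ G ≫ B.act := by
  have e₁ : Γ ◁ B.act = lift (fst Γ (B.tot ⊗ G)) (B.smul (snd _ _ ≫ fst _ _) (snd _ _ ≫ snd _ _)) := by
    apply CartesianMonoidalCategory.hom_ext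
    · simp
    · simp [PrincipalBundle.smul, ← comp_lift]
  have e₂ : (α_ Γ B.tot G).inv ≫ γ[Γ, B.tot] ▷ G =
      lift (fst Γ (B.tot ⊗ G) • (snd Γ (B.tot ⊗ G) ≫ fst B.tot G)) (snd _ _ ≫ snd _ _) := by
    apply CartesianMonoidalCategory.hom_ext
    · rw [lift_fst, Category.assoc, whiskerRight_fst, Hom.smul_def, ← Category.assoc]
      congr 1
      apply CartesianMonoidalCategory.hom_ext <;> simp
    · simp
  rw [e₁, reassoc_of% e₂]
  exact h _ _ _

/-! ### Bundles on the quotient stack come from equivariant bundles -/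

variable [IsAlgebraicGroup Γ] (E : PrincipalBundleOn G (ProdScheme.p (quotientStack Γ Y) S))

/-- The principal `G`-bundle on `Y × S` given by a principal bundle on `[Γ \ Y] × S`. -/
abbrev zBundle : PrincipalBundle G (Y ⊗ S) := eobj E (isSmoothAtlas_zObj Γ Y S)

/-- The identification of the pull-back of `zBundle E` to a torsor with the pull-back of `E`. -/
lemma exists_zBundle_hom : ∃ θ : ∀ {x : ProdScheme (quotientStack Γ Y) S} (hx : Atlas x),
    ((zBundle E).baseChange (qmap x)).Hom (eobj E hx) (qobj x).bundle.proj,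
    (∀ {x y : ProdScheme (quotientStack Γ Y) S} (hx : Atlas x) (hy : Atlas y) (k : x ⟶ y)
      {T : SchC} (m : T ⟶ (qobj x).bundle.tot) (p : T ⟶ (zBundle E).tot)
      (h : p ≫ (zBundle E).proj = m ≫ qmap x)
      (h' : p ≫ (zBundle E).proj = (m ≫ (qarr k).tot) ≫ qmap y),
      bpt m p h ≫ (θ hx).hom ≫ (emap E hx hy k).hom =
        bpt (m ≫ (qarr k).tot) p h' ≫ (θ hy).hom) ∧
    (∀ {x : ProdScheme (quotientStack Γ Y) S} (hx : Atlas x) {T : SchC} (g : T ⟶ Γ)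
      (m : T ⟶ (qobj x).bundle.tot) (p q : T ⟶ (zBundle E).tot)
      (h : p ≫ (zBundle E).proj = (g • m) ≫ qmap x)
      (h' : p ≫ (zBundle E).proj = tpt g (m ≫ qmap x) ≫ qmap (zObj Γ Y S))
      (hq : q ≫ (zBundle E).proj = m ≫ qmap x),
      bpt (tpt g (m ≫ qmap x)) p h' ≫ (θ (isSmoothAtlas_zObj Γ Y S)).hom = q →
      bpt (g • m) p h ≫ (θ hx).hom = bpt m q hq ≫ (θ hx).hom) ∧
    ∀ {T : SchC} (p : T ⟶ (zBundle E).tot)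
      (h : p ≫ (zBundle E).proj = tpt 1 (p ≫ (zBundle E).proj) ≫ qmap (zObj Γ Y S)),
      bpt (tpt 1 (p ≫ (zBundle E).proj)) p h ≫ (θ (isSmoothAtlas_zObj Γ Y S)).hom = p := by
  set hz := isSmoothAtlas_zObj Γ Y S
  -- As `trivToZ x` lies over `qmap x`, the value of `E` at `triv x` is the pull-back of `zBundle E`
  -- to the torsor. Composed with the value of `E` at `fromTriv x`, which lies over `M → U`, this
  -- gives `θ`.
  have H {x : ProdScheme (quotientStack Γ Y) S} (hx : Atlas x) :
      ∃ l : ((zBundle E).baseChange (qmap x)).Hom (eobj E (isSmoothAtlas_triv hx)) (𝟙 _),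
        l.hom ≫ (emap E _ hz (trivToZ x)).hom = ((zBundle E).baseChangeHom (qmap x)).hom :=
    (emap E (isSmoothAtlas_triv hx) hz (trivToZ x)).exists_lift
      ((zBundle E).baseChangeHom (qmap x)) (𝟙 _) (Category.id_comp _)
  choose l hl using @H
  have hlp {x : ProdScheme (quotientStack Γ Y) S} (hx : Atlas x) {T : SchC}
      (m : T ⟶ (qobj x).bundle.tot) (p : T ⟶ (zBundle E).tot)
      (h : p ≫ (zBundle E).proj = m ≫ qmap x) :
      bpt m p h ≫ (l hx).hom ≫ (eobj E (isSmoothAtlas_triv hx)).proj = m := by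
    rw [(l hx).isPullback.w, Category.comp_id, bpt_proj]
  have ext {x : ProdScheme (quotientStack Γ Y) S} (hx : Atlas x) {T : SchC}
      {e e' : T ⟶ (eobj E (isSmoothAtlas_triv hx)).tot}
      (h : e ≫ (eobj E (isSmoothAtlas_triv hx)).proj = e' ≫ (eobj E (isSmoothAtlas_triv hx)).proj)
      (h' : e ≫ (emap E _ hz (trivToZ x)).hom = e' ≫ (emap E _ hz (trivToZ x)).hom) : e = e' :=
    (emap E (isSmoothAtlas_triv hx) hz (trivToZ x)).isPullback.hom_ext h' h
  let θ {x : ProdScheme (quotientStack Γ Y) S} (hx : Atlas x) :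
      ((zBundle E).baseChange (qmap x)).Hom (eobj E hx) (qobj x).bundle.proj :=
    (l hx).comp (emap E (isSmoothAtlas_triv hx) hx (fromTriv x)) (Category.id_comp _)
  have hθ {x : ProdScheme (quotientStack Γ Y) S} (hx : Atlas x) :
      (θ hx).hom = (l hx).hom ≫ (emap E (isSmoothAtlas_triv hx) hx (fromTriv x)).hom := rfl
  have nat : ∀ {x y : ProdScheme (quotientStack Γ Y) S} (hx : Atlas x) (hy : Atlas y) (k : x ⟶ y)
      {T : SchC} (m : T ⟶ (qobj x).bundle.tot) (p : T ⟶ (zBundle E).tot)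
      (h : p ≫ (zBundle E).proj = m ≫ qmap x)
      (h' : p ≫ (zBundle E).proj = (m ≫ (qarr k).tot) ≫ qmap y),
      bpt m p h ≫ (θ hx).hom ≫ (emap E hx hy k).hom =
        bpt (m ≫ (qarr k).tot) p h' ≫ (θ hy).hom := by
    intro x y hx hy k T m p h h'
    obtain ⟨k', h₁, h₂, h₃⟩ := exists_trivMap k
    rw [hθ, hθ, Category.assoc, ← emap_comp E (isSmoothAtlas_triv hx) hx hy, ← h₃,
      emap_comp E (isSmoothAtlas_triv hx) (isSmoothAtlas_triv hy) hy]
    have : bpt m p h ≫ (l hx).hom ≫ (emap E (isSmoothAtlas_triv hx) (isSmoothAtlas_triv hy) k').hom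
        = bpt (m ≫ (qarr k).tot) p h' ≫ (l hy).hom := by
      refine ext hy ?_ ?_
      · rw [Category.assoc, Category.assoc, (emap E _ _ k').isPullback.w, Category.assoc, hlp,
          reassoc_of% hlp hx m p h, h₁]
      · rw [Category.assoc, Category.assoc, ← emap_comp, h₂, hl, Category.assoc, hl, bpt_hom,
          bpt_hom]
    simpa using this =≫ (emap E (isSmoothAtlas_triv hy) hy (fromTriv y)).hom
  refine ⟨θ, nat, ?_, ?_⟩
  -- There is no action yet; `q` plays the role of `g⁻¹ • p`. Naturality is applied to both
  -- projections from `triv x` at the point `tpt g m`, which `fromTriv x` sends to `g • m` and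
  -- `trivToZ x` to `tpt g (m ≫ qmap x)`.
  · intro x hx T g m p q h h' hq e
    have h₁ : p ≫ (zBundle E).proj = tpt g m ≫ qmap (triv x) := by
      rw [h, smul_qmap, tpt_qmap_triv]
    have h₂ := nat (isSmoothAtlas_triv hx) hx (fromTriv x) (tpt g m) p h₁
      (by rw [tpt_fromTriv]; exact h)
    have h₃ := nat (isSmoothAtlas_triv hx) hz (trivToZ x) (tpt g m) p h₁
      (by rw [tpt_trivToZ]; exact h')
    have h₄ : bpt (tpt g m) p h₁ ≫ (θ (isSmoothAtlas_triv hx)).hom = bpt m q hq ≫ (l hx).hom := by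
      refine ext hx ?_ ?_
      · rw [Category.assoc, Category.assoc, hlp, (θ (isSmoothAtlas_triv hx)).isPullback.w,
          ← Category.assoc, bpt_proj, tpt_proj]
      · rw [Category.assoc, Category.assoc, h₃, hl, bpt_hom, ← e]
        congr 1
        exact bpt_congr (tpt_trivToZ x g m) rfl
    rw [hθ, ← reassoc_of% h₄, h₂]
    congr 1
    exact bpt_congr (tpt_fromTriv x g m).symm rfl
  · intro T p h
    -- The unit law of the future action: the diagonal is a section of both projections of `triv
    -- (zObj Γ Y S)`, and it lies at the unit of `Γ`.
    obtain ⟨e, h₁, h₂, h₃⟩ := exists_diag (Γ := Γ) (Y := Y) (S := S)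
    have h₄ : bpt (tpt 1 (p ≫ (zBundle E).proj)) p h ≫ (l hz).hom =
        p ≫ (emap E hz (isSmoothAtlas_triv hz) e).hom := by
      refine ext hz ?_ ?_
      · rw [Category.assoc, Category.assoc]
        refine (hlp hz _ p h).trans ?_
        rw [(emap E hz (isSmoothAtlas_triv hz) e).isPullback.w, h₃, comp_tpt, comp_tpt]
        simp [MonObj.comp_one]
      · rw [Category.assoc, Category.assoc, hl, bpt_hom, ← emap_comp, h₁, emap_id,
          Category.comp_id]
    rw [hθ, reassoc_of% h₄, ← emap_comp, h₂, emap_id, Category.comp_id]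

/-- The action of `Γ` on `zBundle E`. -/
lemma exists_zBundle_smul : ∃ (θ : ∀ {x : ProdScheme (quotientStack Γ Y) S} (hx : Atlas x),
      ((zBundle E).baseChange (qmap x)).Hom (eobj E hx) (qobj x).bundle.proj)
    (s : ∀ {T : SchC}, (T ⟶ Γ) → (T ⟶ (zBundle E).tot) → (T ⟶ (zBundle E).tot)),
    (∀ {x y : ProdScheme (quotientStack Γ Y) S} (hx : Atlas x) (hy : Atlas y) (k : x ⟶ y)
      {T : SchC} (m : T ⟶ (qobj x).bundle.tot) (p : T ⟶ (zBundle E).tot)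
      (h : p ≫ (zBundle E).proj = m ≫ qmap x)
      (h' : p ≫ (zBundle E).proj = (m ≫ (qarr k).tot) ≫ qmap y),
      bpt m p h ≫ (θ hx).hom ≫ (emap E hx hy k).hom =
        bpt (m ≫ (qarr k).tot) p h' ≫ (θ hy).hom) ∧
    (∀ {x : ProdScheme (quotientStack Γ Y) S} (hx : Atlas x) {T : SchC} (g : T ⟶ Γ)
      (m : T ⟶ (qobj x).bundle.tot) (p : T ⟶ (zBundle E).tot)
      (h : p ≫ (zBundle E).proj = m ≫ qmap x)
      (h' : s g p ≫ (zBundle E).proj = (g • m) ≫ qmap x),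
      bpt (g • m) (s g p) h' ≫ (θ hx).hom = bpt m p h ≫ (θ hx).hom) ∧
    (∀ {T' T : SchC} (t : T' ⟶ T) (g : T ⟶ Γ) (p : T ⟶ (zBundle E).tot),
      t ≫ s g p = s (t ≫ g) (t ≫ p)) ∧
    (∀ {T : SchC} (g : T ⟶ Γ) (p : T ⟶ (zBundle E).tot),
      s g p ≫ (zBundle E).proj = g • (p ≫ (zBundle E).proj)) ∧
    (∀ {T : SchC} (p : T ⟶ (zBundle E).tot), s 1 p = p) ∧
    (∀ {T : SchC} (g d : T ⟶ Γ) (p : T ⟶ (zBundle E).tot), s (g * d) p = s g (s d p)) ∧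
    ∀ {T : SchC} (g : T ⟶ Γ) (p : T ⟶ (zBundle E).tot) (d : T ⟶ G),
      s g ((zBundle E).smul p d) = (zBundle E).smul (s g p) d := by
  obtain ⟨θ, nat, key, one⟩ := exists_zBundle_hom E
  set hz := isSmoothAtlas_zObj Γ Y S
  have hw {T : SchC} (g : T ⟶ Γ) (p : T ⟶ (zBundle E).tot) : p ≫ (zBundle E).proj =
      tpt g⁻¹ (g • (p ≫ (zBundle E).proj)) ≫ qmap (zObj Γ Y S) := by
    rw [tpt_qmap_zObj, inv_smul_smul]
  -- At `zObj`, applying `θ` to a point `p` with torsor component `tpt d y` moves `p`, which lies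
  -- over `d • y`, to the point `d⁻¹ • p` over `y`. Hence the choice `d = g⁻¹` and `y = g • (p ≫
  -- (zBundle E).proj)`.
  let s {T : SchC} (g : T ⟶ Γ) (p : T ⟶ (zBundle E).tot) : T ⟶ (zBundle E).tot :=
    bpt (tpt g⁻¹ (g • (p ≫ (zBundle E).proj))) p (hw g p) ≫ (θ hz).hom
  have hs {T : SchC} (g : T ⟶ Γ) (p : T ⟶ (zBundle E).tot) (d : T ⟶ Γ) (y : T ⟶ Y ⊗ S)
      (h : p ≫ (zBundle E).proj = tpt d y ≫ qmap (zObj Γ Y S)) (hd : d = g⁻¹) :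
      bpt (tpt d y) p h ≫ (θ hz).hom = s g p := by
    congr 1
    refine bpt_congr ?_ rfl
    rw [h, tpt_qmap_zObj, hd, smul_inv_smul]
  have comp {T' T : SchC} (t : T' ⟶ T) (g : T ⟶ Γ) (p : T ⟶ (zBundle E).tot) :
      t ≫ s g p = s (t ≫ g) (t ≫ p) := by
    change t ≫ bpt _ _ _ ≫ _ = _
    rw [← Category.assoc, comp_bpt]
    congr 1
    refine bpt_congr ?_ rfl
    rw [comp_tpt, GrpObj.comp_inv, ModObj.comp_smul, Category.assoc]
  have proj {T : SchC} (g : T ⟶ Γ) (p : T ⟶ (zBundle E).tot) :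
      s g p ≫ (zBundle E).proj = g • (p ≫ (zBundle E).proj) := by
    change (_ ≫ _) ≫ _ = _
    rw [Category.assoc, (θ hz).isPullback.w, ← Category.assoc, bpt_proj, tpt_proj]
  have s_one {T : SchC} (p : T ⟶ (zBundle E).tot) : s 1 p = p := by
    have h : p ≫ (zBundle E).proj = tpt 1 (p ≫ (zBundle E).proj) ≫ qmap (zObj Γ Y S) := by
      rw [tpt_qmap_zObj, one_smul]
    rw [← hs 1 p 1 _ h inv_one.symm, one]
  have s_mul {T : SchC} (g d : T ⟶ Γ) (p : T ⟶ (zBundle E).tot) : s (g * d) p = s g (s d p) := by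
    have hy : g⁻¹ • (g * d) • (p ≫ (zBundle E).proj) = d • (p ≫ (zBundle E).proj) := by
      rw [mul_smul, inv_smul_smul]
    set y := (g * d) • (p ≫ (zBundle E).proj)
    have h₁ : p ≫ (zBundle E).proj = (d⁻¹ • tpt g⁻¹ y) ≫ qmap (zObj Γ Y S) := by
      rw [smul_tpt, tpt_qmap_zObj, mul_smul, hy, inv_smul_smul]
    have h₂ : p ≫ (zBundle E).proj =
        tpt d⁻¹ (tpt g⁻¹ y ≫ qmap (zObj Γ Y S)) ≫ qmap (zObj Γ Y S) := by
      rw [tpt_qmap_zObj, tpt_qmap_zObj, hy, inv_smul_smul]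
    have h₃ : s d p ≫ (zBundle E).proj = tpt g⁻¹ y ≫ qmap (zObj Γ Y S) := by
      rw [proj, tpt_qmap_zObj, hy]
    -- Associativity is the invariance of `θ` at the atlas `zObj` itself: translating its torsor
    -- component `g⁻¹` by `d⁻¹` on the left gives `(g * d)⁻¹`.
    have := key hz d⁻¹ (tpt g⁻¹ y) p (s d p) h₁ h₂ h₃ (hs d p _ _ h₂ rfl)
    rw [hs g (s d p) _ _ h₃ rfl] at this
    have e : tpt (g * d)⁻¹ y = d⁻¹ • tpt g⁻¹ y := by rw [smul_tpt, mul_inv_rev]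
    exact (congrArg (· ≫ (θ hz).hom)
      (bpt_congr (h := hw (g * d) p) (h' := h₁) e rfl)).trans this
  refine ⟨θ, s, nat, ?_, comp, proj, s_one, s_mul, ?_⟩
  · intro x hx T g m p h h'
    have h₁ : s g p ≫ (zBundle E).proj = tpt g (m ≫ qmap x) ≫ qmap (zObj Γ Y S) := by
      rw [h', smul_qmap, tpt_qmap_zObj]
    -- Invariance applied to the moved point `s g p`; moving it back by `g⁻¹` gives `p`.
    refine key hx g m (s g p) p h' h₁ h ?_
    rw [hs g⁻¹ (s g p) g _ h₁ (inv_inv g).symm, ← s_mul, inv_mul_cancel, s_one]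
  · intro T g p d
    have h₁ : (zBundle E).smul p d ≫ (zBundle E).proj =
        tpt g⁻¹ (g • (p ≫ (zBundle E).proj)) ≫ qmap (zObj Γ Y S) := by
      rw [PrincipalBundle.smul_proj]
      exact hw g p
    change s g ((zBundle E).smul p d) = (zBundle E).smul (s g p) d
    rw [← hs g ((zBundle E).smul p d) _ _ h₁ rfl, ← hs g p _ _ (hw g p) rfl, ← (θ hz).smul_hom,
      smul_bpt]

/-- Each principal bundle on `[Γ \ Y] × S` is the realization of a `(Γ, G)`-bundle over `Y × S`. -/
theorem exists_equivariant : ∃ (_ : ModObj Γ (zBundle E).tot)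
    (h₁ : γ[Γ, (zBundle E).tot] ≫ (zBundle E).proj = Γ ◁ (zBundle E).proj ≫ prodAction Γ Y S)
    (h₂ : Γ ◁ (zBundle E).act ≫ γ[Γ, (zBundle E).tot] =
      (α_ Γ (zBundle E).tot G).inv ≫ γ[Γ, (zBundle E).tot] ▷ G ≫ (zBundle E).act),
    Nonempty (Realization ⟨S, zBundle E, h₁, h₂⟩ E) := by
  obtain ⟨θ, s, nat, inv, comp, proj, s_one, s_mul, s_comm⟩ := exists_zBundle_smul E
  -- The operation `s` is natural in `T`, so by Yoneda it is given by its value at the universal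
  -- pair.
  let S₀ : Γ ⊗ (zBundle E).tot ⟶ (zBundle E).tot := s (fst _ _) (snd _ _)
  have hS₀ {T : SchC} (g : T ⟶ Γ) (p : T ⟶ (zBundle E).tot) : lift g p ≫ S₀ = s g p := by
    rw [comp, lift_fst, lift_snd]
  let act : ModObj Γ (zBundle E).tot := actionOfPoints _ S₀
    (fun m => by rw [hS₀, s_one]) (fun g h m => by rw [hS₀, hS₀, hS₀, s_mul])
  have hact {T : SchC} (g : T ⟶ Γ) (p : T ⟶ (zBundle E).tot) : g • p = s g p := hS₀ g p
  refine ⟨act, ?_, ?_, ⟨⟨θ, ?_, nat⟩⟩⟩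
  · exact equivariant_of_smul fun g p => by rw [hact, proj]
  · exact act_comm_of_smul fun g p d => by rw [hact, hact, s_comm]
  · intro x hx T g m p h h'
    have h₁ : s g p ≫ (zBundle E).proj = (g • m) ≫ qmap x := by
      rw [← hact]
      exact h'
    rw [← inv hx g m p h h₁]
    congr 1
    exact bpt_congr rfl (hact g p)

end

end

end BundleStacks

/-! ### Correspondence of morphisms under realizations -/

namespace BundleStacks

noncomputable section

open PrincipalBundle

section

variable {Γ : SchC} [GrpObj Γ] {G : SchC} [GrpObj G] {Y : SchC} [ModObj Γ Y]

/-- Both composites are the value at the diagonal of the square: one compatibility factors it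
through `a`, the other through `b`. -/
lemma happ_comm {S S' : SchC} {E : PrincipalBundleOn G (ProdScheme.p (quotientStack Γ Y) S)}
    {E' : PrincipalBundleOn G (ProdScheme.p (quotientStack Γ Y) S')} {h : S ⟶ S'} (φ : E.Hom E' h)
    {x' x : ProdScheme (quotientStack Γ Y) S} {y' y : ProdScheme (quotientStack Γ Y) S'}
    (hx' : Atlas x') (hx : Atlas x) (hy' : Atlas y') (hy : Atlas y) (a : x' ⟶ x) (b : y' ⟶ y)
    (k : (qobj x).Hom (qobj y)) (hk : k.base ≫ qhom y = qhom x ≫ h)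
    (k' : (qobj x').Hom (qobj y')) (hk' : k'.base ≫ qhom y' = qhom x' ≫ h)
    (e : (qarr a).base ≫ k.base = k'.base ≫ (qarr b).base)
    (e' : (qarr a).tot ≫ k.tot = k'.tot ≫ (qarr b).tot) :
    (emap E hx' hx a).hom ≫ (happ φ hx hy k hk).hom =
      (happ φ hx' hy' k' hk').hom ≫ (emap E' hy' hy b).hom := by
  have h₁ := φ.map_app hx' hx hy a k (a.left ≫ k) hk
    (by
      change ((qarr a).base ≫ k.base) ≫ qhom y = qhom x' ≫ h
      rw [Category.assoc, hk, reassoc_of% qarr_base_hom a]) rfl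
  have h₂ := φ.app_map hx' hy' hy k' b (a.left ≫ k) hk'
    (by
      change ((qarr a).base ≫ k.base) ≫ qhom y = qhom x' ≫ h
      rw [Category.assoc, hk, reassoc_of% qarr_base_hom a]) (QuotientObj.Hom.ext e.symm e'.symm)
  exact h₁.symm.trans h₂

/-- The map between the trivial objects on `Y × S` and `Y × S'`. -/
def zMap (Γ : SchC) [GrpObj Γ] (Y : SchC) [ModObj Γ Y] {S S' : SchC} (h : S ⟶ S') :
    (qobj (zObj Γ Y S)).Hom (qobj (zObj Γ Y S')) :=
  QuotientObj.trivialMap (Y ◁ h) (whiskerLeft_fst _ _)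

lemma zMap_hom {S S' : SchC} (h : S ⟶ S') :
    (zMap Γ Y h).base ≫ qhom (zObj Γ Y S') = qhom (zObj Γ Y S) ≫ h :=
  whiskerLeft_snd _ _

/-- A morphism of `(Γ, G)`-bundles is compatible with a pull-back diagram of the principal bundles
which realize them. -/
def Realization.Compat {P P' : EquivariantBunObj Γ G Y}
    {E : PrincipalBundleOn G (ProdScheme.p (quotientStack Γ Y) P.base)}
    {E' : PrincipalBundleOn G (ProdScheme.p (quotientStack Γ Y) P'.base)}
    (r : Realization P E) (r' : Realization P' E') {h : P.base ⟶ P'.base}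
    (f : P.bundle.Hom P'.bundle (Y ◁ h)) (φ : E.Hom E' h) : Prop :=
  ∀ {x : ProdScheme (quotientStack Γ Y) P.base} {y : ProdScheme (quotientStack Γ Y) P'.base}
    (hx : Atlas x) (hy : Atlas y) (k : (qobj x).Hom (qobj y)) (hk : k.base ≫ qhom y = qhom x ≫ h)
    {T : SchC} (m : T ⟶ (qobj x).bundle.tot) (p : T ⟶ P.bundle.tot)
    (w : p ≫ P.bundle.proj = m ≫ qmap x)
    (w' : (p ≫ f.hom) ≫ P'.bundle.proj = (m ≫ k.tot) ≫ qmap y),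
    bpt m p w ≫ (r.hom hx).hom ≫ (happ φ hx hy k hk).hom =
      bpt (m ≫ k.tot) (p ≫ f.hom) w' ≫ (r'.hom hy).hom

namespace Realization

variable [IsAlgebraicGroup Γ] {P P' P'' : EquivariantBunObj Γ G Y}
    {E : PrincipalBundleOn G (ProdScheme.p (quotientStack Γ Y) P.base)}
    {E' : PrincipalBundleOn G (ProdScheme.p (quotientStack Γ Y) P'.base)}
    {E'' : PrincipalBundleOn G (ProdScheme.p (quotientStack Γ Y) P''.base)}
    (r : Realization P E) (r' : Realization P' E') (r'' : Realization P'' E'')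

/-- The realization map is a base change of the torsor `M → U`, hence an epimorphism, so maps out of
a value of `E` are tested on pairs of a point of the torsor and a point of `P`. -/
lemma hom_ext {x : ProdScheme (quotientStack Γ Y) P.base} (hx : Atlas x) {W : SchC}
    {a b : (eobj E hx).tot ⟶ W}
    (h : ∀ {T : SchC} (m : T ⟶ (qobj x).bundle.tot) (p : T ⟶ P.bundle.tot)
      (w : p ≫ P.bundle.proj = m ≫ qmap x),
      bpt m p w ≫ (r.hom hx).hom ≫ a = bpt m p w ≫ (r.hom hx).hom ≫ b) : a = b := by
  have := (Cov.of_isPullback (r.hom hx).isPullback (qobj x).bundle.cov_proj).epi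
  obtain ⟨m, p, w, e⟩ := exists_bpt (𝟙 (P.bundle.baseChange (qmap x)).tot)
  rw [← cancel_epi (r.hom hx).hom, ← Category.id_comp (r.hom hx).hom, e, Category.assoc,
    Category.assoc, h]

omit [IsAlgebraicGroup Γ] in
lemma comp_proj {h : P.base ⟶ P'.base} (f : P.bundle.Hom P'.bundle (Y ◁ h))
    {x : ProdScheme (quotientStack Γ Y) P.base} {y : ProdScheme (quotientStack Γ Y) P'.base}
    (k : (qobj x).Hom (qobj y)) (hk : k.base ≫ qhom y = qhom x ≫ h)
    {T : SchC} {m : T ⟶ (qobj x).bundle.tot} {p : T ⟶ P.bundle.tot}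
    (w : p ≫ P.bundle.proj = m ≫ qmap x) :
    (p ≫ f.hom) ≫ P'.bundle.proj = (m ≫ k.tot) ≫ qmap y := by
  rw [Category.assoc, f.isPullback.w, reassoc_of% w, Category.assoc, tot_qmap k hk]

omit [IsAlgebraicGroup Γ] in
-- The realization map is cartesian: a point of `P` is determined by its torsor component together
-- with its image in `E`.
lemma point_ext {x : ProdScheme (quotientStack Γ Y) P.base} (hx : Atlas x) {T : SchC}
    {m m' : T ⟶ (qobj x).bundle.tot} {p q : T ⟶ P.bundle.tot} {w : p ≫ P.bundle.proj = m ≫ qmap x}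
    {w' : q ≫ P.bundle.proj = m' ≫ qmap x} (hm : m = m')
    (h : bpt m p w ≫ (r.hom hx).hom = bpt m' q w' ≫ (r.hom hx).hom) : p = q := by
  have e : bpt m p w = bpt m' q w' :=
    (r.hom hx).isPullback.hom_ext h (by rw [bpt_proj, bpt_proj, hm])
  rw [← bpt_hom m p w, e, bpt_hom]

/-- Each morphism of `(Γ, G)`-bundles induces a pull-back diagram. -/
lemma exists_compat_right (f : P.Hom P') : ∃ φ : E.Hom E' f.base, r.Compat r' f.map φ := by
  -- Each value is a descended morphism, characterized on points of the pull-backs; both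
  -- compatibilities are then checked on points with `hom_ext`, using naturality of `r` for the
  -- source and of `r'` for the target.
  have H {x : ProdScheme (quotientStack Γ Y) P.base} {y : ProdScheme (quotientStack Γ Y) P'.base}
      (hx : Atlas x) (hy : Atlas y) (k : (qobj x).Hom (qobj y))
      (hk : k.base ≫ qhom y = qhom x ≫ f.base) :=
    exists_desc_map f k hk (r.hom hx) (r'.hom hy) (r'.smul hy) (r.smul hx)
  choose χ hχ using @H
  refine ⟨⟨fun x hx y hy k hk => χ hx hy k hk, ?_, ?_⟩, fun hx hy k hk => hχ hx hy k hk⟩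
  · intro x' x hx' hx y hy a k k' hk hk' e
    refine r.hom_ext hx' fun {T} m p w => ?_
    have w₁ : p ≫ P.bundle.proj = (m ≫ (qarr a).tot) ≫ qmap x := by
      rw [w, Category.assoc, qarr_qmap]
    have h₁ := hχ hx' hy k' hk' m p w (comp_proj f.map k' hk' w)
    have h₂ := r.naturality hx' hx a m p w w₁ =≫ (χ hx hy k hk).hom
    have h₂' : bpt (m ≫ (qarr a).tot) p w₁ ≫ (r.hom hx).hom ≫ (χ hx hy k hk).hom =
        bpt m p w ≫ (r.hom hx').hom ≫ (emap E hx' hx a).hom ≫ (χ hx hy k hk).hom := by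
      simpa only [Category.assoc] using h₂.symm
    have h₃ := hχ hx hy k hk _ p w₁ (comp_proj f.map k hk w₁)
    have e' : (qarr a).tot ≫ QuotientObj.Hom.tot k = QuotientObj.Hom.tot k' :=
      congrArg QuotientObj.Hom.tot e
    refine h₁.trans (Eq.trans ?_ (Eq.trans h₃.symm h₂'))
    congr 1
    exact bpt_congr (by rw [Category.assoc, e']) rfl
  · intro x hx y y' hy hy' k b k' hk hk' e
    refine r.hom_ext hx fun {T} m p w => ?_
    have h₁ := hχ hx hy' k' hk' m p w (comp_proj f.map k' hk' w)
    have h₂ := hχ hx hy k hk m p w (comp_proj f.map k hk w)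
    have e' : QuotientObj.Hom.tot k ≫ (qarr b).tot = QuotientObj.Hom.tot k' :=
      congrArg QuotientObj.Hom.tot e
    have w₁ : (p ≫ f.map.hom) ≫ P'.bundle.proj =
        ((m ≫ QuotientObj.Hom.tot k) ≫ (qarr b).tot) ≫ qmap y' := by
      rw [Category.assoc _ _ (qmap y'), qarr_qmap]
      exact comp_proj f.map k hk w
    have h₂' : bpt (m ≫ QuotientObj.Hom.tot k) (p ≫ f.map.hom) (comp_proj f.map k hk w) ≫ (r'.hom hy).hom ≫
        (emap E' hy hy' b).hom =
        bpt m p w ≫ (r.hom hx).hom ≫ (χ hx hy k hk).hom ≫ (emap E' hy hy' b).hom := by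
      simpa only [Category.assoc] using (h₂ =≫ (emap E' hy hy' b).hom).symm
    have h₃ := r'.naturality hy hy' b _ _ (comp_proj f.map k hk w) w₁
    refine h₁.trans (Eq.trans ?_ (Eq.trans h₃.symm h₂'))
    congr 1
    exact bpt_congr (by rw [Category.assoc, e']) rfl

/-- The canonical isomorphism between a `(Γ, G)`-bundle and the value at the trivial object of the
principal bundle which realizes it. -/
lemma exists_iso : ∃ i : P.bundle.Hom (eobj E (isSmoothAtlas_zObj Γ Y P.base)) (𝟙 _),
    ∀ {T : SchC} (y : T ⟶ Y ⊗ P.base) (p : T ⟶ P.bundle.tot)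
      (w : p ≫ P.bundle.proj = tpt 1 y ≫ qmap (zObj Γ Y P.base)),
      bpt (tpt 1 y) p w ≫ (r.hom (isSmoothAtlas_zObj Γ Y P.base)).hom = p ≫ i.hom := by
  -- The unit section of the trivial torsor on `Y × S` lifts to `j`, and restricting the realization
  -- map at `zObj` along `j` gives the isomorphism.
  obtain ⟨j, hj⟩ := (P.bundle.baseChangeHom (qmap (zObj Γ Y P.base))).exists_lift
    (PrincipalBundle.Hom.id P.bundle) (tpt 1 (𝟙 (Y ⊗ P.base))) (by rw [tpt_qmap_zObj, one_smul])
  refine ⟨j.comp (r.hom (isSmoothAtlas_zObj Γ Y P.base)) (tpt_proj _ _), fun {T} y p w => ?_⟩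
  have : p ≫ j.hom = bpt (tpt 1 y) p w := by
    refine bpt_ext ?_ ?_
    · rw [bpt_hom, Category.assoc, hj]
      exact Category.comp_id _
    · rw [bpt_proj, Category.assoc, j.isPullback.w, reassoc_of% w, comp_tpt, comp_tpt,
        Category.comp_id, tpt_qmap_zObj, MonObj.comp_one, MonObj.comp_one, one_smul]
  rw [← this, Category.assoc]
  rfl

/-- Each pull-back diagram comes from a morphism of `(Γ, G)`-bundles. -/
lemma exists_compat_left {h : P.base ⟶ P'.base} (φ : E.Hom E' h) :
    ∃ f : P.bundle.Hom P'.bundle (Y ◁ h), r.Compat r' f φ := by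
  have hz := isSmoothAtlas_zObj Γ Y P.base
  have hz' := isSmoothAtlas_zObj Γ Y P'.base
  obtain ⟨i, hi⟩ := r.exists_iso
  obtain ⟨i', hi'⟩ := r'.exists_iso
  -- `f` is the value of `φ` on the canonical atlases, transported by the isomorphisms `i` and `i'`.
  obtain ⟨f, hf⟩ := i'.exists_lift
    (i.comp (happ φ hz hz' (zMap Γ Y h) (zMap_hom h)) (Category.id_comp _)) (Y ◁ h)
    (Category.comp_id _)
  replace hf : f.hom ≫ i'.hom = i.hom ≫ (happ φ hz hz' (zMap Γ Y h) (zMap_hom h)).hom := hf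
  refine ⟨f, ?_⟩
  intro x y hx hy k hk T m p w w'
  have hv := isSmoothAtlas_triv hx
  have hv' := isSmoothAtlas_triv hy
  -- Compatibility for arbitrary `x` and `y` is reduced to that at `zObj` through the trivial
  -- objects: `h₁` compares `triv` with the given atlases, `h₂` compares it with the canonical ones.
  let k' : (qobj (triv x)).Hom (qobj (triv y)) := QuotientObj.trivialMap k.tot k.toY
  have hk' : k'.base ≫ qhom (triv y) = qhom (triv x) ≫ h := by
    change k.tot ≫ (qobj y).bundle.proj ≫ qhom y = ((qobj x).bundle.proj ≫ qhom x) ≫ h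
    rw [← Category.assoc, k.isPullback.w, Category.assoc, hk, Category.assoc]
  have h₁ := happ_comm φ hv hx hv' hy (fromTriv x) (fromTriv y) k hk k' hk'
    k.isPullback.w.symm (QuotientObj.trivialMap_tot_comp_fromTrivial k).symm
  have h₂ := happ_comm φ hv hz hv' hz' (trivToZ x) (trivToZ y) (zMap Γ Y h) (zMap_hom h) k' hk'
    (tot_qmap k hk).symm (by
      have e : (qmap x ≫ Y ◁ h) ≫ fst Y P'.base = (qobj x).toY := by
        rw [Category.assoc, whiskerLeft_fst, qmap_fst]
      exact (QuotientObj.trivialMap_tot_comp (qmap_fst x) (whiskerLeft_fst _ _) e rfl).trans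
        (QuotientObj.trivialMap_tot_comp k.toY (qmap_fst y) e (tot_qmap k hk)).symm)
  have w₁ : p ≫ P.bundle.proj = tpt 1 m ≫ qmap (triv x) := by
    rw [tpt_qmap_triv, one_smul, w]
  have w₂ : (p ≫ f.hom) ≫ P'.bundle.proj = tpt 1 (m ≫ k.tot) ≫ qmap (triv y) := by
    rw [tpt_qmap_triv, one_smul, w']
  have e₁ : bpt m p w ≫ (r.hom hx).hom =
      bpt (tpt 1 m) p w₁ ≫ (r.hom hv).hom ≫ (emap E hv hx (fromTriv x)).hom := by
    rw [r.naturality hv hx (fromTriv x) (tpt 1 m) p w₁ (by rw [tpt_fromTriv, one_smul, w])]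
    congr 1
    exact bpt_congr (by rw [tpt_fromTriv, one_smul]) rfl
  have e₂ : bpt (m ≫ k.tot) (p ≫ f.hom) w' ≫ (r'.hom hy).hom =
      bpt (tpt 1 (m ≫ k.tot)) (p ≫ f.hom) w₂ ≫ (r'.hom hv').hom ≫
        (emap E' hv' hy (fromTriv y)).hom := by
    rw [r'.naturality hv' hy (fromTriv y) _ _ w₂ (by rw [tpt_fromTriv, one_smul, w'])]
    congr 1
    exact bpt_congr (by rw [tpt_fromTriv, one_smul]) rfl
  have e₃ : bpt (tpt 1 m) p w₁ ≫ (r.hom hv).hom ≫ (emap E hv hz (trivToZ x)).hom =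
      p ≫ i.hom := by
    have w₃ : p ≫ P.bundle.proj = tpt 1 (m ≫ qmap x) ≫ qmap (zObj Γ Y P.base) := by
      rw [tpt_qmap_zObj, one_smul, w]
    rw [r.naturality hv hz (trivToZ x) (tpt 1 m) p w₁ (by rw [tpt_trivToZ]; exact w₃),
      ← hi _ p w₃]
    congr 1
    exact bpt_congr (tpt_trivToZ x 1 m) rfl
  have e₄ : bpt (tpt 1 (m ≫ k.tot)) (p ≫ f.hom) w₂ ≫ (r'.hom hv').hom ≫
      (emap E' hv' hz' (trivToZ y)).hom = (p ≫ f.hom) ≫ i'.hom := by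
    have w₃ : (p ≫ f.hom) ≫ P'.bundle.proj =
        tpt 1 ((m ≫ k.tot) ≫ qmap y) ≫ qmap (zObj Γ Y P'.base) := by
      rw [tpt_qmap_zObj, one_smul, w']
    rw [r'.naturality hv' hz' (trivToZ y) _ _ w₂ (by rw [tpt_trivToZ]; exact w₃),
      ← hi' _ _ w₃]
    congr 1
    exact bpt_congr (tpt_trivToZ y 1 _) rfl
  have e₅ : bpt (tpt 1 m) p w₁ ≫ (r.hom hv).hom ≫ (happ φ hv hv' k' hk').hom =
      bpt (tpt 1 (m ≫ k.tot)) (p ≫ f.hom) w₂ ≫ (r'.hom hv').hom := by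
    -- The value of `E'` at `triv y` is the pull-back of its value at `zObj`. The component there
    -- agrees by the choice of `f`, and the component in the torsor is `m ≫ k.tot` on both sides.
    refine (emap E' hv' hz' (trivToZ y)).isPullback.hom_ext ?_ ?_
    · simp only [Category.assoc]
      rw [e₄, ← h₂, reassoc_of% e₃, Category.assoc, hf]
    · have c₁ : bpt (tpt 1 m) p w₁ ≫ (r.hom hv).hom ≫ (eobj E hv).proj = m := by
        rw [(r.hom hv).isPullback.w, ← Category.assoc, bpt_proj]
        exact tpt_proj 1 m
      have c₂ : bpt (tpt 1 (m ≫ k.tot)) (p ≫ f.hom) w₂ ≫ (r'.hom hv').hom ≫ (eobj E' hv').proj =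
          m ≫ k.tot := by
        rw [(r'.hom hv').isPullback.w, ← Category.assoc, bpt_proj]
        exact tpt_proj 1 (m ≫ k.tot)
      rw [Category.assoc, Category.assoc, Category.assoc, (happ φ hv hv' k' hk').isPullback.w, c₂,
        reassoc_of% c₁]
      rfl
  rw [reassoc_of% e₁, h₁, reassoc_of% e₅, e₂]

variable {r r'} in
-- At `zObj` the realization maps are `Γ`-invariant, so the image of `g • p` under `f` and the
-- `g`-translate of the image of `p` have the same image in `E'`. They also have the same torsor
-- component, so `point_ext` identifies them.
lemma Compat.equivariant {h : P.base ⟶ P'.base} {f : P.bundle.Hom P'.bundle (Y ◁ h)}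
    {φ : E.Hom E' h} (hf : r.Compat r' f φ) :
    γ[Γ, P.bundle.tot] ≫ f.hom = Γ ◁ f.hom ≫ γ[Γ, P'.bundle.tot] := by
  refine BundleStacks.equivariant_of_smul fun {T} g p => ?_
  have hz := isSmoothAtlas_zObj Γ Y P.base
  have hz' := isSmoothAtlas_zObj Γ Y P'.base
  obtain ⟨m, w⟩ : ∃ m : T ⟶ (qobj (zObj Γ Y P.base)).bundle.tot,
      p ≫ P.bundle.proj = m ≫ qmap (zObj Γ Y P.base) :=
    ⟨tpt 1 (p ≫ P.bundle.proj), by rw [tpt_qmap_zObj, one_smul]⟩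
  have w₁ : (g • p) ≫ P.bundle.proj = (g • m) ≫ qmap (zObj Γ Y P.base) := by
    rw [P.smul_proj, smul_qmap, w]
  have w₂ := comp_proj f _ (zMap_hom h) w
  have w₃ : (g • (p ≫ f.hom)) ≫ P'.bundle.proj =
      (g • (m ≫ (zMap Γ Y h).tot)) ≫ qmap (zObj Γ Y P'.base) := by
    rw [P'.smul_proj, smul_qmap, w₂]
  refine r'.point_ext hz' (w := comp_proj f _ (zMap_hom h) w₁) (w' := w₃)
    (smul_comp (zMap Γ Y h).equivariant g m) ?_
  rw [← hf hz hz' _ (zMap_hom h) _ _ w₁, r'.smul hz' g _ _ w₂, ← hf hz hz' _ (zMap_hom h) _ _ w,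
    ← Category.assoc, r.smul hz g m p w, Category.assoc]

variable {r r'} in
-- Evaluate both compatibilities at `zObj`, at the universal point of `P` placed over the unit
-- section, and cancel the realization of `P'` with `point_ext`.
lemma Compat.left_unique {h : P.base ⟶ P'.base} {f f' : P.bundle.Hom P'.bundle (Y ◁ h)}
    {φ : E.Hom E' h} (hf : r.Compat r' f φ) (hf' : r.Compat r' f' φ) : f = f' := by
  have hz := isSmoothAtlas_zObj Γ Y P.base
  have hz' := isSmoothAtlas_zObj Γ Y P'.base
  have w : 𝟙 _ ≫ P.bundle.proj = tpt 1 P.bundle.proj ≫ qmap (zObj Γ Y P.base) := by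
    rw [tpt_qmap_zObj, one_smul, Category.id_comp]
  have := r'.point_ext hz' (w := comp_proj f _ (zMap_hom h) w)
    (w' := comp_proj f' _ (zMap_hom h) w) rfl
    ((hf hz hz' _ (zMap_hom h) _ _ w _).symm.trans (hf' hz hz' _ (zMap_hom h) _ _ w _))
  exact PrincipalBundle.Hom.ext (by simpa using this)

variable {r r'} in
lemma Compat.right_unique {h : P.base ⟶ P'.base} {f : P.bundle.Hom P'.bundle (Y ◁ h)}
    {φ φ' : E.Hom E' h} (hf : r.Compat r' f φ) (hf' : r.Compat r' f φ') : φ = φ' := by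
  refine PrincipalBundleOn.Hom.ext ?_
  funext x hx y hy k hk
  refine PrincipalBundle.Hom.ext (r.hom_ext hx fun m p w => ?_)
  exact (hf hx hy k hk m p w (comp_proj f k hk w)).trans (hf' hx hy k hk m p w _).symm

end Realization

end

end

end BundleStacks

namespace BundleStacks

noncomputable section

open PrincipalBundle

section

variable {Γ : SchC} [GrpObj Γ] {G : SchC} [GrpObj G] {Y : SchC} [ModObj Γ Y]

/-! ### The equivalence -/

/-- A morphism `f` of `(Γ, G)`-bundles corresponds to a morphism `φ` of the principal bundles on the
quotient stack which realize them. -/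
def Realization.Related {P P' : EquivariantBunObj Γ G Y}
    {E : PrincipalBundleOn G (ProdScheme.p (quotientStack Γ Y) P.base)}
    {E' : PrincipalBundleOn G (ProdScheme.p (quotientStack Γ Y) P'.base)}
    (r : Realization P E) (r' : Realization P' E') (f : P ⟶ P')
    (φ : (⟨P.base, E⟩ : BunObj G (quotientStack Γ Y)) ⟶ ⟨P'.base, E'⟩) : Prop :=
  ∃ ψ : E.Hom E' (EquivariantBunObj.Hom.base f),
    φ = BunObj.Hom.mk (EquivariantBunObj.Hom.base f) ψ ∧
      r.Compat r' (EquivariantBunObj.Hom.map f) ψ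

namespace Realization

variable {P P' P'' : EquivariantBunObj Γ G Y}
    {E : PrincipalBundleOn G (ProdScheme.p (quotientStack Γ Y) P.base)}
    {E' : PrincipalBundleOn G (ProdScheme.p (quotientStack Γ Y) P'.base)}
    {E'' : PrincipalBundleOn G (ProdScheme.p (quotientStack Γ Y) P''.base)}
    {r : Realization P E} {r' : Realization P' E'} {r'' : Realization P'' E''}

lemma related_id : r.Related r (𝟙 P) (𝟙 _) := by
  refine ⟨PrincipalBundleOn.Hom.id E, rfl, fun {x y} hx hy k hk {T} m p w w' => ?_⟩
  have e : p ≫ (EquivariantBunObj.Hom.map (𝟙 P)).hom = p := by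
    change p ≫ 𝟙 _ ≫ 𝟙 _ = p
    simp
  have w₁ : p ≫ P.bundle.proj = (m ≫ k.tot) ≫ qmap y := by rwa [e] at w'
  refine (r.naturality hx hy (qhomMk k (hk.trans (Category.comp_id _))) m p w w₁).trans ?_
  exact congrArg (· ≫ (r.hom hy).hom) (bpt_congr rfl e.symm)

/-- Values of a composite pull-back diagram are computed through an intermediate atlas `y`, at which
the two compatibilities can be chained. -/
lemma Related.comp {f : P ⟶ P'} {f' : P' ⟶ P''}
    {φ : (⟨P.base, E⟩ : BunObj G (quotientStack Γ Y)) ⟶ ⟨P'.base, E'⟩}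
    {φ' : (⟨P'.base, E'⟩ : BunObj G (quotientStack Γ Y)) ⟶ ⟨P''.base, E''⟩}
    (h : r.Related r' f φ) (h' : r'.Related r'' f' φ') :
    r.Related r'' (f ≫ f') (φ ≫ φ') := by
  obtain ⟨ψ, rfl, hψ⟩ := h
  obtain ⟨ψ', rfl, hψ'⟩ := h'
  refine ⟨ψ.comp ψ', rfl, fun {x z} hx hz k hk {T} m p w w' => ?_⟩
  obtain ⟨y, hy, (a : (qobj x).Hom (qobj y)), (b : (qobj y).Hom (qobj z)), ha, hb, hab⟩ := PrincipalBundleOn.Hom.exists_factor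
    (EquivariantBunObj.Hom.base f) (EquivariantBunObj.Hom.base f') x z hz k hk
  have e₁ : (happ (ψ.comp ψ') hx hz k hk).hom =
      (happ ψ hx hy a ha).hom ≫ (happ ψ' hy hz b hb).hom :=
    PrincipalBundleOn.Hom.comp_app ψ ψ' hx hy hz a b k ha hb hk hab
  have w₁ := comp_proj (EquivariantBunObj.Hom.map f) a ha w
  have h₁ := hψ hx hy a ha m p w w₁
  have h₂ := hψ' hy hz b hb _ _ w₁ (comp_proj (EquivariantBunObj.Hom.map f') b hb w₁)
  have h₃ : bpt m p w ≫ (r.hom hx).hom ≫ (happ ψ hx hy a ha).hom ≫ (happ ψ' hy hz b hb).hom =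
      bpt (m ≫ a.tot) (p ≫ (EquivariantBunObj.Hom.map f).hom) w₁ ≫ (r'.hom hy).hom ≫
        (happ ψ' hy hz b hb).hom := by
    simpa only [Category.assoc] using h₁ =≫ (happ ψ' hy hz b hb).hom
  rw [e₁, h₃, h₂]
  have e₂ : a.tot ≫ b.tot = k.tot :=
    congrArg QuotientObj.Hom.tot hab
  refine congrArg (· ≫ (r''.hom hz).hom) (bpt_congr ?_ (Category.assoc _ _ _))
  rw [Category.assoc, e₂]

lemma Related.base_eq {f : P ⟶ P'}
    {φ : (⟨P.base, E⟩ : BunObj G (quotientStack Γ Y)) ⟶ ⟨P'.base, E'⟩}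
    (h : r.Related r' f φ) : BunObj.Hom.base φ = EquivariantBunObj.Hom.base f := by
  obtain ⟨ψ, rfl, -⟩ := h
  rfl

variable [IsAlgebraicGroup Γ]

lemma Related.left_unique {f f' : P ⟶ P'}
    {φ : (⟨P.base, E⟩ : BunObj G (quotientStack Γ Y)) ⟶ ⟨P'.base, E'⟩}
    (h : r.Related r' f φ) (h' : r.Related r' f' φ) : f = f' := by
  obtain ⟨f₀, f₁, f₂⟩ := f
  obtain ⟨g₀, g₁, g₂⟩ := f'
  obtain ⟨ψ, rfl, hψ⟩ := h
  obtain ⟨ψ', e, hψ'⟩ := h'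
  obtain rfl : f₀ = g₀ := congrArg BunObj.Hom.base e
  obtain rfl : ψ = ψ' := by injection e
  obtain rfl := hψ.left_unique hψ'
  rfl

lemma Related.right_unique {f : P ⟶ P'}
    {φ φ' : (⟨P.base, E⟩ : BunObj G (quotientStack Γ Y)) ⟶ ⟨P'.base, E'⟩}
    (h : r.Related r' f φ) (h' : r.Related r' f φ') : φ = φ' := by
  obtain ⟨ψ, rfl, hψ⟩ := h
  obtain ⟨ψ', rfl, hψ'⟩ := h'
  rw [hψ.right_unique hψ']

/-- Turns a commutative square of bundles on the stack into one of `(Γ, G)`-bundles; it yields the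
naturality of the unit. -/
lemma Related.comp_left_unique {Q : EquivariantBunObj Γ G Y}
    {H : PrincipalBundleOn G (ProdScheme.p (quotientStack Γ Y) Q.base)} {t : Realization Q H}
    {f : P ⟶ P'} {f' : P' ⟶ P''} {g : P ⟶ Q} {g' : Q ⟶ P''}
    {φ : (⟨P.base, E⟩ : BunObj G (quotientStack Γ Y)) ⟶ ⟨P'.base, E'⟩}
    {φ' : (⟨P'.base, E'⟩ : BunObj G (quotientStack Γ Y)) ⟶ ⟨P''.base, E''⟩}
    {χ : (⟨P.base, E⟩ : BunObj G (quotientStack Γ Y)) ⟶ ⟨Q.base, H⟩}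
    {χ' : (⟨Q.base, H⟩ : BunObj G (quotientStack Γ Y)) ⟶ ⟨P''.base, E''⟩}
    (h₁ : r.Related r' f φ) (h₂ : r'.Related r'' f' φ') (h₃ : r.Related t g χ)
    (h₄ : t.Related r'' g' χ') (e : φ ≫ φ' = χ ≫ χ') : f ≫ f' = g ≫ g' :=
  (h₁.comp h₂).left_unique (e ▸ h₃.comp h₄)

variable (r r')

lemma exists_related_right (f : P ⟶ P') : ∃ φ, r.Related r' f φ := by
  obtain ⟨ψ, hψ⟩ := r.exists_compat_right r' f
  exact ⟨_, ψ, rfl, hψ⟩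

lemma exists_related_left
    (φ : (⟨P.base, E⟩ : BunObj G (quotientStack Γ Y)) ⟶ ⟨P'.base, E'⟩) :
    ∃ f, r.Related r' f φ := by
  obtain ⟨f, hf⟩ := r.exists_compat_left r' (BunObj.Hom.map φ)
  exact ⟨⟨BunObj.Hom.base φ, f, hf.equivariant⟩, BunObj.Hom.map φ, rfl, hf⟩

/-- The morphism of principal bundles corresponding to a morphism of `(Γ, G)`-bundles. -/
def homRight (f : P ⟶ P') : (⟨P.base, E⟩ : BunObj G (quotientStack Γ Y)) ⟶ ⟨P'.base, E'⟩ :=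
  (r.exists_related_right r' f).choose

lemma homRight_related (f : P ⟶ P') : r.Related r' f (r.homRight r' f) :=
  (r.exists_related_right r' f).choose_spec

/-- The morphism of `(Γ, G)`-bundles corresponding to a morphism of principal bundles. -/
def homLeft (φ : (⟨P.base, E⟩ : BunObj G (quotientStack Γ Y)) ⟶ ⟨P'.base, E'⟩) : P ⟶ P' :=
  (r.exists_related_left r' φ).choose

lemma homLeft_related (φ : (⟨P.base, E⟩ : BunObj G (quotientStack Γ Y)) ⟶ ⟨P'.base, E'⟩) :
    r.Related r' (r.homLeft r' φ) φ :=
  (r.exists_related_left r' φ).choose_spec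

/-- Two principal bundles realizing the same `(Γ, G)`-bundle are isomorphic. -/
def isoRight {E₁ E₂ : PrincipalBundleOn G (ProdScheme.p (quotientStack Γ Y) P.base)}
    (r₁ : Realization P E₁) (r₂ : Realization P E₂) :
    (⟨P.base, E₁⟩ : BunObj G (quotientStack Γ Y)) ≅ ⟨P.base, E₂⟩ where
  hom := r₁.homRight r₂ (𝟙 P)
  inv := r₂.homRight r₁ (𝟙 P)
  hom_inv_id := by
    have := (r₁.homRight_related r₂ (𝟙 P)).comp (r₂.homRight_related r₁ (𝟙 P))
    rw [Category.comp_id] at this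
    exact this.right_unique related_id
  inv_hom_id := by
    have := (r₂.homRight_related r₁ (𝟙 P)).comp (r₁.homRight_related r₂ (𝟙 P))
    rw [Category.comp_id] at this
    exact this.right_unique related_id

/-- Two `(Γ, G)`-bundles realized by isomorphic principal bundles are isomorphic. -/
def isoLeft (j : (⟨P.base, E⟩ : BunObj G (quotientStack Γ Y)) ≅ ⟨P'.base, E'⟩) : P ≅ P' where
  hom := r.homLeft r' j.hom
  inv := r'.homLeft r j.inv
  hom_inv_id := by
    have := (r.homLeft_related r' j.hom).comp (r'.homLeft_related r j.inv)
    rw [j.hom_inv_id] at this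
    exact this.left_unique related_id
  inv_hom_id := by
    have := (r'.homLeft_related r j.inv).comp (r.homLeft_related r' j.hom)
    rw [j.inv_hom_id] at this
    exact this.left_unique related_id

end Realization

variable [IsAlgebraicGroup Γ]

/-- The `(Γ, G)`-bundle given by a principal bundle on the quotient stack. -/
def ofBun (B : BunObj G (quotientStack Γ Y)) : EquivariantBunObj Γ G Y :=
  letI := (exists_equivariant B.bundle).choose
  ⟨B.base, zBundle B.bundle, (exists_equivariant B.bundle).choose_spec.choose,
    (exists_equivariant B.bundle).choose_spec.choose_spec.choose⟩

/-- A principal bundle on the quotient stack realizes the associated `(Γ, G)`-bundle. -/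
def ofBunRealization (B : BunObj G (quotientStack Γ Y)) : Realization (ofBun B) B.bundle :=
  (exists_equivariant B.bundle).choose_spec.choose_spec.choose_spec.some

/-- The functor from principal bundles on the quotient stack to `(Γ, G)`-bundles. -/
def ofBunFunctor (Γ : SchC) [GrpObj Γ] (G : SchC) [GrpObj G] (Y : SchC) [ModObj Γ Y]
    [IsAlgebraicGroup Γ] :
    BasedFunctor (Bun G (quotientStack Γ Y)) (EquivariantBun Γ G Y) where
  obj B := ofBun B
  map {B B'} φ := (ofBunRealization B).homLeft (ofBunRealization B') φ
  -- Functoriality needs no formula for the chosen morphism: the identity and composites are related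
  -- to the right morphisms, and related morphisms are unique.
  map_id B := ((ofBunRealization B).homLeft_related _ _).left_unique Realization.related_id
  map_comp {_ _ _} φ φ' := (Realization.homLeft_related _ _ _).left_unique
    (((ofBunRealization _).homLeft_related (ofBunRealization _) φ).comp
      ((ofBunRealization _).homLeft_related (ofBunRealization _) φ'))
  w := by
    refine CategoryTheory.Functor.ext (fun B => rfl) fun B B' φ => ?_
    exact ((ofBunRealization B).homLeft_related (ofBunRealization B') φ).base_eq.symm.trans
      ((Category.id_comp _).trans (Category.comp_id _)).symm

variable [IsAffine G.left]

/-- The principal bundle on the quotient stack given by a `(Γ, G)`-bundle. -/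
def toBun (P : EquivariantBunObj Γ G Y) : BunObj G (quotientStack Γ Y) :=
  ⟨P.base, (exists_realization P).choose⟩

/-- The principal bundle associated to a `(Γ, G)`-bundle realizes it. -/
def toBunRealization (P : EquivariantBunObj Γ G Y) : Realization P (toBun P).bundle :=
  (exists_realization P).choose_spec.some

/-- The functor from `(Γ, G)`-bundles to principal bundles on the quotient stack. -/
def toBunFunctor (Γ : SchC) [GrpObj Γ] (G : SchC) [GrpObj G] (Y : SchC) [ModObj Γ Y]
    [IsAlgebraicGroup Γ] [IsAffine G.left] :
    BasedFunctor (EquivariantBun Γ G Y) (Bun G (quotientStack Γ Y)) where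
  obj P := toBun P
  map {P P'} f := (toBunRealization P).homRight (toBunRealization P') f
  map_id P := ((toBunRealization P).homRight_related _ _).right_unique Realization.related_id
  map_comp {_ _ _} f f' := (Realization.homRight_related _ _ _).right_unique
    (((toBunRealization _).homRight_related (toBunRealization _) f).comp
      ((toBunRealization _).homRight_related (toBunRealization _) f'))
  w := by
    refine CategoryTheory.Functor.ext (fun P => rfl) fun P P' f => ?_
    exact ((toBunRealization P).homRight_related (toBunRealization P') f).base_eq.trans
      ((Category.id_comp _).trans (Category.comp_id _)).symm

lemma isHomLift_of_map_eq_id {C D : Type*} [Category* C] [Category* D] {p : C ⥤ D} {a b : C}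
    (φ : a ⟶ b) (e : p.obj b = p.obj a) (h : p.map φ = eqToHom e.symm) :
    p.IsHomLift (𝟙 (p.obj a)) φ :=
  IsHomLift.of_fac _ _ _ rfl e (by simp [h])

/-- The composite on `(Γ, G)`-bundles is isomorphic to the identity. -/
def unitIso (Γ : SchC) [GrpObj Γ] (G : SchC) [GrpObj G] (Y : SchC) [ModObj Γ Y]
    [IsAlgebraicGroup Γ] [IsAffine G.left] :
    (toBunFunctor Γ G Y).comp (ofBunFunctor Γ G Y) ≅ BasedFunctor.id (EquivariantBun Γ G Y) :=
  BasedNatIso.mkNatIso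
    (NatIso.ofComponents
      -- Both `P` and `ofBun (toBun P)` are realized by the same bundle on the stack.
      (fun P => (ofBunRealization (toBun P)).isoLeft (toBunRealization P) (Iso.refl _))
      (fun {P P'} f =>
        ((ofBunRealization (toBun P)).homLeft_related (ofBunRealization (toBun P'))
          ((toBunFunctor Γ G Y).map f)).comp_left_unique
          ((ofBunRealization (toBun P')).homLeft_related (toBunRealization P') (𝟙 (toBun P')))
          ((ofBunRealization (toBun P)).homLeft_related (toBunRealization P) (𝟙 (toBun P)))
          ((toBunRealization P).homRight_related (toBunRealization P') f)
          ((Category.comp_id ((toBunFunctor Γ G Y).map f)).trans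
            (Category.id_comp ((toBunFunctor Γ G Y).map f)).symm)))
    (fun P => isHomLift_of_map_eq_id _ rfl
      ((ofBunRealization (toBun P)).homLeft_related (toBunRealization P) (𝟙 _)).base_eq.symm)

/-- The composite on principal bundles on the quotient stack is isomorphic to the identity. -/
def counitIso (Γ : SchC) [GrpObj Γ] (G : SchC) [GrpObj G] (Y : SchC) [ModObj Γ Y]
    [IsAlgebraicGroup Γ] [IsAffine G.left] :
    (ofBunFunctor Γ G Y).comp (toBunFunctor Γ G Y) ≅
      BasedFunctor.id (Bun G (quotientStack Γ Y)) :=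
  BasedNatIso.mkNatIso
    (NatIso.ofComponents
      -- Both `toBun (ofBun B)` and `B` realize the same `(Γ, G)`-bundle `ofBun B`.
      (fun B => (toBunRealization (ofBun B)).isoRight (ofBunRealization B))
      (fun {B B'} φ => by
        have h₁ := ((toBunRealization (ofBun B)).homRight_related (toBunRealization (ofBun B'))
          ((ofBunRealization B).homLeft (ofBunRealization B') φ)).comp
          ((toBunRealization (ofBun B')).homRight_related (ofBunRealization B') (𝟙 _))
        have h₂ := ((toBunRealization (ofBun B)).homRight_related (ofBunRealization B) (𝟙 _)).comp
          ((ofBunRealization B).homLeft_related (ofBunRealization B') φ)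
        rw [Category.comp_id] at h₁
        rw [Category.id_comp] at h₂
        exact h₁.right_unique h₂))
    (fun B => isHomLift_of_map_eq_id _ rfl
      ((toBunRealization (ofBun B)).homRight_related (ofBunRealization B) (𝟙 _)).base_eq)

end

end

end BundleStacks

theorem mainTheorem6 (Γ G : BundleStacks.SchC) [GrpObj Γ] [GrpObj G]
    [BundleStacks.IsAlgebraicGroup Γ] [BundleStacks.IsAlgebraicGroup G] [IsAffine G.left]
    (Y : BundleStacks.SchC) [ModObj Γ Y] :
    BundleStacks.IsEquivalent (BundleStacks.EquivariantBun Γ G Y)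
      (BundleStacks.Bun G (BundleStacks.quotientStack Γ Y)) :=
  ⟨BundleStacks.toBunFunctor Γ G Y, BundleStacks.ofBunFunctor Γ G Y,
    ⟨BundleStacks.unitIso Γ G Y⟩, ⟨BundleStacks.counitIso Γ G Y⟩⟩
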